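/- Let $\mathfrak h$ be a finite-dimensional complex vector space, $G\subset GL(\mathfrak h)$ a finite group generated by (complex) reflections and acting irreducibly on $\mathfrak h$, $\mathcal S\subset G$ its set of reflections, $t\in\mathbb C$, and $c:\mathcal S\to\mathbb C$ a conjugation-invariant function. For $s\in\mathcal S$ let $\alpha_s\in\mathfrak h^*$, $\alpha_s^\vee\in\mathfrak h$ be eigenvectors of $s$ for the nontrivial eigenvalues with $\alpha_s(\alpha_s^\vee)=2$. The rational Cherednik algebra $\mathsf H=\mathsf H_{t,c}(G,\mathfrak h)$ is the $\mathbb C$-algebra generated by $\mathfrak h$, $\mathfrak h^*$ and $\mathbb CG$ with the relations $[y,y']=0=[x,x']$, $gy=g(y)g$, $gx=g(x)g$, $[y,x]=t\,x(y)-\sum_{s\in\mathcal S}c(s)\,\alpha_s(y)\,x(\alpha_s^\vee)\,s$ for $y,y'\in\mathfrak h$, $x,x'\in\mathfrak h^*$, $g\in G$. It is $\mathbb Z$-graded with $\mathfrak h^*$, $\mathfrak h$, $G$ in degrees $1,-1,0$. For an irreducible finite-dimensional $G$-representation $\tau$ let $M_{t,c}(\tau)=\mathsf H\otimes_{\mathbb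 C[\mathfrak h^*]\rtimes\mathbb CG}\tau$ be the standard module ($\mathfrak h$ acts on $\tau$ by $0$), graded with $1\otimes\tau$ in degree $0$, and let $L_{t,c}(\tau)$ be its unique simple graded quotient, i.e. the quotient by the sum of all proper graded submodules. For graded $\mathsf H$-modules $X,Y$ let $X[\gamma]$ be the module $X$ with $X[\gamma]_\delta=X_{\delta-\gamma}$, and put $$\mathrm{EPgr}_{\mathsf H}(X,Y)=\sum_{\gamma\in\mathbb Z}\Big(\sum_{p\ge0}(-1)^p\dim\mathrm{Ext}^p(X[\gamma],Y)\Big)\mathbf q^\gamma ,$$ with $\mathrm{Ext}$ taken in the category of graded $\mathsf H$-modules and degree-$0$ homomorphisms. It is called well defined if all $\mathrm{Ext}^p(X[\gamma],Y)$ are finite dimensional and there is $N$ with $\mathrm{Ext}^p(X[\gamma],Y)=0$ for all $p>N$ and all $\gamma$. Let $S^*=\bigwedge\mathfrak h^*=S^{*,+}\oplus S^{*,-}$ (even and odd parts; $\bigwedge^\ell\mathfrak h^*$ in degree $\ell$), on which $x\in\mathfrak h^*$ acts by $\omega\mapsto 2x\wedge\omega$ and $y\in\mathfrak h$ by $\omega\mapsto-\partial_y\omega$.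 For a graded $\mathsf H$-module $X$ let $D_X=\sum_j(x_j\otimes y_j+y_j\otimes x_j)$ on $X\otimes S^*$, where $(y_j)$, $(x_j)$ are dual bases of $\mathfrak h$, $\mathfrak h^*$; let $D_X^\pm:X\otimes S^{*,\pm}\to X\otimes S^{*,\mp}$ be its restrictions, and $H_D^\pm(X)=\ker D_X^\pm/(\ker D_X^\pm\cap\mathrm{im}\,D_X^\mp)$, which are graded (by total degree) $G$-modules for the diagonal action of $G$. For irreducible $\sigma,\tau$ the Dirac index polynomial is $$d_{\sigma,\tau}(\mathbf q)=\sum_n\big(\dim\mathrm{Hom}_G(\tau,H_D^+(L_{t,c}(\sigma))_n)-\dim\mathrm{Hom}_G(\tau,H_D^-(L_{t,c}(\sigma))_n)\big)\mathbf q^n ,$$ the graded multiplicity of $\tau$ in the Dirac index $H_D^+(L_{t,c}(\sigma))-H_D^-(L_{t,c}(\sigma))$. **Corollary.** Let $\sigma,\tau$ be irreducible finite-dimensional $G$-representations. Then both pairings below are well defined, $H_D^\pm(L_{t,c}(\sigma))$ are finite dimensional, and $$\mathrm{EPgr}_{\mathsf H}(M_{t,c}(\tau),M_{t,c}(\sigma))=\delta_{\tau,\sigma},\qquad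 \mathrm{EPgr}_{\mathsf H}(M_{t,c}(\tau),L_{t,c}(\sigma))=d_{\sigma,\tau}(\mathbf q),$$ where $\delta_{\tau,\sigma}$ is $1$ if $\tau\cong\sigma$ and $0$ otherwise. -/

import Mathlib

open CategoryTheory CategoryTheory.Limits TensorProduct

universe u v

section GradedModules

/-- A family of subspaces is a grading as soon as it spans and there are linear maps `p n` which are
the identity on the `n`-th subspace and vanish on the others. -/
theorem isInternal_of_proj {X : Type v} [AddCommGroup X] [Module ℂ X] (deg : ℤ → Submodule ℂ X)
    (p : ℤ → X →ₗ[ℂ] X) (h1 : ∀ n, ∀ x ∈ deg n, p n x = x)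
    (h0 : ∀ m n, m ≠ n → ∀ x ∈ deg n, p m x = 0) (top : ⨆ n, deg n = ⊤) :
    DirectSum.IsInternal deg := by
  rw [DirectSum.isInternal_submodule_iff_iSupIndep_and_iSup_eq_top]
  refine ⟨fun n => ?_, top⟩
  rw [Submodule.disjoint_def]
  intro x hx hx'
  have hle : (⨆ (j : ℤ) (_ : j ≠ n), deg j) ≤ LinearMap.ker (p n) :=
    iSup₂_le fun j hj y hy => h0 n j (Ne.symm hj) y hy
  rw [← h1 n x hx]
  exact hle hx'

theorem iSup_deg_eq_top {X : Type v} [AddCommGroup X] [Module ℂ X] {deg : ℤ → Submodule ℂ X}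
    (h : DirectSum.IsInternal deg) : ⨆ n, deg n = ⊤ :=
  DirectSum.IsInternal.submodule_iSup_eq_top h

/-- The projection onto the `n`-th homogeneous component of a grading. -/
noncomputable def gradedProj {X : Type v} [AddCommGroup X] [Module ℂ X] {deg : ℤ → Submodule ℂ X}
    (h : DirectSum.IsInternal deg) (n : ℤ) : X →ₗ[ℂ] X :=
  (deg n).subtype ∘ₗ DirectSum.component ℂ ℤ (fun i => deg i) n ∘ₗ
    (LinearEquiv.ofBijective (DirectSum.coeLinearMap deg) h).symm.toLinearMap

section gradedProj

variable {X : Type v} [AddCommGroup X] [Module ℂ X] {deg : ℤ → Submodule ℂ X}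
  (h : DirectSum.IsInternal deg)

theorem gradedProj_mem (n : ℤ) (x : X) : gradedProj h n x ∈ deg n := by
  simp [gradedProj]

theorem gradedProj_same {n : ℤ} {x : X} (hx : x ∈ deg n) : gradedProj h n x = x := by
  have : (LinearEquiv.ofBijective (DirectSum.coeLinearMap deg) h).symm x
      = DirectSum.lof ℂ ℤ (fun i => deg i) n ⟨x, hx⟩ := by
    rw [LinearEquiv.symm_apply_eq]
    exact (DirectSum.coeLinearMap_lof deg n ⟨x, hx⟩).symm
  simp [gradedProj, this, DirectSum.component.lof_self]

theorem gradedProj_ne {m n : ℤ} (hmn : m ≠ n) {x : X} (hx : x ∈ deg n) :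
    gradedProj h m x = 0 := by
  have : (LinearEquiv.ofBijective (DirectSum.coeLinearMap deg) h).symm x
      = DirectSum.lof ℂ ℤ (fun i => deg i) n ⟨x, hx⟩ := by
    rw [LinearEquiv.symm_apply_eq]
    exact (DirectSum.coeLinearMap_lof deg n ⟨x, hx⟩).symm
  simp [gradedProj, this, DirectSum.component.of, hmn.symm]

theorem exists_sum_gradedProj (x : X) : ∃ s : Finset ℤ, x = ∑ n ∈ s, gradedProj h n x := by
  classical
  set y := (LinearEquiv.ofBijective (DirectSum.coeLinearMap deg) h).symm x with hy
  have hx : x = DirectSum.coeLinearMap deg y := by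
    have := (LinearEquiv.ofBijective (DirectSum.coeLinearMap deg) h).apply_symm_apply x
    rw [← hy] at this
    exact this.symm
  refine ⟨DFinsupp.support y, ?_⟩
  conv_lhs => rw [hx, DirectSum.coeLinearMap_eq_dfinsuppSum, DFinsupp.sum]
  rfl

end gradedProj

variable {A : Type u} [Ring A] [Algebra ℂ A]

/-- A `ℤ`-graded module over a `ℂ`-algebra `A` with grading `𝒜`: an `A`-module with a decomposition
`X = ⨁ₙ Xₙ` into complex subspaces such that `𝒜 i • X j ⊆ X (i + j)`. -/
structure GrMod (𝒜 : ℤ → Submodule ℂ A) where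
  carrier : Type v
  [isAddCommGroup : AddCommGroup carrier]
  [isModuleC : Module ℂ carrier]
  [isModule : Module A carrier]
  [isScalarTower : IsScalarTower ℂ A carrier]
  deg : ℤ → Submodule ℂ carrier
  isInternal : DirectSum.IsInternal deg
  smul_mem : ∀ {i j : ℤ} {a : A} {m : carrier}, a ∈ 𝒜 i → m ∈ deg j → a • m ∈ deg (i + j)

namespace GrMod

variable {𝒜 : ℤ → Submodule ℂ A}

instance : CoeSort (GrMod.{u, v} 𝒜) (Type v) := ⟨carrier⟩

attribute [instance] isAddCommGroup isModuleC isModule isScalarTower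

/-- Morphisms of graded modules: `A`-linear maps of degree `0`. -/
def homSubmodule (X Y : GrMod.{u, v} 𝒜) : Submodule ℂ (X →ₗ[A] Y) where
  carrier := {f | ∀ n, ∀ x ∈ X.deg n, f x ∈ Y.deg n}
  add_mem' hf hg n x hx := (Y.deg n).add_mem (hf n x hx) (hg n x hx)
  zero_mem' n _ _ := (Y.deg n).zero_mem
  smul_mem' c _ hf n x hx := (Y.deg n).smul_mem c (hf n x hx)

/-- The category of graded `A`-modules and `A`-linear maps of degree `0`. -/
instance : Category.{v} (GrMod.{u, v} 𝒜) where
  Hom X Y := homSubmodule X Y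
  id X := ⟨LinearMap.id, fun _ _ hx => hx⟩
  comp f g := ⟨g.1 ∘ₗ f.1, fun n x hx => g.2 n _ (f.2 n x hx)⟩

@[ext] theorem hom_ext {X Y : GrMod.{u, v} 𝒜} {f g : X ⟶ Y} (h : ∀ x, f.1 x = g.1 x) : f = g :=
  Subtype.ext (LinearMap.ext h)

@[simp] theorem comp_apply {X Y Z : GrMod.{u, v} 𝒜} (f : X ⟶ Y) (g : Y ⟶ Z) (x : X) :
    (f ≫ g).1 x = g.1 (f.1 x) := rfl

@[simp] theorem id_apply {X : GrMod.{u, v} 𝒜} (x : X) : (𝟙 X : X ⟶ X).1 x = x := rfl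

instance : Preadditive (GrMod.{u, v} 𝒜) where
  homGroup X Y := inferInstanceAs (AddCommGroup (homSubmodule X Y))
  add_comp _ _ _ f g h := Subtype.ext (LinearMap.ext fun x => map_add h.1 (f.1 x) (g.1 x))
  comp_add _ _ _ _ _ _ := rfl

instance : Linear ℂ (GrMod.{u, v} 𝒜) where
  homModule X Y := inferInstanceAs (Module ℂ (homSubmodule X Y))
  smul_comp _ _ _ c f g := Subtype.ext (LinearMap.ext fun x => by
    exact LinearMap.map_smul_of_tower g.1 c (f.1 x))
  comp_smul _ _ _ _ _ _ := rfl

@[simp] theorem zero_apply {X Y : GrMod.{u, v} 𝒜} (x : X) : (0 : X ⟶ Y).1 x = 0 := rfl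

@[simp] theorem add_apply {X Y : GrMod.{u, v} 𝒜} (f g : X ⟶ Y) (x : X) :
    (f + g).1 x = f.1 x + g.1 x := rfl

/-- The projection of a graded module onto its `n`-th component. -/
noncomputable def proj (X : GrMod.{u, v} 𝒜) (n : ℤ) : X →ₗ[ℂ] X := gradedProj X.isInternal n

theorem proj_hom {X Y : GrMod.{u, v} 𝒜} (f : X ⟶ Y) (n : ℤ) (x : X) :
    Y.proj n (f.1 x) = f.1 (X.proj n x) := by
  have hx : x ∈ ⨆ n, X.deg n := by rw [iSup_deg_eq_top X.isInternal]; trivial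
  induction hx using Submodule.iSup_induction' with
  | mem i x hx =>
    by_cases hi : n = i
    · subst hi
      rw [proj, proj, gradedProj_same _ hx, gradedProj_same _ (f.2 _ _ hx)]
    · rw [proj, proj, gradedProj_ne _ hi hx, gradedProj_ne _ hi (f.2 _ _ hx), map_zero]
  | zero => simp
  | add x y _ _ hx hy => rw [map_add, map_add, hx, hy, map_add, map_add]

/-- A submodule is homogeneous (graded) if it contains the homogeneous components of its
elements. -/
def IsHomogeneous (X : GrMod.{u, v} 𝒜) (N : Submodule A X) : Prop :=
  ∀ n, ∀ x ∈ N, X.proj n x ∈ N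

/-- A homogeneous submodule, as a graded module. -/
noncomputable def sub (X : GrMod.{u, v} 𝒜) (N : Submodule A X) (hN : X.IsHomogeneous N) :
    GrMod.{u, v} 𝒜 where
  carrier := N
  deg n := (X.deg n).comap (N.subtype.restrictScalars ℂ)
  isInternal := by
    let p : ℤ → N →ₗ[ℂ] N := fun n =>
      { toFun := fun x => ⟨X.proj n x, hN n x x.2⟩
        map_add' := fun x y => Subtype.ext (map_add _ _ _)
        map_smul' := fun c x => Subtype.ext (map_smul (X.proj n) c (x : X)) }
    refine isInternal_of_proj _ p (fun n x hx => Subtype.ext ?_)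
      (fun m n hmn x hx => Subtype.ext ?_) ?_
    · exact gradedProj_same X.isInternal hx
    · exact gradedProj_ne X.isInternal hmn hx
    · rw [eq_top_iff]
      rintro x -
      obtain ⟨s, hs⟩ := exists_sum_gradedProj X.isInternal (x : X)
      have : x = ∑ n ∈ s, p n x := by
        apply Subtype.ext
        rw [AddSubmonoidClass.coe_finsetSum]
        exact hs
      rw [this]
      exact Submodule.sum_mem _ fun n _ =>
        Submodule.mem_iSup_of_mem n (gradedProj_mem X.isInternal n (x : X))
  smul_mem ha hm := X.smul_mem ha hm

/-- The quotient of a graded module by a homogeneous submodule, as a graded module: its degree `n`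
part is the image of the degree `n` part. -/
noncomputable def quot (X : GrMod.{u, v} 𝒜) (N : Submodule A X) (hN : X.IsHomogeneous N) :
    GrMod.{u, v} 𝒜 where
  carrier := X ⧸ N
  deg n := (X.deg n).map (N.mkQ.restrictScalars ℂ)
  isInternal := by
    let p : ℤ → (X ⧸ N) →ₗ[ℂ] (X ⧸ N) := fun n =>
      (N.restrictScalars ℂ).liftQ ((N.mkQ.restrictScalars ℂ) ∘ₗ X.proj n) (fun x hx => by
        simpa using hN n x hx) ∘ₗ (Submodule.Quotient.restrictScalarsEquiv ℂ N).symm.toLinearMap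
    have hp : ∀ n x, p n (N.mkQ x) = N.mkQ (X.proj n x) := fun n x => rfl
    refine isInternal_of_proj _ p ?_ ?_ ?_
    · rintro n _ ⟨x, hx, rfl⟩
      exact (hp n x).trans (congrArg N.mkQ (gradedProj_same X.isInternal hx))
    · rintro m n hmn _ ⟨x, hx, rfl⟩
      exact (hp m x).trans ((congrArg N.mkQ (gradedProj_ne X.isInternal hmn hx)).trans
        (map_zero _))
    · rw [← Submodule.map_iSup, iSup_deg_eq_top X.isInternal, Submodule.map_top,
        LinearMap.range_eq_top]
      exact N.mkQ_surjective
  smul_mem := by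
    rintro i j a _ ha ⟨x, hx, rfl⟩
    exact ⟨a • x, X.smul_mem ha hx, map_smul N.mkQ a x⟩

/-- The direct sum of two graded modules. -/
noncomputable def prod (X Y : GrMod.{u, v} 𝒜) : GrMod.{u, v} 𝒜 where
  carrier := X × Y
  deg n := (X.deg n).prod (Y.deg n)
  isInternal := by
    refine isInternal_of_proj _ (fun n => (X.proj n).prodMap (Y.proj n)) ?_ ?_ ?_
    · rintro n ⟨x, y⟩ ⟨hx, hy⟩
      exact Prod.ext (gradedProj_same X.isInternal hx) (gradedProj_same Y.isInternal hy)
    · rintro m n hmn ⟨x, y⟩ ⟨hx, hy⟩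
      exact Prod.ext (gradedProj_ne X.isInternal hmn hx) (gradedProj_ne Y.isInternal hmn hy)
    · rw [eq_top_iff]
      rintro ⟨x, y⟩ -
      obtain ⟨s, hs⟩ := exists_sum_gradedProj X.isInternal x
      obtain ⟨t, ht⟩ := exists_sum_gradedProj Y.isInternal y
      have : ((x, y) : X × Y) = ∑ n ∈ s, (gradedProj X.isInternal n x, (0 : Y))
          + ∑ n ∈ t, ((0 : X), gradedProj Y.isInternal n y) := by
        refine Prod.ext ?_ ?_
        · rw [Prod.fst_add, Prod.fst_sum, Prod.fst_sum]; simpa using hs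
        · rw [Prod.snd_add, Prod.snd_sum, Prod.snd_sum]; simpa using ht
      rw [this]
      refine Submodule.add_mem _ (Submodule.sum_mem _ fun n _ => Submodule.mem_iSup_of_mem n ?_)
        (Submodule.sum_mem _ fun n _ => Submodule.mem_iSup_of_mem n ?_)
      · exact ⟨gradedProj_mem X.isInternal n x, (Y.deg n).zero_mem⟩
      · exact ⟨(X.deg n).zero_mem, gradedProj_mem Y.isInternal n y⟩
  smul_mem ha hm := ⟨X.smul_mem ha hm.1, Y.smul_mem ha hm.2⟩

/-- The zero graded module. -/
def zero : GrMod.{u, v} 𝒜 where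
  carrier := PUnit
  deg _ := ⊤
  isInternal := isInternal_of_proj _ (fun _ => 0) (fun _ _ _ => rfl) (fun _ _ _ _ _ => rfl)
    (by simp)
  smul_mem _ _ := trivial

instance : HasFiniteProducts (GrMod.{u, v} 𝒜) := by
  have : HasTerminal (GrMod.{u, v} 𝒜) := by
    have : ∀ X : GrMod.{u, v} 𝒜, Unique (X ⟶ zero) := fun X =>
      ⟨⟨0⟩, fun f => hom_ext fun x => rfl⟩
    exact hasTerminal_of_unique zero
  have : ∀ X Y : GrMod.{u, v} 𝒜, HasLimit (Limits.pair X Y) := fun X Y => by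
    refine HasLimit.mk ⟨BinaryFan.mk (P := prod X Y)
      ⟨LinearMap.fst A X Y, fun _ _ hx => hx.1⟩ ⟨LinearMap.snd A X Y, fun _ _ hx => hx.2⟩, ?_⟩
    refine BinaryFan.isLimitMk
      (fun s => ⟨LinearMap.prod s.fst.1 s.snd.1, fun n x hx => ⟨s.fst.2 n x hx, s.snd.2 n x hx⟩⟩)
      (fun s => rfl) (fun s => rfl) (fun s m h₁ h₂ => hom_ext fun x => Prod.ext ?_ ?_)
    · exact congrArg (fun g => g.1 x) h₁
    · exact congrArg (fun g => g.1 x) h₂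
  have : HasBinaryProducts (GrMod.{u, v} 𝒜) := hasBinaryProducts_of_hasLimit_pair _
  exact hasFiniteProducts_of_has_binary_and_terminal

theorem isHomogeneous_ker {X Y : GrMod.{u, v} 𝒜} (f : X ⟶ Y) :
    X.IsHomogeneous (LinearMap.ker f.1) := fun n x hx => by
  rw [LinearMap.mem_ker] at hx ⊢
  rw [← proj_hom, hx, map_zero]

theorem isHomogeneous_range {X Y : GrMod.{u, v} 𝒜} (f : X ⟶ Y) :
    Y.IsHomogeneous (LinearMap.range f.1) := by
  rintro n _ ⟨x, rfl⟩
  exact ⟨X.proj n x, (proj_hom f n x).symm⟩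

/-- The inclusion of a homogeneous submodule. -/
noncomputable def subι (X : GrMod.{u, v} 𝒜) (N : Submodule A X) (hN : X.IsHomogeneous N) :
    X.sub N hN ⟶ X :=
  ⟨N.subtype, fun _ _ hx => hx⟩

/-- The projection onto a quotient by a homogeneous submodule. -/
noncomputable def quotπ (X : GrMod.{u, v} 𝒜) (N : Submodule A X) (hN : X.IsHomogeneous N) :
    X ⟶ X.quot N hN :=
  ⟨N.mkQ, fun _ x hx => ⟨x, hx, rfl⟩⟩

theorem comp_eq_zero_iff {X Y Z : GrMod.{u, v} 𝒜} (f : X ⟶ Y) (g : Y ⟶ Z) :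
    f ≫ g = 0 ↔ ∀ x, g.1 (f.1 x) = 0 :=
  ⟨fun h x => congrArg (fun k => k.1 x) h, fun h => hom_ext h⟩

theorem mono_injective {X Y : GrMod.{u, v} 𝒜} (f : X ⟶ Y) [Mono f] : Function.Injective f.1 := by
  rw [← LinearMap.ker_eq_bot, eq_bot_iff]
  intro x hx
  have h0 : X.subι _ (isHomogeneous_ker f) ≫ f = 0 := hom_ext fun x => x.2
  have := congrArg (fun k => k.1 ⟨x, hx⟩) (Limits.zero_of_comp_mono f h0)
  exact this

theorem epi_surjective {X Y : GrMod.{u, v} 𝒜} (f : X ⟶ Y) [Epi f] : Function.Surjective f.1 := by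
  rw [← LinearMap.range_eq_top, eq_top_iff]
  intro y _
  have h0 : f ≫ Y.quotπ _ (isHomogeneous_range f) = 0 := hom_ext fun x => by
    exact (Submodule.Quotient.mk_eq_zero _).2 ⟨x, rfl⟩
  have := congrArg (fun k => k.1 y) (Limits.zero_of_epi_comp f h0)
  exact (Submodule.Quotient.mk_eq_zero _).1 this

/-- An injective morphism is the kernel of any morphism `g` with `ker g = range f`. -/
noncomputable def isLimitOfExact {X Y Z : GrMod.{u, v} 𝒜} (f : X ⟶ Y) (g : Y ⟶ Z) (w : f ≫ g = 0)
    (hf : Function.Injective f.1) (hfg : LinearMap.ker g.1 ≤ LinearMap.range f.1) :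
    IsLimit (KernelFork.ofι f w) :=
  haveI : Mono f := ⟨fun g h e => hom_ext fun x => hf (congrArg (fun k => k.1 x) e)⟩
  KernelFork.IsLimit.ofι' f w fun {W} k hk => by
    let e := LinearEquiv.ofInjective f.1 hf
    have hk' : ∀ x, k.1 x ∈ LinearMap.range f.1 := fun x =>
      hfg ((comp_eq_zero_iff k g).1 hk x)
    let l : W →ₗ[A] X := e.symm.toLinearMap ∘ₗ k.1.codRestrict _ hk'
    have hl : ∀ x, f.1 (l x) = k.1 x := fun x =>
      congrArg Subtype.val (e.apply_symm_apply ⟨k.1 x, hk' x⟩)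
    refine ⟨⟨l, fun n x hx => ?_⟩, hom_ext hl⟩
    have h1 : X.proj n (l x) = l x := by
      apply hf
      rw [← proj_hom, hl]
      exact gradedProj_same Y.isInternal (k.2 n x hx)
    rw [← h1]
    exact gradedProj_mem X.isInternal n _

/-- A surjective morphism is the cokernel of any morphism `f` with `ker g = range f`. -/
noncomputable def isColimitOfExact {X Y Z : GrMod.{u, v} 𝒜} (f : X ⟶ Y) (g : Y ⟶ Z)
    (w : f ≫ g = 0) (hg : Function.Surjective g.1)
    (hfg : LinearMap.ker g.1 ≤ LinearMap.range f.1) : IsColimit (CokernelCofork.ofπ g w) :=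
  haveI : Epi g := ⟨fun k l e => hom_ext fun z => by
    obtain ⟨y, rfl⟩ := hg z
    exact congrArg (fun k => k.1 y) e⟩
  CokernelCofork.IsColimit.ofπ' g w fun {W} k hk => by
    have hk' : LinearMap.ker g.1 ≤ LinearMap.ker k.1 := by
      refine hfg.trans ?_
      rintro _ ⟨x, rfl⟩
      exact (comp_eq_zero_iff f k).1 hk x
    let e := g.1.quotKerEquivOfSurjective hg
    let l : Z →ₗ[A] W := (LinearMap.ker g.1).liftQ k.1 hk' ∘ₗ e.symm.toLinearMap
    have hl : ∀ y, l (g.1 y) = k.1 y := fun y => by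
      have : e.symm (g.1 y) = (LinearMap.ker g.1).mkQ y := by
        rw [LinearEquiv.symm_apply_eq]; rfl
      change (LinearMap.ker g.1).liftQ k.1 hk' (e.symm (g.1 y)) = _
      rw [this]; rfl
    refine ⟨⟨l, fun n z hz => ?_⟩, hom_ext hl⟩
    obtain ⟨y, rfl⟩ := hg z
    have h1 : g.1 (Y.proj n y) = g.1 y := by
      rw [← proj_hom]; exact gradedProj_same Z.isInternal hz
    rw [← h1, hl]
    exact k.2 n _ (gradedProj_mem Y.isInternal n y)

/-- The category of graded modules is abelian. -/
noncomputable instance : Abelian (GrMod.{u, v} 𝒜) where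
  has_kernels := ⟨fun {X Y} f => by
    have w : X.subι _ (isHomogeneous_ker f) ≫ f = 0 := hom_ext fun x => x.2
    exact HasLimit.mk ⟨_, isLimitOfExact (X.subι _ (isHomogeneous_ker f)) f w
      Subtype.val_injective (Submodule.range_subtype _).ge⟩⟩
  has_cokernels := ⟨fun {X Y} f => by
    have w : f ≫ Y.quotπ _ (isHomogeneous_range f) = 0 := hom_ext fun x => by
      exact (Submodule.Quotient.mk_eq_zero _).2 ⟨x, rfl⟩
    exact HasColimit.mk ⟨_, isColimitOfExact f (Y.quotπ _ (isHomogeneous_range f)) w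
      (Submodule.mkQ_surjective _) (Submodule.ker_mkQ _).le⟩⟩
  normalMonoOfMono {X Y} f _ := by
    have w : f ≫ Y.quotπ _ (isHomogeneous_range f) = 0 := hom_ext fun x => by
      exact (Submodule.Quotient.mk_eq_zero _).2 ⟨x, rfl⟩
    exact ⟨⟨_, Y.quotπ _ (isHomogeneous_range f), w, isLimitOfExact _ _ w (mono_injective f)
      (Submodule.ker_mkQ _).le⟩⟩
  normalEpiOfEpi {X Y} f _ := by
    have w : X.subι _ (isHomogeneous_ker f) ≫ f = 0 := hom_ext fun x => x.2
    exact ⟨⟨_, X.subι _ (isHomogeneous_ker f), w, isColimitOfExact _ _ w (epi_surjective f)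
      (Submodule.range_subtype _).ge⟩⟩

noncomputable instance : HasExt.{max (max u (v + 1)) v} (GrMod.{u, v} 𝒜) := HasExt.standard _

/-- The shift `X[γ]`: the same module with `X[γ]_δ = X_{δ - γ}`. -/
def shift (X : GrMod.{u, v} 𝒜) (γ : ℤ) : GrMod.{u, v} 𝒜 where
  carrier := X
  deg δ := X.deg (δ - γ)
  isInternal := by
    refine isInternal_of_proj _ (fun n => X.proj (n - γ))
      (fun n x hx => gradedProj_same X.isInternal hx)
      (fun m n hmn x hx => gradedProj_ne X.isInternal (by omega) hx) ?_
    rw [← iSup_deg_eq_top X.isInternal]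
    exact (Equiv.subRight γ).iSup_comp (g := X.deg)
  smul_mem {i j} _ _ ha hm := by
    have := X.smul_mem ha hm
    rwa [← add_sub_assoc] at this

/-- The degree `γ` component `Ext^p(X[γ], Y)` of the graded `Ext^p(X, Y)`, the `Ext`-group being
that of the abelian category of graded modules. -/
abbrev GrExt (X Y : GrMod.{u, v} 𝒜) (p : ℕ) (γ : ℤ) : Type (max u (v + 1)) :=
  Abelian.Ext.{max u (v + 1)} (X.shift γ) Y p

end GrMod

end GradedModules

section Cherednik

open Module

variable {h : Type u} [AddCommGroup h] [Module ℂ h]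

/-- A (complex) reflection: an invertible linear map `s` such that `s - 1` has rank one. -/
def IsCReflection (s : h ≃ₗ[ℂ] h) : Prop :=
  finrank ℂ (LinearMap.range ((s : h →ₗ[ℂ] h) - LinearMap.id)) = 1

/-- The set `𝒮` of reflections contained in `G`. -/
abbrev Refl (G : Subgroup (h ≃ₗ[ℂ] h)) : Type u := {s : G // IsCReflection (s : h ≃ₗ[ℂ] h)}

noncomputable instance (G : Subgroup (h ≃ₗ[ℂ] h)) [Finite G] : Fintype (Refl G) :=
  Fintype.ofFinite _

/-- The action of `G` on `𝔥`. -/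
def reflRep (G : Subgroup (h ≃ₗ[ℂ] h)) : Representation ℂ G h where
  toFun g := (g : h ≃ₗ[ℂ] h).toLinearMap
  map_one' := rfl
  map_mul' _ _ := rfl

/-- `G` is generated by the reflections it contains and acts irreducibly on `𝔥`. -/
structure IsIrredReflectionGroup (G : Subgroup (h ≃ₗ[ℂ] h)) : Prop where
  generated : Subgroup.closure {s : G | IsCReflection (s : h ≃ₗ[ℂ] h)} = ⊤
  irreducible : (reflRep G).IsIrreducible

/-- A choice, for every reflection `s`, of eigenvectors `α_s ∈ 𝔥*`, `α_s^∨ ∈ 𝔥` of `s` for the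
nontrivial eigenvalues, normalised by `α_s(α_s^∨) = 2`. -/
structure RootChoice (G : Subgroup (h ≃ₗ[ℂ] h)) where
  α : Refl G → Dual ℂ h
  αv : Refl G → h
  eigen : ∀ s, ∃ μ : ℂ, μ ≠ 1 ∧ (reflRep G).dual s.1 (α s) = μ • α s
  eigenv : ∀ s, ∃ μ : ℂ, μ ≠ 1 ∧ reflRep G s.1 (αv s) = μ • αv s
  pairing : ∀ s, α s (αv s) = 2

/-- A parameter function `c : 𝒮 → ℂ` is conjugation invariant. -/
def IsConjInvariant {G : Subgroup (h ≃ₗ[ℂ] h)} (c : Refl G → ℂ) : Prop :=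
  ∀ (g : G) (s s' : Refl G), s'.1 = g * s.1 * g⁻¹ → c s' = c s

/-- Generators of the rational Cherednik algebra: the elements of `𝔥*`, of `𝔥` and of `G`. -/
inductive CherGen (G : Subgroup (h ≃ₗ[ℂ] h)) : Type u
  | x (ξ : Dual ℂ h)
  | y (η : h)
  | g (g : G)

/-- The data defining a rational Cherednik algebra. -/
structure CherData (G : Subgroup (h ≃ₗ[ℂ] h)) where
  t : ℂ
  c : Refl G → ℂ
  conj : IsConjInvariant c
  roots : RootChoice G

variable {G : Subgroup (h ≃ₗ[ℂ] h)} [Finite G]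

open FreeAlgebra in
/-- The defining relations of `H_{t,c}(G, 𝔥)`: those making the generators in `𝔥` and `𝔥*` linear and
those in `G` multiplicative, followed by `[y,y'] = 0 = [x,x']`, `gy = g(y)g`, `gx = g(x)g` and
`[y,x] = t x(y) - ∑ₛ c(s) αₛ(y) x(αₛ^∨) s`. -/
inductive CherRel (D : CherData G) : FreeAlgebra ℂ (CherGen G) → FreeAlgebra ℂ (CherGen G) → Prop
  | x_add (ξ ξ' : Dual ℂ h) : CherRel D (ι ℂ (.x (ξ + ξ'))) (ι ℂ (.x ξ) + ι ℂ (.x ξ'))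
  | x_smul (a : ℂ) (ξ : Dual ℂ h) : CherRel D (ι ℂ (.x (a • ξ))) (a • ι ℂ (.x ξ))
  | y_add (η η' : h) : CherRel D (ι ℂ (.y (η + η'))) (ι ℂ (.y η) + ι ℂ (.y η'))
  | y_smul (a : ℂ) (η : h) : CherRel D (ι ℂ (.y (a • η))) (a • ι ℂ (.y η))
  | g_one : CherRel D (ι ℂ (.g 1)) 1
  | g_mul (g g' : G) : CherRel D (ι ℂ (.g (g * g'))) (ι ℂ (.g g) * ι ℂ (.g g'))
  | y_comm (η η' : h) : CherRel D (ι ℂ (.y η) * ι ℂ (.y η')) (ι ℂ (.y η') * ι ℂ (.y η))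
  | x_comm (ξ ξ' : Dual ℂ h) : CherRel D (ι ℂ (.x ξ) * ι ℂ (.x ξ')) (ι ℂ (.x ξ') * ι ℂ (.x ξ))
  | g_y (g : G) (η : h) :
      CherRel D (ι ℂ (.g g) * ι ℂ (.y η)) (ι ℂ (.y (reflRep G g η)) * ι ℂ (.g g))
  | g_x (g : G) (ξ : Dual ℂ h) :
      CherRel D (ι ℂ (.g g) * ι ℂ (.x ξ)) (ι ℂ (.x ((reflRep G).dual g ξ)) * ι ℂ (.g g))
  | y_x (η : h) (ξ : Dual ℂ h) :
      CherRel D (ι ℂ (.y η) * ι ℂ (.x ξ) - ι ℂ (.x ξ) * ι ℂ (.y η))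
        (algebraMap ℂ _ (D.t * ξ η) -
          ∑ s : Refl G, (D.c s * D.roots.α s η * ξ (D.roots.αv s)) • ι ℂ (.g s.1))

/-- The rational Cherednik algebra `H_{t,c}(G, 𝔥)`. -/
def Cher (D : CherData G) : Type u := RingQuot (CherRel D)

namespace Cher

variable (D : CherData G)

noncomputable instance : Ring (Cher D) := inferInstanceAs (Ring (RingQuot (CherRel D)))

noncomputable instance : Algebra ℂ (Cher D) := inferInstanceAs (Algebra ℂ (RingQuot (CherRel D)))

/-- The quotient map from the free algebra. -/
noncomputable def mk : FreeAlgebra ℂ (CherGen G) →ₐ[ℂ] Cher D := RingQuot.mkAlgHom ℂ (CherRel D)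

/-- The class of a generator. -/
noncomputable def gen (z : CherGen G) : Cher D := mk D (FreeAlgebra.ι ℂ z)

variable {D} in
theorem mk_rel {a b : FreeAlgebra ℂ (CherGen G)} (hab : CherRel D a b) : mk D a = mk D b :=
  RingQuot.mkAlgHom_rel ℂ hab

theorem mk_ι (z : CherGen G) : mk D (FreeAlgebra.ι ℂ z) = gen D z := rfl

/-- The linear map `𝔥* → H_{t,c}`. -/
noncomputable def x : Dual ℂ h →ₗ[ℂ] Cher D where
  toFun ξ := gen D (.x ξ)
  map_add' ξ ξ' := (mk_rel (.x_add ξ ξ')).trans (map_add _ _ _)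
  map_smul' a ξ := (mk_rel (.x_smul a ξ)).trans (map_smul _ _ _)

/-- The linear map `𝔥 → H_{t,c}`. -/
noncomputable def y : h →ₗ[ℂ] Cher D where
  toFun η := gen D (.y η)
  map_add' η η' := (mk_rel (.y_add η η')).trans (map_add _ _ _)
  map_smul' a η := (mk_rel (.y_smul a η)).trans (map_smul _ _ _)

/-- The multiplicative map `G → H_{t,c}`. -/
noncomputable def g : G →* Cher D where
  toFun g := gen D (.g g)
  map_one' := (mk_rel .g_one).trans (map_one _)
  map_mul' g g' := (mk_rel (.g_mul g g')).trans (map_mul _ _ _)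

theorem g_mul_y (g : G) (η : h) : Cher.g D g * y D η = y D (reflRep G g η) * Cher.g D g :=
  (map_mul _ _ _).symm.trans ((mk_rel (.g_y g η)).trans (map_mul _ _ _))

theorem g_mul_x (g : G) (ξ : Dual ℂ h) :
    Cher.g D g * x D ξ = x D ((reflRep G).dual g ξ) * Cher.g D g :=
  (map_mul _ _ _).symm.trans ((mk_rel (.g_x g ξ)).trans (map_mul _ _ _))

/-- The degree of a generator: `1` on `𝔥*`, `-1` on `𝔥`, `0` on `G`. -/
def genDeg : CherGen G → ℤ
  | .x _ => 1
  | .y _ => -1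
  | .g _ => 0

/-- The grading of `H_{t,c}`: `H_n` is spanned by the products of generators of total degree `n`. -/
noncomputable def deg (n : ℤ) : Submodule ℂ (Cher D) :=
  Submodule.span ℂ {a | ∃ l : List (CherGen G), (l.map genDeg).sum = n ∧ a = (l.map (gen D)).prod}

theorem mul_mem_deg {i j : ℤ} {a b : Cher D} (ha : a ∈ deg D i) (hb : b ∈ deg D j) :
    a * b ∈ deg D (i + j) := by
  have := Submodule.mul_mem_mul ha hb
  rw [deg, deg, Submodule.span_mul_span] at this
  refine Submodule.span_mono ?_ this
  rintro _ ⟨_, ⟨l, rfl, rfl⟩, _, ⟨l', rfl, rfl⟩, rfl⟩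
  exact ⟨l ++ l', by simp, by simp⟩

theorem gen_mem_deg (z : CherGen G) : gen D z ∈ deg D (genDeg z) :=
  Submodule.subset_span ⟨[z], by simp, by simp⟩

theorem one_mem_deg : (1 : Cher D) ∈ deg D 0 := Submodule.subset_span ⟨[], by simp, by simp⟩

theorem iSup_deg : ⨆ n, deg D n = ⊤ := by
  rw [eq_top_iff]
  rintro a -
  obtain ⟨b, rfl⟩ := RingQuot.mkAlgHom_surjective ℂ (CherRel D) a
  have hb : b ∈ Submodule.span ℂ (Set.range
      fun l : List (CherGen G) => (l.map (FreeAlgebra.ι ℂ)).prod) := by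
    induction b using FreeAlgebra.induction with
    | grade0 r =>
      rw [Algebra.algebraMap_eq_smul_one]
      exact Submodule.smul_mem _ _ (Submodule.subset_span ⟨[], by simp⟩)
    | grade1 z => exact Submodule.subset_span ⟨[z], by simp⟩
    | mul a b ha hb =>
      have := Submodule.mul_mem_mul ha hb
      rw [Submodule.span_mul_span] at this
      refine Submodule.span_mono ?_ this
      rintro _ ⟨_, ⟨l, rfl⟩, _, ⟨l', rfl⟩, rfl⟩
      exact ⟨l ++ l', by simp⟩
    | add a b ha hb => exact Submodule.add_mem _ ha hb
  induction hb using Submodule.span_induction with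
  | mem _ hx =>
    obtain ⟨l, rfl⟩ := hx
    refine Submodule.mem_iSup_of_mem (l.map genDeg).sum (Submodule.subset_span ⟨l, rfl, ?_⟩)
    rw [map_list_prod, List.map_map]
    rfl
  | zero => rw [map_zero]; exact Submodule.zero_mem _
  | add _ _ _ _ h₁ h₂ => rw [map_add]; exact Submodule.add_mem _ h₁ h₂
  | smul r _ _ h => rw [map_smul]; exact Submodule.smul_mem _ _ h

theorem y_mul_x (η : h) (ξ : Dual ℂ h) :
    gen D (.y η) * gen D (.x ξ) - gen D (.x ξ) * gen D (.y η) = algebraMap ℂ (Cher D) (D.t * ξ η) -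
      ∑ s : Refl G, (D.c s * D.roots.α s η * ξ (D.roots.αv s)) • gen D (.g s.1) := by
  have := mk_rel (CherRel.y_x (D := D) η ξ)
  rw [map_sub, map_sub, map_sum, map_mul, map_mul, AlgHom.commutes] at this
  simp only [map_smul] at this
  exact this

/-- The coaction `H_{t,c} → H_{t,c}[q, q⁻¹]`, `a ↦ a qⁿ` for `a` of degree `n`, used to see that the
sum of the `H_n` is direct. -/
noncomputable def coaction : Cher D →ₐ[ℂ] AddMonoidAlgebra (Cher D) ℤ :=
  RingQuot.liftAlgHom ℂ ⟨FreeAlgebra.lift ℂ fun z => AddMonoidAlgebra.single (genDeg z) (gen D z), by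
    intro a b hab
    have key := mk_rel hab
    cases hab with
    | y_x η ξ =>
      have e : AddMonoidAlgebra.single (0 : ℤ) (gen D (.y η) * gen D (.x ξ))
          - AddMonoidAlgebra.single (0 : ℤ) (gen D (.x ξ) * gen D (.y η)) =
          algebraMap ℂ (AddMonoidAlgebra (Cher D) ℤ) (D.t * ξ η) - ∑ s : Refl G,
            (D.c s * D.roots.α s η * ξ (D.roots.αv s)) •
              AddMonoidAlgebra.single (0 : ℤ) (gen D (.g s.1)) := by
        have := congrArg (AddMonoidAlgebra.singleZeroAlgHom (R := ℂ) (A := Cher D) (M := ℤ))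
          (y_mul_x D η ξ)
        rw [map_sub, map_sub, map_sum, AlgHom.commutes] at this
        simp only [map_smul] at this
        exact this
      simp only [map_sub, map_mul, map_smul, map_sum, FreeAlgebra.lift_ι_apply, AlgHom.commutes,
        AddMonoidAlgebra.single_mul_single, genDeg, neg_add_cancel, add_neg_cancel] at e ⊢
      exact e
    | _ =>
      simp only [map_add, map_mul, map_smul, map_one, FreeAlgebra.lift_ι_apply, mk_ι,
        AddMonoidAlgebra.single_mul_single, genDeg, add_zero, zero_add] at key ⊢
      rw [key]
      first
        | done
        | rfl
        | exact AddMonoidAlgebra.single_add _ _ _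
        | exact (AddMonoidAlgebra.smul_single _ _ _).symm⟩

theorem coaction_gen (z : CherGen G) :
    coaction D (gen D z) = AddMonoidAlgebra.single (genDeg z) (gen D z) :=
  (RingQuot.liftAlgHom_mkAlgHom_apply ℂ _ _ (FreeAlgebra.ι ℂ z)).trans
    (FreeAlgebra.lift_ι_apply _ _)

theorem coaction_of_mem {n : ℤ} {a : Cher D} (ha : a ∈ deg D n) :
    coaction D a = AddMonoidAlgebra.single n a := by
  induction ha using Submodule.span_induction with
  | mem _ hx =>
    obtain ⟨l, rfl, rfl⟩ := hx
    induction l with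
    | nil => exact map_one _
    | cons z l ih =>
      rw [List.map_cons, List.prod_cons, map_mul, ih, coaction_gen,
        AddMonoidAlgebra.single_mul_single, List.map_cons, List.sum_cons]
  | zero => rw [map_zero, AddMonoidAlgebra.single_zero]
  | add _ _ _ _ h₁ h₂ => rw [map_add, h₁, h₂, AddMonoidAlgebra.single_add]
  | smul r _ _ h => rw [map_smul, h, AddMonoidAlgebra.smul_single]

theorem isInternal_deg : DirectSum.IsInternal (deg D) := by
  refine isInternal_of_proj _ (fun n => Finsupp.lapply n ∘ₗ
    (AddMonoidAlgebra.coeffLinearEquiv (S := Cher D) (M := ℤ) ℂ).toLinearMap ∘ₗ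
      (coaction D).toLinearMap) (fun n a ha => ?_) (fun m n hmn a ha => ?_) (iSup_deg D)
  · change (coaction D a).coeff n = a
    rw [coaction_of_mem D ha, AddMonoidAlgebra.coeff_single, Finsupp.single_eq_same]
  · change (coaction D a).coeff m = 0
    rw [coaction_of_mem D ha, AddMonoidAlgebra.coeff_single, Finsupp.single_eq_of_ne hmn]

end Cher

namespace GrMod

variable {A : Type u} [Ring A] [Algebra ℂ A] {𝒜 : ℤ → Submodule ℂ A}

theorem proj_smul (X : GrMod.{u, v} 𝒜) {i : ℤ} {a : A} (ha : a ∈ 𝒜 i) (n : ℤ) (x : X) :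
    X.proj n (a • x) = a • X.proj (n - i) x := by
  have hx : x ∈ ⨆ n, X.deg n := by rw [iSup_deg_eq_top X.isInternal]; trivial
  induction hx using Submodule.iSup_induction' with
  | mem j x hx =>
    by_cases hn : n = i + j
    · subst hn
      rw [proj, gradedProj_same _ (X.smul_mem ha hx), proj, add_sub_cancel_left,
        gradedProj_same _ hx]
    · rw [proj, gradedProj_ne _ hn (X.smul_mem ha hx), proj, gradedProj_ne _ (by omega) hx,
        smul_zero]
  | zero => simp
  | add x y _ _ hx hy => rw [smul_add, map_add, hx, hy, map_add, smul_add]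

/-- A submodule generated by homogeneous elements is homogeneous. -/
theorem isHomogeneous_span (h𝒜 : ⨆ n, 𝒜 n = ⊤) (X : GrMod.{u, v} 𝒜) (S : Set X)
    (hS : ∀ s ∈ S, ∃ n, s ∈ X.deg n) : X.IsHomogeneous (Submodule.span A S) := by
  intro n x hx
  induction hx using Submodule.span_induction generalizing n with
  | mem s hs =>
    obtain ⟨m, hm⟩ := hS s hs
    by_cases hnm : n = m
    · subst hnm
      rw [proj, gradedProj_same _ hm]
      exact Submodule.subset_span hs
    · rw [proj, gradedProj_ne _ hnm hm]
      exact Submodule.zero_mem _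
  | zero => rw [map_zero]; exact Submodule.zero_mem _
  | add _ _ _ _ h₁ h₂ => rw [map_add]; exact Submodule.add_mem _ (h₁ n) (h₂ n)
  | smul a x _ h =>
    have ha : a ∈ ⨆ n, 𝒜 n := by rw [h𝒜]; trivial
    induction ha using Submodule.iSup_induction' with
    | mem i a ha => rw [proj_smul X ha]; exact Submodule.smul_mem _ _ (h _)
    | zero => rw [zero_smul, map_zero]; exact Submodule.zero_mem _
    | add _ _ _ _ h₁ h₂ => rw [add_smul, map_add]; exact Submodule.add_mem _ h₁ h₂

/-- A sum of homogeneous submodules is homogeneous. -/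
theorem isHomogeneous_sSup (X : GrMod.{u, v} 𝒜) (S : Set (Submodule A X))
    (hS : ∀ N ∈ S, X.IsHomogeneous N) : X.IsHomogeneous (sSup S) := by
  intro n x hx
  rw [sSup_eq_iSup'] at hx
  induction hx using Submodule.iSup_induction' with
  | mem N x hx => exact le_sSup N.2 (hS N N.2 n x hx)
  | zero => rw [map_zero]; exact Submodule.zero_mem _
  | add _ _ _ _ h₁ h₂ => rw [map_add]; exact Submodule.add_mem _ h₁ h₂

/-- The quotient of `X` by the sum of all its proper graded submodules. -/
noncomputable def head (X : GrMod.{u, v} 𝒜) : GrMod.{u, v} 𝒜 :=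
  X.quot (sSup {N | X.IsHomogeneous N ∧ N ≠ ⊤}) (X.isHomogeneous_sSup _ fun _ hN => hN.1)

/-- The graded Euler–Poincaré pairing: the coefficient of `q^γ` is
`∑ₚ (-1)^p dim Ext^p(X[γ], Y)`. -/
noncomputable def EPgr (X Y : GrMod.{u, v} 𝒜) (γ : ℤ) : ℤ :=
  ∑ᶠ p : ℕ, (-1) ^ p * (Module.finrank ℂ (GrExt X Y p γ) : ℤ)

/-- The sum defining the graded Euler–Poincaré pairing makes sense: each graded piece of each
`Ext^p(X, Y)` is finite dimensional, and `Ext^p(X, Y) = 0` for all large `p`. -/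
def EPgrDefined (X Y : GrMod.{u, v} 𝒜) : Prop :=
  (∀ p γ, FiniteDimensional ℂ (GrExt X Y p γ)) ∧
    ∃ N : ℕ, ∀ p > N, ∀ γ, Subsingleton (GrExt X Y p γ)

end GrMod

namespace Cher

variable (D : CherData G) {V : Type u} [AddCommGroup V] [Module ℂ V]

/-- The graded left module `H_{t,c} ⊗_ℂ V`, with `V` in degree `0`. -/
noncomputable def free (V : Type u) [AddCommGroup V] [Module ℂ V] : GrMod.{u, u} (deg D) where
  carrier := Cher D ⊗[ℂ] V
  deg n := Submodule.span ℂ {m | ∃ a ∈ deg D n, ∃ v : V, m = a ⊗ₜ v}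
  isInternal := by
    refine isInternal_of_proj _ (fun n => (gradedProj (isInternal_deg D) n).rTensor V)
      (fun n m hm => ?_) (fun k n hkn m hm => ?_) ?_
    · induction hm using Submodule.span_induction with
      | mem _ hm =>
        obtain ⟨a, ha, v, rfl⟩ := hm
        rw [LinearMap.rTensor_tmul, gradedProj_same _ ha]
      | zero => rw [map_zero]
      | add _ _ _ _ h₁ h₂ => rw [map_add, h₁, h₂]
      | smul c _ _ h => rw [map_smul, h]
    · induction hm using Submodule.span_induction with
      | mem _ hm =>
        obtain ⟨a, ha, v, rfl⟩ := hm
        rw [LinearMap.rTensor_tmul, gradedProj_ne _ hkn ha, TensorProduct.zero_tmul]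
      | zero => rw [map_zero]
      | add _ _ _ _ h₁ h₂ => rw [map_add, h₁, h₂, add_zero]
      | smul c _ _ h => rw [map_smul, h, smul_zero]
    · rw [eq_top_iff]
      rintro m -
      induction m using TensorProduct.induction_on with
      | zero => exact Submodule.zero_mem _
      | add _ _ h₁ h₂ => exact Submodule.add_mem _ h₁ h₂
      | tmul a v =>
        have ha : a ∈ ⨆ n, deg D n := by rw [iSup_deg]; trivial
        induction ha using Submodule.iSup_induction' with
        | mem i a ha => exact Submodule.mem_iSup_of_mem i (Submodule.subset_span ⟨a, ha, v, rfl⟩)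
        | zero => rw [TensorProduct.zero_tmul]; exact Submodule.zero_mem _
        | add _ _ _ _ h₁ h₂ => rw [TensorProduct.add_tmul]; exact Submodule.add_mem _ h₁ h₂
  smul_mem := by
    intro i j a m ha hm
    induction hm using Submodule.span_induction with
    | mem _ hm =>
      obtain ⟨b, hb, v, rfl⟩ := hm
      exact Submodule.subset_span ⟨a * b, mul_mem_deg D ha hb, v, rfl⟩
    | zero => rw [smul_zero]; exact Submodule.zero_mem _
    | add _ _ _ _ h₁ h₂ => rw [smul_add]; exact Submodule.add_mem _ h₁ h₂
    | smul c _ _ h => rw [smul_comm]; exact Submodule.smul_mem _ _ h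

theorem tmul_mem_deg_free {n : ℤ} {a : Cher D} (ha : a ∈ deg D n) (v : V) :
    (a ⊗ₜ[ℂ] v : Cher D ⊗[ℂ] V) ∈ (free D V).deg n :=
  Submodule.subset_span (R := ℂ) (M := Cher D ⊗[ℂ] V) ⟨a, ha, v, rfl⟩

/-- The relations `η ⊗ v = 0` (`η ∈ 𝔥`) and `g ⊗ v = 1 ⊗ gv` (`g ∈ G`) in `H_{t,c} ⊗_ℂ V`. -/
def stdRel (ρ : Representation ℂ G V) : Set (free D V) :=
  {m | (∃ (η : h) (v : V), m = (y D η ⊗ₜ[ℂ] v : Cher D ⊗[ℂ] V)) ∨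
    ∃ (g : G) (v : V), m = (Cher.g D g ⊗ₜ[ℂ] v - 1 ⊗ₜ[ℂ] ρ g v : Cher D ⊗[ℂ] V)}

theorem isHomogeneous_stdRel (ρ : Representation ℂ G V) :
    (free D V).IsHomogeneous (Submodule.span (Cher D) (stdRel D ρ)) := by
  refine GrMod.isHomogeneous_span (iSup_deg D) _ _ ?_
  rintro _ (⟨η, v, rfl⟩ | ⟨g, v, rfl⟩)
  · exact ⟨-1, tmul_mem_deg_free D (gen_mem_deg D (.y η)) v⟩
  · exact ⟨0, Submodule.sub_mem _ (tmul_mem_deg_free D (gen_mem_deg D (.g g)) v)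
      (tmul_mem_deg_free D (one_mem_deg D) (ρ g v))⟩

/-- The standard module `M_{t,c}(τ) = H_{t,c} ⊗_{ℂ[𝔥*] ⋊ ℂG} τ`, where `𝔥` acts on `τ` by `0`, with
`1 ⊗ τ` in degree `0`. The tensor product is written as the quotient of `H_{t,c} ⊗_ℂ τ` that makes it
balanced over the generators `𝔥` and `G` of `ℂ[𝔥*] ⋊ ℂG`. -/
noncomputable def std (ρ : Representation ℂ G V) : GrMod.{u, u} (deg D) :=
  (free D V).quot (Submodule.span (Cher D) (stdRel D ρ)) (isHomogeneous_stdRel D ρ)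

/-- The simple module `L_{t,c}(τ)`, the unique simple graded quotient of `M_{t,c}(τ)`: the quotient by
the sum of all proper graded submodules. -/
noncomputable def simple (ρ : Representation ℂ G V) : GrMod.{u, u} (deg D) :=
  (std D ρ).head

/-! ### The Dirac operator, Dirac cohomology and Dirac index -/

section Dirac

variable {D} (X : GrMod.{u, u} (deg D))

/-- The operator by which an element of `H_{t,c}` acts. -/
noncomputable def act : Cher D →ₐ[ℂ] Module.End ℂ X := Algebra.lsmul ℂ ℂ X

/-- The restriction to `G` of a module over `H_{t,c}`. -/
noncomputable def rep : Representation ℂ G X := (act X).toMonoidHom.comp (Cher.g D)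

/-- The spin module `S* = ⋀ 𝔥*`. -/
abbrev Spin (h : Type u) [AddCommGroup h] [Module ℂ h] : Type u := ExteriorAlgebra ℂ (Dual ℂ h)

/-- The natural action of `G` on `S* = ⋀ 𝔥*`. -/
noncomputable def spinRep (G : Subgroup (h ≃ₗ[ℂ] h)) : Representation ℂ G (Spin h) where
  toFun g := (ExteriorAlgebra.map ((reflRep G).dual g)).toLinearMap
  map_one' := by
    rw [map_one, Module.End.one_eq_id, ExteriorAlgebra.map_id]; rfl
  map_mul' g g' := by
    rw [map_mul, Module.End.mul_eq_comp, ← ExteriorAlgebra.map_comp_map]; rfl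

/-- The Clifford action of `ξ ∈ 𝔥*` on `S*`: `ω ↦ 2 ξ ∧ ω`. -/
noncomputable def spinX : Dual ℂ h →ₗ[ℂ] Module.End ℂ (Spin h) :=
  (2 : ℂ) • (LinearMap.mul ℂ (Spin h) ∘ₗ ExteriorAlgebra.ι ℂ)

/-- The Clifford action of `η ∈ 𝔥` on `S*`: `ω ↦ -∂_η ω`, with `∂_η` the odd derivation such that
`∂_η ξ = ξ(η)` for `ξ ∈ 𝔥*`. -/
noncomputable def spinY : h →ₗ[ℂ] Module.End ℂ (Spin h) :=
  -(CliffordAlgebra.contractLeft (Q := (0 : QuadraticForm ℂ (Dual ℂ h))) ∘ₗ Dual.eval ℂ h)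

/-- The local Dirac operator `D_X` on `X ⊗ S*`: the action of
`𝒟 = ∑ⱼ (xⱼ ⊗ yⱼ + yⱼ ⊗ xⱼ) ∈ H_{t,c} ⊗ 𝒞(𝔥 ⊕ 𝔥*)`, for dual bases `yⱼ` of `𝔥` and `xⱼ` of `𝔥*`. -/
noncomputable def dirac [FiniteDimensional ℂ h] : Module.End ℂ (X ⊗[ℂ] Spin h) :=
  ∑ j, (TensorProduct.map (act X (x D ((finBasis ℂ h).coord j))) (spinY (finBasis ℂ h j)) +
    TensorProduct.map (act X (y D (finBasis ℂ h j))) (spinX ((finBasis ℂ h).coord j)))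

/-- The diagonal action of `G` on `X ⊗ S*`. -/
noncomputable def diracRep : Representation ℂ G (X ⊗[ℂ] Spin h) := (rep X).tprod (spinRep G)

/-- The subspaces `X ⊗ S*⁺` (`ε = 0`) and `X ⊗ S*⁻` (`ε = 1`), where `S*^±` is the sum of the even,
respectively odd, exterior powers of `𝔥*`. -/
noncomputable def parityPart (ε : ZMod 2) : Submodule ℂ (X ⊗[ℂ] Spin h) :=
  Submodule.span ℂ {z | ∃ (ℓ : ℕ) (m : X) (ω : Spin h), (ℓ : ZMod 2) = ε ∧ ω ∈ ⋀[ℂ]^ℓ (Dual ℂ h) ∧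
    z = m ⊗ₜ ω}

/-- The component of total degree `n` of `X ⊗ S*`, where `⋀^ℓ 𝔥*` has degree `ℓ`. -/
noncomputable def totalDeg (n : ℤ) : Submodule ℂ (X ⊗[ℂ] Spin h) :=
  Submodule.span ℂ {z | ∃ (ℓ : ℕ) (m : X) (ω : Spin h), m ∈ X.deg (n - ℓ) ∧ ω ∈ ⋀[ℂ]^ℓ (Dual ℂ h) ∧
    z = m ⊗ₜ ω}

theorem sum_basis_smul [FiniteDimensional ℂ h] {W : Type*} [AddCommGroup W] [Module ℂ W]
    (B : Dual ℂ h →ₗ[ℂ] h →ₗ[ℂ] W) (g : G) :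
    ∑ j, B ((reflRep G).dual g ((finBasis ℂ h).coord j)) (reflRep G g (finBasis ℂ h j)) =
      ∑ j, B ((finBasis ℂ h).coord j) (finBasis ℂ h j) := by
  set b := finBasis ℂ h
  have h1 : ∀ j, reflRep G g (b j) = ∑ k, b.coord k (reflRep G g (b j)) • b k := fun j =>
    (b.sum_repr _).symm
  have h2 : ∀ k, ∑ j, b.coord k (reflRep G g (b j)) • (reflRep G).dual g (b.coord j) = b.coord k := by
    intro k
    apply LinearMap.ext
    intro v
    have := congrArg (fun w => b.coord k (reflRep G g w)) (b.sum_repr (reflRep G g⁻¹ v))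
    simp only [map_sum, map_smul, smul_eq_mul] at this
    rw [← Module.End.mul_apply, ← map_mul, mul_inv_cancel, map_one, Module.End.one_apply] at this
    rw [← this, LinearMap.sum_apply]
    refine Finset.sum_congr rfl fun j _ => ?_
    rw [LinearMap.smul_apply, smul_eq_mul, mul_comm]
    rfl
  calc _ = ∑ j, ∑ k, b.coord k (reflRep G g (b j)) • B ((reflRep G).dual g (b.coord j)) (b k) := by
        refine Finset.sum_congr rfl fun j _ => ?_
        conv_lhs => rw [h1 j, map_sum]
        simp only [map_smul]
    _ = ∑ k, B (∑ j, b.coord k (reflRep G g (b j)) • (reflRep G).dual g (b.coord j)) (b k) := by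
        rw [Finset.sum_comm]
        refine Finset.sum_congr rfl fun k _ => ?_
        rw [map_sum, LinearMap.sum_apply]
        simp only [map_smul, LinearMap.smul_apply]
    _ = _ := by simp only [h2]

theorem rep_comp_x (g : G) (ξ : Dual ℂ h) :
    rep X g ∘ₗ act X (x D ξ) = act X (x D ((reflRep G).dual g ξ)) ∘ₗ rep X g := by
  change act X (Cher.g D g) * act X (x D ξ) = act X _ * act X (Cher.g D g)
  rw [← map_mul, g_mul_x, map_mul]

theorem rep_comp_y (g : G) (η : h) :
    rep X g ∘ₗ act X (y D η) = act X (y D (reflRep G g η)) ∘ₗ rep X g := by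
  change act X (Cher.g D g) * act X (y D η) = act X _ * act X (Cher.g D g)
  rw [← map_mul, g_mul_y, map_mul]

theorem spinRep_comp_spinX (g : G) (ξ : Dual ℂ h) :
    spinRep G g ∘ₗ spinX ξ = spinX ((reflRep G).dual g ξ) ∘ₗ spinRep G g := by
  apply LinearMap.ext
  intro ω
  change ExteriorAlgebra.map ((reflRep G).dual g) ((2 : ℂ) • (ExteriorAlgebra.ι ℂ ξ * ω)) =
    (2 : ℂ) • (ExteriorAlgebra.ι ℂ ((reflRep G).dual g ξ) *
      ExteriorAlgebra.map ((reflRep G).dual g) ω)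
  rw [map_smul, map_mul, ExteriorAlgebra.map_apply_ι]

theorem spinRep_comp_spinY (g : G) (η : h) :
    spinRep G g ∘ₗ spinY η = spinY (reflRep G g η) ∘ₗ spinRep G g := by
  apply LinearMap.ext
  intro ω
  change ExteriorAlgebra.map ((reflRep G).dual g) (-CliffordAlgebra.contractLeft (Dual.eval ℂ h η) ω) =
    -CliffordAlgebra.contractLeft (Dual.eval ℂ h (reflRep G g η))
      (ExteriorAlgebra.map ((reflRep G).dual g) ω)
  rw [map_neg, neg_inj]
  have hd : ∀ ξ : Dual ℂ h, (reflRep G).dual g ξ (reflRep G g η) = ξ η := fun ξ => by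
    change ξ (reflRep G g⁻¹ (reflRep G g η)) = ξ η
    rw [← Module.End.mul_apply, ← map_mul, inv_mul_cancel, map_one, Module.End.one_apply]
  induction ω using CliffordAlgebra.left_induction with
  | algebraMap r => simp
  | add a b ha hb => simp only [map_add, ha, hb]
  | ι_mul a ξ ha =>
    rw [CliffordAlgebra.contractLeft_ι_mul, map_sub, map_smul, map_mul, map_mul, ha]
    have : ExteriorAlgebra.map ((reflRep G).dual g) (CliffordAlgebra.ι 0 ξ) =
      CliffordAlgebra.ι 0 ((reflRep G).dual g ξ) := ExteriorAlgebra.map_apply_ι _ _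
    rw [this, CliffordAlgebra.contractLeft_ι_mul, Dual.eval_apply, Dual.eval_apply, hd]

/-- The Dirac operator commutes with `G`. -/
theorem diracRep_comp_dirac [FiniteDimensional ℂ h] (g : G) (z : X ⊗[ℂ] Spin h) :
    diracRep X g (dirac X z) = dirac X (diracRep X g z) := by
  have h1 : diracRep X g ∘ₗ dirac X =
      ∑ j, (TensorProduct.map (act X (x D ((reflRep G).dual g ((finBasis ℂ h).coord j))))
          (spinY (reflRep G g (finBasis ℂ h j))) +
        TensorProduct.map (act X (y D (reflRep G g (finBasis ℂ h j))))
          (spinX ((reflRep G).dual g ((finBasis ℂ h).coord j)))) ∘ₗ diracRep X g := by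
    rw [dirac, ← Module.End.mul_eq_comp, Finset.mul_sum]
    refine Finset.sum_congr rfl fun j _ => ?_
    rw [Module.End.mul_eq_comp, LinearMap.comp_add, LinearMap.add_comp]
    change TensorProduct.map (rep X g) (spinRep G g) ∘ₗ _ + TensorProduct.map (rep X g) (spinRep G g) ∘ₗ _
      = _ ∘ₗ TensorProduct.map (rep X g) (spinRep G g) + _ ∘ₗ TensorProduct.map (rep X g) (spinRep G g)
    rw [← TensorProduct.map_comp, ← TensorProduct.map_comp, ← TensorProduct.map_comp,
      ← TensorProduct.map_comp, rep_comp_x, rep_comp_y, spinRep_comp_spinX, spinRep_comp_spinY]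
  let B : Dual ℂ h →ₗ[ℂ] h →ₗ[ℂ] Module.End ℂ (X ⊗[ℂ] Spin h) :=
    LinearMap.mk₂ ℂ (fun ξ η => TensorProduct.map (act X (x D ξ)) (spinY η) +
      TensorProduct.map (act X (y D η)) (spinX ξ))
      (fun ξ ξ' η => by
        simp only [map_add, TensorProduct.map_add_left, TensorProduct.map_add_right]; abel)
      (fun c ξ η => by
        simp only [map_smul, TensorProduct.map_smul_left, TensorProduct.map_smul_right, smul_add])
      (fun ξ η η' => by
        simp only [map_add, TensorProduct.map_add_left, TensorProduct.map_add_right]; abel)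
      (fun c ξ η => by
        simp only [map_smul, TensorProduct.map_smul_left, TensorProduct.map_smul_right, smul_add])
  have h2 := sum_basis_smul B g
  simp only [← Module.End.mul_eq_comp, ← Finset.sum_mul] at h1
  have h3 : diracRep X g * dirac X = dirac X * diracRep X g := h1.trans (congrArg (· * _) h2)
  exact congrArg (fun f => f z) h3

theorem diracRep_mem_parityPart (ε : ZMod 2) (g : G) (z : X ⊗[ℂ] Spin h)
    (hz : z ∈ parityPart X ε) : diracRep X g z ∈ parityPart X ε := by
  induction hz using Submodule.span_induction with
  | mem _ hz =>
    obtain ⟨ℓ, m, ω, hℓ, hω, rfl⟩ := hz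
    refine Submodule.subset_span ⟨ℓ, rep X g m, spinRep G g ω, hℓ, ?_, rfl⟩
    have : (⋀[ℂ]^ℓ (Dual ℂ h)).map (ExteriorAlgebra.map ((reflRep G).dual g)).toLinearMap ≤
        ⋀[ℂ]^ℓ (Dual ℂ h) := by
      rw [ExteriorAlgebra.exteriorPower, Submodule.map_pow]
      refine pow_le_pow_left' ?_ ℓ
      rintro _ ⟨_, ⟨ξ, rfl⟩, rfl⟩
      exact ⟨(reflRep G).dual g ξ, (ExteriorAlgebra.map_apply_ι _ _).symm⟩
    exact this ⟨ω, hω, rfl⟩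
  | zero => rw [map_zero]; exact Submodule.zero_mem _
  | add _ _ _ _ h₁ h₂ => rw [map_add]; exact Submodule.add_mem _ h₁ h₂
  | smul c _ _ h => rw [map_smul]; exact Submodule.smul_mem _ _ h

variable [FiniteDimensional ℂ h]

/-- `ker D_X^±`, the kernel of `D_X` on `X ⊗ S*^±`. -/
noncomputable def diracKer (ε : ZMod 2) : Submodule ℂ (X ⊗[ℂ] Spin h) :=
  LinearMap.ker (dirac X) ⊓ parityPart X ε

/-- `im D_X^∓`, the image under `D_X` of `X ⊗ S*^∓`. -/
noncomputable def diracIm (ε : ZMod 2) : Submodule ℂ (X ⊗[ℂ] Spin h) :=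
  (parityPart X (ε + 1)).map (dirac X)

/-- The action of `G` on `ker D_X^±`. -/
noncomputable def diracKerRep (ε : ZMod 2) : Representation ℂ G (diracKer X ε) :=
  (diracRep X).subrepresentation (diracKer X ε) fun g z hz =>
    ⟨by
      have : dirac X z = 0 := hz.1
      change dirac X (diracRep X g z) = 0
      rw [← diracRep_comp_dirac, this, map_zero],
    diracRep_mem_parityPart X ε g z hz.2⟩

/-- The Dirac cohomology `H_D^±(X) = ker D_X^± / (ker D_X^± ∩ im D_X^∓)`. -/
abbrev DiracCoh (ε : ZMod 2) : Type u :=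
  diracKer X ε ⧸ (diracKer X ε ⊓ diracIm X ε).submoduleOf (diracKer X ε)

/-- The action of `G` on `H_D^±(X)`. -/
noncomputable def diracCohRep (ε : ZMod 2) : Representation ℂ G (DiracCoh X ε) :=
  (diracKerRep X ε).quotient _ fun g z hz => by
    obtain ⟨-, w, hw, hwz⟩ := hz
    refine ⟨(diracKerRep X ε g z).2, diracRep X g w, diracRep_mem_parityPart X _ g w hw, ?_⟩
    rw [← diracRep_comp_dirac, hwz]
    rfl

/-- The degree `n` component of `H_D^±(X)`. -/
noncomputable def diracCohDeg (ε : ZMod 2) (n : ℤ) : Submodule ℂ (DiracCoh X ε) :=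
  ((totalDeg X n).submoduleOf (diracKer X ε)).map (Submodule.mkQ _)

/-- The space `Hom_G(τ, H_D^±(X)_n)`. -/
noncomputable def homDiracCoh (τ : Representation ℂ G V) (ε : ZMod 2) (n : ℤ) :
    Submodule ℂ (V →ₗ[ℂ] DiracCoh X ε) where
  carrier := {f | (∀ g v, f (τ g v) = diracCohRep X ε g (f v)) ∧ ∀ v, f v ∈ diracCohDeg X ε n}
  add_mem' {f f'} hf hf' :=
    ⟨fun g v => by simp only [LinearMap.add_apply, hf.1, hf'.1, map_add],
      fun v => Submodule.add_mem _ (hf.2 v) (hf'.2 v)⟩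
  zero_mem' := ⟨fun g v => by simp, fun v => Submodule.zero_mem _⟩
  smul_mem' c f hf :=
    ⟨fun g v => by simp only [LinearMap.smul_apply, hf.1, map_smul],
      fun v => Submodule.smul_mem _ c (hf.2 v)⟩

/-- For irreducible `τ`, the graded multiplicity of `τ` in the Dirac index
`I_D(X) = H_D^+(X) - H_D^-(X)`: the coefficient of `qⁿ`. -/
noncomputable def diracIndexMult (τ : Representation ℂ G V) (n : ℤ) : ℤ :=
  (finrank ℂ (homDiracCoh X τ 0 n) : ℤ) - finrank ℂ (homDiracCoh X τ 1 n)

end Dirac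

/-- The Dirac index polynomial `d_{σ,τ}(q)`, as the function sending `n` to the coefficient of `qⁿ`: the
graded multiplicity of `τ` in the Dirac index of `L_{t,c}(σ)`. -/
noncomputable def diracIndexPoly [FiniteDimensional ℂ h] {W : Type u} [AddCommGroup W] [Module ℂ W]
    (σ : Representation ℂ G W) (τ : Representation ℂ G V) : ℤ → ℤ :=
  diracIndexMult (simple D σ) τ

open Classical in
/-- The constant `δ_{τ,σ}` as a function of the exponent of `q`: it is `1` in degree `0` if `τ ≅ σ`, and
`0` otherwise. -/
noncomputable def delta {W : Type u} [AddCommGroup W] [Module ℂ W]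
    (τ : Representation ℂ G V) (σ : Representation ℂ G W) (n : ℤ) : ℤ :=
  if n = 0 ∧ Nonempty (τ.Equiv σ) then 1 else 0

end Cher

end Cherednik

/-! The argument computes `Ext` from a Koszul resolution and compares the answer with the Dirac
index through the square of the Dirac operator.

The standard module is induced from `τ` along `ℂ[𝔥*] ⋊ ℂG`, and over that algebra `τ` (with `𝔥`
acting by `0`) has the Koszul resolution with terms `S(𝔥) ⊗ ⋀^p 𝔥 ⊗ τ`. Induction is exact because,
by a PBW argument, the induced module of `N` lives on `S(𝔥*) ⊗ N`, with `𝔥` acting by Dunkl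
operators; their commutativity is `YRep.opY_comm`. So `M(τ)[γ]` is resolved by `H ⊗_{ℂG} (⋀^p 𝔥 ⊗
τ)`, generated in degree `γ - p` (`Koszul.exists_resolution`). These terms are projective because
one can average over the finite group `G`, and the morphisms from the `p`-th term to `Y` form
`Hom_G(τ, Y_{γ-p} ⊗ ⋀^p 𝔥*)` (`Koszul.homEquiv`). Hence, if the components of `Y` are finite
dimensional, all `Ext^p` are finite dimensional, they vanish for large `p`, and the coefficient of
`q^γ` is the multiplicity of `τ` in the even part of `(Y ⊗ S*)_γ` minus that in the odd part
(`Koszul.hasExtEuler_std`, `Cher.finrank_homSpin`).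

The Dirac operator preserves total degree and exchanges the parities. If `Y` is a quotient of
`M(σ)`, its square is `-2 (t deg - z_σ + Ω)`, where `Ω = ∑ c(s) κ(s)⁻¹ s` acts diagonally and `z_σ`
is its scalar on `σ` (`Cher.dirac_dirac`). By Schur's lemma this is a scalar on `Hom_G(τ, (Y ⊗
S*)_γ)`. If the scalar is nonzero, the even and odd spaces have equal dimension and there is no
cohomology; if it is zero, `D` is a differential and passing to cohomology keeps the difference of
dimensions. Either way the difference is the coefficient of the Dirac index
(`Cher.diracIndexMult_eq`). Taking `Y = L(σ)` gives the second formula.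

For `Y = M(σ)` the dimensions involved depend only on the graded `G`-module `S(𝔥*) ⊗ σ`, hence not
on `t` and `c`. With `t = 1` and `c = 0` the scalar is `-2γ`, so only `γ = 0` contributes, and there
one finds `dim Hom_G(τ, σ)` (`Cher.sum_finrank_homBideg_std`).

Dirac cohomology is finite dimensional for different reasons in two cases. If `t ≠ 0`, the formula
for the square confines `ker D` to finitely many degrees. If `t = 0`, invariant polynomials of
positive degree produce singular vectors of `M(σ)`, so they act by zero on `L(σ)`, which is then
finite dimensional (`Cher.finite_simple`). -/

set_option linter.unusedSectionVars false
set_option linter.unusedVariables false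

/-! ### Euler characteristics of `Ext` from finite projective resolutions. -/

section EulerCharacteristic

open CategoryTheory.Abelian Module

universe w v₁ u₁

variable {C : Type u₁} [Category.{v₁} C] [Abelian C] [Linear ℂ C] [HasExt.{w} C]

/-- The groups `Ext^p(X, Y)` are finite dimensional, vanish for `p > N`, and have Euler
characteristic `e`. -/
structure HasExtEuler (X Y : C) (N : ℕ) (e : ℤ) : Prop where
  finite : ∀ p, FiniteDimensional ℂ (Ext.{w} X Y p)
  vanish : ∀ p > N, Subsingleton (Ext.{w} X Y p)
  euler : ∑ p ∈ Finset.range (N + 1), (-1) ^ p * (finrank ℂ (Ext.{w} X Y p) : ℤ) = e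

theorem HasExtEuler.finsum_eq {X Y : C} {N : ℕ} {e : ℤ} (H : HasExtEuler.{w} X Y N e) :
    ∑ᶠ p : ℕ, (-1) ^ p * (finrank ℂ (Ext.{w} X Y p) : ℤ) = e := by
  rw [← H.euler]
  refine finsum_eq_sum_of_support_subset _ fun p hp => ?_
  by_contra hpN
  have : Subsingleton (Ext.{w} X Y p) := H.vanish p (by simpa using hpN)
  exact hp (by simp [finrank_zero_of_subsingleton])

theorem HasExtEuler.of_isZero {X Y : C} (hX : IsZero X) : HasExtEuler.{w} X Y 0 0 := by
  have h0 : ∀ p, Subsingleton (Ext.{w} X Y p) := fun p => by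
    refine subsingleton_of_forall_eq 0 fun e => ?_
    rw [← Ext.mk₀_id_comp e, (IsZero.iff_id_eq_zero X).1 hX, Ext.mk₀_zero, Ext.zero_comp]
  exact ⟨fun p => Module.Finite.of_finite, fun p _ => h0 p, by
    simp [finrank_zero_of_subsingleton]⟩

/-- The Euler characteristic of `Ext` along a short exact sequence with projective middle term. -/
theorem HasExtEuler.of_shortExact {S : ShortComplex C} (hS : S.ShortExact) [Projective S.X₂] (Y : C)
    [FiniteDimensional ℂ (S.X₂ ⟶ Y)] {N : ℕ} {e : ℤ} (H : HasExtEuler.{w} S.X₁ Y N e) :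
    HasExtEuler.{w} S.X₃ Y (N + 1) (finrank ℂ (S.X₂ ⟶ Y) - e) := by
  have h2 : ∀ p, Subsingleton (Ext.{w} S.X₂ Y (p + 1)) := fun p =>
    Ext.subsingleton_of_projective _ _ _
  have := H.finite
  have e2 : Ext.{w} S.X₂ Y 0 ≃ₗ[ℂ] (S.X₂ ⟶ Y) := Ext.linearEquiv₀
  have f2 : FiniteDimensional ℂ (Ext.{w} S.X₂ Y 0) := e2.symm.finiteDimensional
  let δ : ∀ p, Ext.{w} S.X₁ Y p →ₗ[ℂ] Ext.{w} S.X₃ Y (p + 1) := fun p =>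
    Ext.precompOfLinear hS.extClass ℂ Y (add_comm 1 p)
  have δ_surj : ∀ p, Function.Surjective (δ p) := fun p x =>
    Ext.contravariant_sequence_exact₃ hS Y x (Subsingleton.elim _ _) (add_comm 1 p)
  have δ_inj : ∀ p, Function.Injective (δ (p + 1)) := fun p => by
    rw [injective_iff_map_eq_zero]
    intro x hx
    obtain ⟨z, rfl⟩ := Ext.contravariant_sequence_exact₁ hS Y x (add_comm 1 (p + 1)) hx
    rw [Subsingleton.elim z 0, Ext.comp_zero]
  -- In positive degrees the connecting maps are isomorphisms. What remains is the exact sequence `0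
  -- → Ext⁰(X₃) → Ext⁰(X₂) → Ext⁰(X₁) → Ext¹(X₃) → 0`, handled by rank-nullity for `f` and `δ 0`.
  let f : Ext.{w} S.X₂ Y 0 →ₗ[ℂ] Ext.{w} S.X₁ Y 0 :=
    Ext.precompOfLinear (Ext.mk₀ S.f) ℂ Y (zero_add 0)
  let g : Ext.{w} S.X₃ Y 0 →ₗ[ℂ] Ext.{w} S.X₂ Y 0 :=
    Ext.precompOfLinear (Ext.mk₀ S.g) ℂ Y (zero_add 0)
  have := hS.epi_g
  have g_inj : Function.Injective g := Ext.precomp_mk₀_injective_of_epi Y S.g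
  have hgf : LinearMap.range g = LinearMap.ker f := by
    apply le_antisymm
    · rintro _ ⟨x, rfl⟩
      change (Ext.mk₀ S.f).comp ((Ext.mk₀ S.g).comp x (zero_add 0)) (zero_add 0) = 0
      rw [Ext.mk₀_comp_mk₀_assoc, S.zero, Ext.mk₀_zero, Ext.zero_comp]
    · intro x hx
      exact Ext.contravariant_sequence_exact₂ hS Y x hx
  have hfδ : LinearMap.range f = LinearMap.ker (δ 0) := by
    apply le_antisymm
    · rintro _ ⟨x, rfl⟩
      change hS.extClass.comp ((Ext.mk₀ S.f).comp x (zero_add 0)) (add_comm 1 0) = 0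
      rw [← Ext.comp_assoc (h₁₂ := add_zero 1) (h₂₃ := zero_add 0) (h := by rfl), hS.extClass_comp,
        Ext.zero_comp]
    · intro x hx
      exact Ext.contravariant_sequence_exact₁ hS Y x (add_comm 1 0) hx
  have fin3 : ∀ p, FiniteDimensional ℂ (Ext.{w} S.X₃ Y p) := fun p => by
    cases p with
    | zero => exact FiniteDimensional.of_injective g g_inj
    | succ p => exact Module.Finite.of_surjective (δ p) (δ_surj p)
  refine ⟨fin3, fun p hp => ?_, ?_⟩
  · obtain ⟨p, rfl⟩ : ∃ q, p = q + 1 := ⟨p - 1, by omega⟩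
    have := H.vanish p (by omega)
    exact (δ_surj p).subsingleton
  · have hs : ∀ p, (finrank ℂ (Ext.{w} S.X₃ Y (p + 1 + 1)) : ℤ) = finrank ℂ (Ext.{w} S.X₁ Y (p + 1)) :=
      fun p => by
        rw [(LinearEquiv.ofBijective (δ (p + 1)) ⟨δ_inj p, δ_surj _⟩).finrank_eq]
    have r1 := LinearMap.finrank_range_add_finrank_ker f
    have r2 := LinearMap.finrank_range_add_finrank_ker (δ 0)
    rw [← hgf, LinearMap.finrank_range_of_inj g_inj, e2.finrank_eq] at r1
    rw [← hfδ, LinearMap.range_eq_top.2 (δ_surj 0), finrank_top] at r2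
    -- The terms of index 0 and 1 for `X₃` and of index 0 for `X₁` are split off: the four-term
    -- sequence balances them, and the other terms match through `hs`.
    rw [← H.euler, Finset.sum_range_succ', Finset.sum_range_succ', Finset.sum_range_succ' _ N]
    simp only [hs]
    have : ∀ p ∈ Finset.range N, (-1 : ℤ) ^ (p + 1 + 1) * (finrank ℂ (Ext.{w} S.X₁ Y (p + 1)) : ℤ) =
        - ((-1 : ℤ) ^ (p + 1) * (finrank ℂ (Ext.{w} S.X₁ Y (p + 1)) : ℤ)) := fun p _ => by ring
    rw [Finset.sum_congr rfl this, Finset.sum_neg_distrib]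
    push_cast [← r1, ← r2]
    have r1' : ((finrank ℂ (LinearMap.range f) + finrank ℂ (Ext.{w} S.X₃ Y 0) : ℕ) : ℤ) =
      finrank ℂ (S.X₂ ⟶ Y) := congrArg _ r1
    have r2' : ((finrank ℂ (Ext.{w} S.X₃ Y (0 + 1)) + finrank ℂ (LinearMap.range f) : ℕ) : ℤ) =
      finrank ℂ (Ext.{w} S.X₁ Y 0) := congrArg _ r2
    push_cast at r1' r2'
    linarith

/-- The Euler characteristic of `Ext` computed by a finite projective resolution, given as a chain of
short exact sequences `0 → Z (p + 1) → P p → Z p → 0`. -/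
theorem HasExtEuler.of_resolution (Y : C) (r : ℕ) : ∀ (Z P : ℕ → C)
    (_ : ∀ p, ∃ (f : Z (p + 1) ⟶ P p) (g : P p ⟶ Z p) (w : f ≫ g = 0),
      (ShortComplex.mk f g w).ShortExact),
    (∀ p, Projective (P p)) → (∀ p, FiniteDimensional ℂ (P p ⟶ Y)) → IsZero (Z r) →
    HasExtEuler.{w} (Z 0) Y r (∑ p ∈ Finset.range r, (-1) ^ p * (finrank ℂ (P p ⟶ Y) : ℤ)) := by
  induction r with
  | zero => exact fun Z P _ _ _ h => by simpa using HasExtEuler.of_isZero h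
  | succ r ih =>
    intro Z P S hP hfin hZ
    -- The shifted chain resolves the first syzygy `Z 1`, which is why `Z` and `P` are quantified
    -- inside the induction.
    have := ih (fun p => Z (p + 1)) (fun p => P (p + 1)) (fun p => S (p + 1)) (fun p => hP _)
      (fun p => hfin _) hZ
    obtain ⟨f, g, w, hS⟩ := S 0
    have hP0 : Projective (ShortComplex.mk f g w).X₂ := hP 0
    have hf0 : FiniteDimensional ℂ ((ShortComplex.mk f g w).X₂ ⟶ Y) := hfin 0
    have := HasExtEuler.of_shortExact hS Y this
    convert this using 1
    rw [Finset.sum_range_succ', sub_eq_add_neg, add_comm, ← Finset.sum_neg_distrib]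
    congr 1
    · simp
    · exact Finset.sum_congr rfl fun p _ => by ring

end EulerCharacteristic

/-! ### Gradings given by operators, and sums of Clifford type. -/

section LinearAlgebra

open Module
local infixl:70 " ⊠ " => TensorProduct.map

variable {X Y : Type*} [AddCommGroup X] [Module ℂ X] [AddCommGroup Y] [Module ℂ Y]

/-- An operator whose eigenspaces for integral eigenvalues span. -/
def IsGradingOp (E : End ℂ X) : Prop := ⨆ n : ℤ, E.eigenspace (n : ℂ) = ⊤

theorem IsGradingOp.isInternal {X : Type v} [AddCommGroup X] [Module ℂ X] {E : End ℂ X}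
    (hE : IsGradingOp E) : DirectSum.IsInternal fun n : ℤ => E.eigenspace (n : ℂ) := by
  rw [DirectSum.isInternal_submodule_iff_iSupIndep_and_iSup_eq_top]
  exact ⟨E.eigenspaces_iSupIndep.comp Int.cast_injective, hE⟩

/-- Induction along a spanning family of subspaces. -/
theorem iSup_eq_top_induction {ι : Type*} {S : ι → Submodule ℂ X} (hS : ⨆ n, S n = ⊤) {P : X → Prop}
    (mem : ∀ n, ∀ x ∈ S n, P x) (add : ∀ x y, P x → P y → P (x + y)) (zero : P 0) (x : X) : P x := by
  have hx : x ∈ ⨆ n, S n := by rw [hS]; trivial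
  induction hx using Submodule.iSup_induction' with
  | mem i x hx => exact mem i x hx
  | zero => exact zero
  | add x y _ _ hx hy => exact add _ _ hx hy

theorem linearMap_ext_of_iSup {ι : Type*} {S : ι → Submodule ℂ X} (hS : ⨆ n, S n = ⊤) {f g : X →ₗ[ℂ] Y}
    (h : ∀ n, ∀ x ∈ S n, f x = g x) : f = g := by
  ext x
  refine iSup_eq_top_induction (P := fun x => f x = g x) hS h (fun x y hx hy => ?_) ?_ x
  · rw [map_add, map_add, hx, hy]
  · rw [map_zero, map_zero]

theorem isGradingOp_tensor {E : End ℂ X} {F : End ℂ Y} (hE : IsGradingOp E) (hF : IsGradingOp F) :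
    IsGradingOp (E ⊠ (1 : End ℂ Y) + (1 : End ℂ X) ⊠ F) := by
  rw [IsGradingOp, eq_top_iff]
  rintro z -
  induction z using TensorProduct.induction_on with
  | zero => exact Submodule.zero_mem _
  | add _ _ h₁ h₂ => exact Submodule.add_mem _ h₁ h₂
  | tmul x y =>
    refine iSup_eq_top_induction (P := fun x => x ⊗ₜ[ℂ] y ∈ _) hE (fun m x hx => ?_)
      (fun x x' h h' => ?_) ?_ x
    · refine iSup_eq_top_induction (P := fun y => x ⊗ₜ[ℂ] y ∈ _) hF (fun n y hy => ?_)
        (fun x x' h h' => ?_) ?_ y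
      · refine Submodule.mem_iSup_of_mem (m + n) ?_
        rw [End.mem_eigenspace_iff] at hx hy ⊢
        simp [hx, hy, add_smul, TensorProduct.tmul_smul, TensorProduct.smul_tmul']
      · rw [TensorProduct.tmul_add]; exact Submodule.add_mem _ h h'
      · rw [TensorProduct.tmul_zero]; exact Submodule.zero_mem _
    · rw [TensorProduct.add_tmul]; exact Submodule.add_mem _ h h'
    · rw [TensorProduct.zero_tmul]; exact Submodule.zero_mem _

section gradedScale

variable {X : Type v} [AddCommGroup X] [Module ℂ X] {deg : ℤ → Submodule ℂ X}
  (h : DirectSum.IsInternal deg)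

/-- The operator acting on the `n`-th homogeneous component of a grading by the scalar `φ n`. -/
noncomputable def gradedScale (φ : ℤ → ℂ) : End ℂ X :=
  DirectSum.toModule ℂ ℤ X (fun n => φ n • (deg n).subtype) ∘ₗ
    (LinearEquiv.ofBijective (DirectSum.coeLinearMap deg) h).symm.toLinearMap

theorem gradedScale_of_mem (φ : ℤ → ℂ) {n : ℤ} {x : X} (hx : x ∈ deg n) :
    gradedScale h φ x = φ n • x := by
  have : (LinearEquiv.ofBijective (DirectSum.coeLinearMap deg) h).symm x
      = DirectSum.lof ℂ ℤ (fun i => deg i) n ⟨x, hx⟩ := by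
    rw [LinearEquiv.symm_apply_eq]
    exact (DirectSum.coeLinearMap_lof deg n ⟨x, hx⟩).symm
  simp [gradedScale, this, DirectSum.toModule_lof]

theorem gradedScale_comp {Y : Type*} [AddCommGroup Y] [Module ℂ Y] {deg' : ℤ → Submodule ℂ Y}
    (h' : DirectSum.IsInternal deg') (φ : ℤ → ℂ) (T : X →ₗ[ℂ] Y)
    (hT : ∀ n, ∀ x ∈ deg n, T x ∈ deg' n) :
    T ∘ₗ gradedScale h φ = gradedScale h' φ ∘ₗ T := by
  refine linearMap_ext_of_iSup (iSup_deg_eq_top h) fun n x hx => ?_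
  rw [LinearMap.comp_apply, LinearMap.comp_apply, gradedScale_of_mem h φ hx, map_smul,
    gradedScale_of_mem h' φ (hT n x hx)]

/-- Comparing components in degree `m` gives `(m - n) x_m = 0`. This turns degree conditions into
eigenvector equations, so that gradings can be transported by commuting operators. -/
theorem mem_deg_iff_gradedScale {n : ℤ} {x : X} :
    x ∈ deg n ↔ gradedScale h (fun m => (m : ℂ)) x = (n : ℂ) • x := by
  refine ⟨fun hx => gradedScale_of_mem h _ hx, fun hx => ?_⟩
  have key : ∀ m, gradedProj h m (gradedScale h (fun m => (m : ℂ)) x) = (m : ℂ) • gradedProj h m x := by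
    intro m
    have := linearMap_ext_of_iSup (iSup_deg_eq_top h)
      (f := gradedProj h m ∘ₗ gradedScale h (fun m => (m : ℂ))) (g := (m : ℂ) • gradedProj h m)
      fun k y hy => ?_
    · exact congrArg (fun f => f x) this
    · rw [LinearMap.comp_apply, gradedScale_of_mem h _ hy, map_smul, LinearMap.smul_apply]
      by_cases hmk : m = k
      · rw [hmk]
      · rw [gradedProj_ne h hmk hy, smul_zero, smul_zero]
  obtain ⟨s, hs⟩ := exists_sum_gradedProj h x
  have h0 : ∀ m, m ≠ n → gradedProj h m x = 0 := fun m hm => by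
    have := key m
    rw [hx, map_smul] at this
    have h2 := sub_eq_zero.2 this
    rw [← sub_smul, smul_eq_zero, sub_eq_zero] at h2
    exact h2.resolve_left fun h => hm (Int.cast_injective h.symm)
  rw [hs]
  refine Submodule.sum_mem _ fun m _ => ?_
  by_cases hm : m = n
  · rw [hm]; exact gradedProj_mem h n x
  · rw [h0 m hm]; exact Submodule.zero_mem _

end gradedScale

/-- A family of subspaces contained in a family of independent subspaces and spanning. -/
theorem eq_of_le_of_iSup_eq_top {deg : ℤ → Submodule ℂ X} (h : DirectSum.IsInternal deg)
    {S : ℤ → Submodule ℂ X} (hle : ∀ n, S n ≤ deg n) (hS : ⨆ n, S n = ⊤) (n : ℤ) : S n = deg n := by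
  refine le_antisymm (hle n) fun x hx => ?_
  rw [← gradedProj_same h hx]
  refine iSup_eq_top_induction (P := fun x => gradedProj h n x ∈ S n) hS (fun m x hx => ?_)
    (fun x y h₁ h₂ => ?_) ?_ x
  · by_cases hm : n = m
    · subst hm; rwa [gradedProj_same h (hle _ hx)]
    · rw [gradedProj_ne h hm (hle _ hx)]; exact Submodule.zero_mem _
  · rw [map_add]; exact Submodule.add_mem _ h₁ h₂
  · rw [map_zero]; exact Submodule.zero_mem _

section Clifford

theorem tmul_map_neg_left (f : End ℂ X) (g : End ℂ Y) : (-f) ⊠ g = -(f ⊠ g) :=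
  TensorProduct.ext' fun x y => TensorProduct.neg_tmul (f x) (g y)

theorem tmul_map_neg_right (f : End ℂ X) (g : End ℂ Y) : f ⊠ (-g) = -(f ⊠ g) :=
  TensorProduct.ext' fun x y => TensorProduct.tmul_neg (f x) (g y)

variable {ι : Type*} [Fintype ι]

/-- The double sum is symmetric in the first factor and antisymmetric in the second, so exchanging
the indices shows that it equals its negative. -/
theorem sum_tmul_sq {x : ι → End ℂ X} {a : ι → End ℂ Y} (hx : ∀ i j, x i * x j = x j * x i)
    (ha : ∀ i j, a i * a j + a j * a i = 0) :
    (∑ i, x i ⊠ a i) * (∑ i, x i ⊠ a i) = 0 := by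
  have h1 : (∑ i, x i ⊠ a i) * (∑ i, x i ⊠ a i) = ∑ i, ∑ j, (x i * x j) ⊠ (a i * a j) := by
    rw [Finset.sum_mul_sum]
    simp only [TensorProduct.map_mul]
  have h2 : ∑ i, ∑ j, (x i * x j) ⊠ (a i * a j) = -∑ i, ∑ j, (x i * x j) ⊠ (a i * a j) := by
    conv_lhs => rw [Finset.sum_comm]
    rw [← Finset.sum_neg_distrib]
    refine Finset.sum_congr rfl fun i _ => ?_
    rw [← Finset.sum_neg_distrib]
    refine Finset.sum_congr rfl fun j _ => ?_
    rw [hx j i, eq_neg_of_add_eq_zero_left (ha j i), tmul_map_neg_right]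
  rw [h1]
  rw [eq_neg_iff_add_eq_zero, ← two_smul ℂ, smul_eq_zero] at h2
  exact h2.resolve_left two_ne_zero

/-- Rewriting `xy ⊗ ab + yx ⊗ ba` as `xy ⊗ (ab + ba) + (yx - xy) ⊗ ba` isolates the Clifford
relation in one summand and the commutator in the other. It serves both the Koszul complex and the
square of the Dirac operator. -/
theorem sum_tmul_anticomm (x y : ι → End ℂ X) (a b : ι → End ℂ Y) :
    (∑ i, x i ⊠ a i) * (∑ i, y i ⊠ b i) + (∑ i, y i ⊠ b i) * (∑ i, x i ⊠ a i) =
      ∑ i, ∑ j, ((x i * y j) ⊠ (a i * b j + b j * a i) +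
        (y j * x i - x i * y j) ⊠ (b j * a i)) := by
  rw [Finset.sum_mul_sum, Finset.sum_mul_sum]
  conv_lhs => enter [2]; rw [Finset.sum_comm]
  rw [← Finset.sum_add_distrib]
  refine Finset.sum_congr rfl fun i _ => ?_
  rw [← Finset.sum_add_distrib]
  refine Finset.sum_congr rfl fun j _ => ?_
  rw [← TensorProduct.map_mul, ← TensorProduct.map_mul, TensorProduct.map_add_right, sub_eq_add_neg,
    TensorProduct.map_add_left, tmul_map_neg_left]
  abel

end Clifford

end LinearAlgebra

/-! ### The symmetric algebra: derivations, Euler operator, divided differences. -/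

section SymmetricAlgebra

open Module
local infixl:70 " ⊠ " => TensorProduct.map

/-- The symmetric algebra of a finite-dimensional vector space, as the polynomial ring in the vectors
of a basis. -/
abbrev Sy (E : Type*) [AddCommGroup E] [Module ℂ E] : Type := MvPolynomial (Fin (finrank ℂ E)) ℂ

namespace Sy

variable {E : Type*} [AddCommGroup E] [Module ℂ E] [FiniteDimensional ℂ E]

/-- The inclusion of `E` in its symmetric algebra. -/
noncomputable def ι : E →ₗ[ℂ] Sy E := (finBasis ℂ E).constr ℂ MvPolynomial.X

@[simp] theorem ι_basis (i) : ι (finBasis ℂ E i) = (MvPolynomial.X i : Sy E) :=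
  (finBasis ℂ E).constr_basis _ _ _

theorem induction {P : Sy E → Prop} (C : ∀ a, P (MvPolynomial.C a)) (add : ∀ f f', P f → P f' → P (f + f'))
    (mul : ∀ e f, P f → P (ι e * f)) (f : Sy E) : P f := by
  induction f using MvPolynomial.induction_on with
  | C a => exact C a
  | add f f' h h' => exact add _ _ h h'
  | mul_X f i h => rw [mul_comm, ← ι_basis]; exact mul _ _ h

theorem hom_ext {A : Type*} [Semiring A] [Algebra ℂ A] {f g : Sy E →ₐ[ℂ] A} (h : ∀ e, f (ι e) = g (ι e)) :
    f = g := MvPolynomial.algHom_ext fun i => by rw [← ι_basis, h]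

/-- An algebra homomorphism from the symmetric algebra to any algebra is determined by a linear map
with commuting values. -/
theorem exists_lift {A : Type*} [Ring A] [Algebra ℂ A] (L : E →ₗ[ℂ] A)
    (hL : ∀ e e', L e * L e' = L e' * L e) : ∃ Ψ : Sy E →ₐ[ℂ] A, ∀ e, Ψ (ι e) = L e := by
  have hc : ∀ a ∈ Set.range L, ∀ b ∈ Set.range L, a * b = b * a := by
    rintro _ ⟨e, rfl⟩ _ ⟨e', rfl⟩
    exact hL e e'
  -- `MvPolynomial.aeval` needs a commutative target; the subalgebra generated by the commuting
  -- values is one.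
  let : CommRing (Algebra.adjoin ℂ (Set.range L)) :=
    { (inferInstance : Ring (Algebra.adjoin ℂ (Set.range L))) with
      mul_comm := (Algebra.isMulCommutative_adjoin ℂ hc).is_comm.comm }
  let Φ : Sy E →ₐ[ℂ] Algebra.adjoin ℂ (Set.range L) := MvPolynomial.aeval fun i =>
    ⟨L (finBasis ℂ E i), Algebra.subset_adjoin ⟨_, rfl⟩⟩
  refine ⟨(Algebra.adjoin ℂ (Set.range L)).val.comp Φ, fun e => ?_⟩
  have : ((Algebra.adjoin ℂ (Set.range L)).val.comp Φ).toLinearMap ∘ₗ ι = L := by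
    refine (finBasis ℂ E).ext fun i => ?_
    simp [Φ]
  exact congrArg (fun f => f e) this

/-- Functoriality of the symmetric algebra. -/
noncomputable def map (f : E →ₗ[ℂ] E) : Sy E →ₐ[ℂ] Sy E :=
  MvPolynomial.aeval fun i => ι (f (finBasis ℂ E i))

@[simp] theorem map_ι (f : E →ₗ[ℂ] E) (e : E) : map f (ι e) = ι (f e) := by
  have : (map f).toLinearMap ∘ₗ ι = ι ∘ₗ f := by
    refine (finBasis ℂ E).ext fun i => ?_
    simp [map]
  exact congrArg (fun f => f e) this

/-- The action of a group on the symmetric algebra of a representation. -/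
noncomputable def rep {G : Type*} [Monoid G] (ρ : Representation ℂ G E) : Representation ℂ G (Sy E) where
  toFun g := (map (ρ g)).toLinearMap
  map_one' := by
    have : map (ρ 1) = AlgHom.id ℂ (Sy E) := hom_ext fun e => by simp
    rw [this]; rfl
  map_mul' g g' := by
    have : map (ρ (g * g')) = (map (ρ g)).comp (map (ρ g')) := hom_ext fun e => by simp
    rw [this]; rfl

theorem rep_one {G : Type*} [Monoid G] (ρ : Representation ℂ G E) (g : G) : rep ρ g 1 = 1 :=
  map_one (map (ρ g))

theorem rep_mul {G : Type*} [Monoid G] (ρ : Representation ℂ G E) (g : G) (e : E) (f : Sy E) :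
    rep ρ g (ι e * f) = ι (ρ g e) * rep ρ g f :=
  (map_mul (map (ρ g)) _ _).trans (by rw [map_ι]; rfl)

/-- Multiplication by an element of `E`. -/
noncomputable def mulι : E →ₗ[ℂ] End ℂ (Sy E) := LinearMap.mul ℂ (Sy E) ∘ₗ ι

@[simp] theorem mulι_apply (e : E) (f : Sy E) : mulι e f = ι e * f := rfl

theorem mulι_comm (e e' : E) : mulι e * mulι e' = mulι e' * mulι e :=
  LinearMap.ext fun f => mul_left_comm (ι e) (ι e') f

/-- The derivation of the symmetric algebra extending a linear form. -/
noncomputable def der : Dual ℂ E →ₗ[ℂ] End ℂ (Sy E) where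
  toFun φ := ∑ i, φ (finBasis ℂ E i) • (MvPolynomial.pderiv i).toLinearMap
  map_add' φ φ' := by simp [add_smul, Finset.sum_add_distrib]
  map_smul' c φ := by simp [mul_smul, Finset.smul_sum]

@[simp] theorem der_one (φ : Dual ℂ E) : der φ (1 : Sy E) = 0 := by
  simp [der]

theorem der_mul (φ : Dual ℂ E) (e : E) (f : Sy E) :
    der φ (ι e * f) = φ e • f + ι e * der φ f := by
  have h1 : der φ (ι e * f) = der φ (ι e) * f + ι e * der φ f := by
    simp only [der, LinearMap.coe_mk, AddHom.coe_mk, LinearMap.sum_apply, LinearMap.smul_apply,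
      Finset.sum_mul, Finset.mul_sum, ← Finset.sum_add_distrib]
    refine Finset.sum_congr rfl fun i _ => ?_
    rw [Derivation.coeFn_coe, Derivation.leibniz, smul_eq_mul, smul_eq_mul, smul_mul_assoc,
      mul_smul_comm, smul_add, add_comm, mul_comm f]
  have h2 : der φ ∘ₗ ι = Algebra.linearMap ℂ (Sy E) ∘ₗ φ := by
    refine (finBasis ℂ E).ext fun j => ?_
    simp [der, MvPolynomial.pderiv_X, Pi.single_apply, Algebra.smul_def]
  have h3 : der φ (ι e) = algebraMap ℂ (Sy E) (φ e) := congrArg (fun f => f e) h2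
  rw [h1, h3, Algebra.smul_def]

theorem der_mulι (φ : Dual ℂ E) (e : E) : der φ * mulι e = mulι e * der φ + φ e • 1 :=
  LinearMap.ext fun f => (der_mul φ e f).trans (add_comm _ _)

/-- The Euler operator of the symmetric algebra. -/
noncomputable def eul (E : Type*) [AddCommGroup E] [Module ℂ E] [FiniteDimensional ℂ E] : End ℂ (Sy E) :=
  ∑ i, mulι (finBasis ℂ E i) * der ((finBasis ℂ E).coord i)

@[simp] theorem eul_one : eul E (1 : Sy E) = 0 := by
  simp [eul]

theorem eul_mulι (e : E) : eul E * mulι e = mulι e * eul E + mulι e := by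
  rw [eul, Finset.sum_mul, Finset.mul_sum]
  have : ∀ i ∈ Finset.univ, mulι (finBasis ℂ E i) * der ((finBasis ℂ E).coord i) * mulι e =
      mulι e * (mulι (finBasis ℂ E i) * der ((finBasis ℂ E).coord i)) +
        mulι ((finBasis ℂ E).coord i e • finBasis ℂ E i) := fun i _ => by
    rw [mul_assoc, der_mulι, mul_add, ← mul_assoc, mulι_comm, mul_assoc, map_smul, mul_smul_comm,
      mul_one]
  rw [Finset.sum_congr rfl this, Finset.sum_add_distrib, ← map_sum]
  congr 2
  exact (finBasis ℂ E).sum_repr e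

theorem isGradingOp_eul : IsGradingOp (eul E) := by
  rw [IsGradingOp, eq_top_iff]
  rintro f -
  induction f using Sy.induction with
  | C a =>
    refine Submodule.mem_iSup_of_mem 0 ?_
    rw [End.mem_eigenspace_iff, ← mul_one (MvPolynomial.C a), ← MvPolynomial.smul_eq_C_mul, map_smul]
    simp
  | add f f' h h' => exact Submodule.add_mem _ h h'
  | mul e f h =>
    refine Submodule.iSup_induction _ (motive := fun f => ι e * f ∈ _) h (fun n f hf => ?_) ?_ ?_
    · refine Submodule.mem_iSup_of_mem (n + 1) ?_
      rw [End.mem_eigenspace_iff] at hf ⊢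
      have := congrArg (fun T => T f) (eul_mulι e)
      simp only [End.mul_apply, LinearMap.add_apply, mulι_apply, hf] at this
      rw [this]
      push_cast
      rw [add_smul, one_smul, mul_smul_comm]
    · rw [mul_zero]; exact Submodule.zero_mem _
    · intro x y hx hy; rw [mul_add]; exact Submodule.add_mem _ hx hy

theorem ι_injective : Function.Injective (ι : E → Sy E) := by
  rw [injective_iff_map_eq_zero]
  intro e he
  rw [← (finBasis ℂ E).forall_coord_eq_zero_iff]
  intro i
  have := der_mul ((finBasis ℂ E).coord i) e (1 : Sy E)
  rw [he, zero_mul, map_zero, der_one, mul_zero, add_zero, eq_comm, smul_eq_zero] at this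
  exact this.resolve_right one_ne_zero

/-- The divided difference operator `f ↦ (f - s f) / a` of a transformation `s e = e - l(e) a`. -/
theorem exists_divDiff {s : E →ₗ[ℂ] E} {l : Dual ℂ E} {a : E} (ha : a ≠ 0)
    (hs : ∀ e, s e = e - l e • a) : ∃ Δ : End ℂ (Sy E), Δ 1 = 0 ∧
      ∀ e f, Δ (ι e * f) = l e • map s f + ι e * Δ f := by
  have ha' : ι a ≠ (0 : Sy E) := fun h => ha (ι_injective (h.trans (map_zero _).symm))
  have hinj : Function.Injective (mulι a : End ℂ (Sy E)) := fun f g hfg => mul_left_cancel₀ ha' hfg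
  -- Divisibility by `a` passes from `f` to `e f` because `e f - s(e f) = e (f - s f) + l(e) a
  -- s(f)`; the same identity gives the twisted Leibniz rule.
  have hdvd : ∀ f : Sy E, (LinearMap.id - (map s).toLinearMap : End ℂ (Sy E)) f ∈
      LinearMap.range (mulι a : End ℂ (Sy E)) := fun f => by
    induction f using Sy.induction with
    | C b => exact ⟨0, by simp [MvPolynomial.algHom_C]⟩
    | add f f' h h' => rw [map_add]; exact Submodule.add_mem _ h h'
    | mul e f h =>
      obtain ⟨g, hg⟩ := h
      refine ⟨l e • map s f + ι e * g, ?_⟩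
      simp only [mulι_apply, LinearMap.sub_apply, LinearMap.id_apply, AlgHom.toLinearMap_apply,
        map_mul, map_ι, hs, map_sub, map_smul] at hg ⊢
      rw [mul_add, mul_left_comm, hg, sub_mul, smul_mul_assoc, mul_smul_comm, mul_sub]
      abel
  refine ⟨(LinearEquiv.ofInjective _ hinj).symm.toLinearMap ∘ₗ LinearMap.codRestrict _ _ hdvd, ?_, ?_⟩
  · simp only [LinearMap.comp_apply, LinearEquiv.coe_coe, LinearEquiv.symm_apply_eq]
    ext1
    simp
  · intro e f
    have key : ∀ g, ι a * ((LinearEquiv.ofInjective _ hinj).symm.toLinearMap ∘ₗ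
        LinearMap.codRestrict _ _ hdvd) g = g - map s g := fun g =>
      congrArg Subtype.val ((LinearEquiv.ofInjective _ hinj).apply_symm_apply
        (LinearMap.codRestrict _ _ hdvd g))
    apply mul_left_cancel₀ ha'
    rw [mul_add, mul_left_comm, key, key, map_mul, map_ι, hs, map_sub, map_smul, sub_mul,
      smul_mul_assoc, mul_smul_comm, mul_sub]
    abel

section Tensor

variable {N : Type*} [AddCommGroup N] [Module ℂ N]

/-- Induction on the polynomial degree: identities between operators on `S(E) ⊗ N` can be checked on
`1 ⊗ N` and then propagated by their commutation relations with `E`, with no explicit formula. -/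
theorem tensor_induction {P : Sy E ⊗[ℂ] N → Prop} (one : ∀ n, P (1 ⊗ₜ n))
    (add : ∀ z z', P z → P z' → P (z + z')) (mul : ∀ e z, P z → P ((mulι e ⊠ (1 : End ℂ N)) z))
    (z : Sy E ⊗[ℂ] N) : P z := by
  induction z using TensorProduct.induction_on with
  | zero => simpa using one 0
  | add _ _ h₁ h₂ => exact add _ _ h₁ h₂
  | tmul f n =>
    induction f using Sy.induction with
    | C a =>
      rw [← mul_one (MvPolynomial.C a), ← MvPolynomial.smul_eq_C_mul, TensorProduct.smul_tmul]
      exact one _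
    | add f f' h h' => rw [TensorProduct.add_tmul]; exact add _ _ h h'
    | mul e f h => exact mul e _ h

end Tensor

end Sy

end SymmetricAlgebra

/-! ### Reflections and their roots under conjugation. -/

section Reflections

open Module

variable {h : Type u} [AddCommGroup h] [Module ℂ h]

theorem IsCReflection.conj {s : h ≃ₗ[ℂ] h} (hs : IsCReflection s) (g : h ≃ₗ[ℂ] h) :
    IsCReflection (g * s * g⁻¹) := by
  have e : ((g * s * g⁻¹ : h ≃ₗ[ℂ] h) : h →ₗ[ℂ] h) - LinearMap.id =
      g.toLinearMap ∘ₗ ((s : h →ₗ[ℂ] h) - LinearMap.id) ∘ₗ (g⁻¹ : h ≃ₗ[ℂ] h).toLinearMap := by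
    ext v
    simp
  have hr : LinearMap.range ((g⁻¹ : h ≃ₗ[ℂ] h).toLinearMap) = ⊤ :=
    LinearEquiv.range (g⁻¹ : h ≃ₗ[ℂ] h)
  rw [IsCReflection, e, LinearMap.range_comp, LinearMap.range_comp, hr, Submodule.map_top]
  exact (LinearEquiv.finrank_map_eq g _).trans hs

variable {G : Subgroup (h ≃ₗ[ℂ] h)}

/-- Conjugation of reflections. -/
def Refl.conj (g : G) : Refl G ≃ Refl G where
  toFun s := ⟨g * s.1 * g⁻¹, s.2.conj g⟩
  invFun s := ⟨g⁻¹ * s.1 * g, by simpa using s.2.conj (g⁻¹ : G)⟩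
  left_inv s := Subtype.ext (by simp [mul_assoc])
  right_inv s := Subtype.ext (by simp [mul_assoc])

theorem dual_reflRep_apply (g : G) (ξ : Dual ℂ h) (η : h) :
    (reflRep G).dual g ξ (reflRep G g η) = ξ η := by
  change ξ (reflRep G g⁻¹ (reflRep G g η)) = ξ η
  rw [← Module.End.mul_apply, ← map_mul, inv_mul_cancel, map_one, Module.End.one_apply]

namespace RootChoice

variable (R : RootChoice G)

/-- Half of `1 - λ_s`, with `λ_s` the nontrivial eigenvalue of `s` on `𝔥*`. -/
noncomputable def κ (s : Refl G) : ℂ := (1 - (R.eigen s).choose) / 2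

theorem κ_ne_zero (s : Refl G) : R.κ s ≠ 0 :=
  div_ne_zero (sub_ne_zero.2 (R.eigen s).choose_spec.1.symm) two_ne_zero

theorem α_ne_zero (s : Refl G) : R.α s ≠ 0 := fun h0 => by
  have := R.pairing s
  rw [h0] at this
  exact two_ne_zero this.symm

/-- The range of `s - 1` is the line through `α_s^∨`, so `s η - η` is a multiple of `α_s^∨`; pairing
with the eigenvector `α_s` determines the multiple. The relation between `κ'` and `κ` reads `(1 -
2κ)(1 - 2κ') = 1`: the nontrivial eigenvalues on `𝔥` and `𝔥*` are inverse to each other. -/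
theorem exists_reflRep_apply (s : Refl G) : ∃ κ' : ℂ,
    (∀ η, reflRep G s.1 η = η - (κ' * R.α s η) • R.αv s) ∧ κ' + R.κ s = 2 * R.κ s * κ' := by
  obtain ⟨μ, hμ, hv⟩ := R.eigenv s
  have hα := (R.eigen s).choose_spec.2
  set l := (R.eigen s).choose with hl
  have hs : finrank ℂ (LinearMap.range (((s.1 : h ≃ₗ[ℂ] h) : h →ₗ[ℂ] h) - LinearMap.id)) = 1 := s.2
  have hav : R.αv s ≠ 0 := fun h0 => by
    have := R.pairing s
    rw [h0, map_zero] at this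
    exact two_ne_zero this.symm
  have hmem : R.αv s ∈ LinearMap.range (((s.1 : h ≃ₗ[ℂ] h) : h →ₗ[ℂ] h) - LinearMap.id) := by
    refine ⟨(μ - 1)⁻¹ • R.αv s, ?_⟩
    have hv' : ((s.1 : h ≃ₗ[ℂ] h) : h →ₗ[ℂ] h) (R.αv s) = μ • R.αv s := hv
    rw [map_smul, LinearMap.sub_apply, hv', LinearMap.id_apply]
    nth_rewrite 2 [← one_smul ℂ (R.αv s)]
    rw [← sub_smul, smul_smul, inv_mul_cancel₀ (sub_ne_zero.2 hμ), one_smul]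
  have hex : ∀ η, ∃ c : ℂ, reflRep G s.1 η = η + c • R.αv s := fun η => by
    obtain ⟨c, hc⟩ := (finrank_eq_one_iff_of_nonzero' (⟨R.αv s, hmem⟩ : LinearMap.range _)
      (fun h0 => hav (congrArg Subtype.val h0))).1 hs ⟨_, ⟨η, rfl⟩⟩
    refine ⟨c, ?_⟩
    have := congrArg Subtype.val hc
    change c • R.αv s = reflRep G s.1 η - η at this
    rw [this]; abel
  have hrel : ∀ η c, reflRep G s.1 η = η + c • R.αv s → R.α s η = l * (R.α s η + 2 * c) :=
    fun η c hc => by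
      have := dual_reflRep_apply s.1 (R.α s) η
      rw [hα, hc, LinearMap.smul_apply, map_add, map_smul, R.pairing, smul_eq_mul, smul_eq_mul] at this
      linear_combination -this
  have hl0 : l ≠ 0 := fun h0 => by
    obtain ⟨c, hc⟩ := hex (R.αv s)
    have := hrel _ c hc
    rw [h0, zero_mul, R.pairing] at this
    exact two_ne_zero this
  refine ⟨-((1 - l) / (2 * l)), fun η => ?_, ?_⟩
  · obtain ⟨c, hc⟩ := hex η
    have := hrel _ c hc
    have hc' : c = (1 - l) / (2 * l) * R.α s η := by
      field_simp
      linear_combination -this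
    rw [hc, hc', neg_mul, neg_smul, sub_neg_eq_add]
  · rw [κ, ← hl]
    field_simp
    ring

theorem dual_apply (s : Refl G) (ξ : Dual ℂ h) :
    (reflRep G).dual s.1 ξ = ξ - (R.κ s * ξ (R.αv s)) • R.α s := by
  obtain ⟨κ', h1, h2⟩ := R.exists_reflRep_apply s
  ext η
  -- An explicit preimage of `η` under `s` turns the dual action into evaluation at that preimage.
  have : η = reflRep G s.1 (η - (R.κ s * R.α s η) • R.αv s) := by
    rw [h1]
    simp only [map_sub, map_smul, R.pairing, smul_eq_mul]
    have e : κ' * (R.α s η - R.κ s * R.α s η * 2) = - (R.κ s * R.α s η) := by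
      linear_combination R.α s η * h2
    rw [e, neg_smul, sub_neg_eq_add, sub_add_cancel]
  conv_lhs => rw [this, dual_reflRep_apply]
  simp only [map_sub, map_smul, smul_eq_mul, LinearMap.sub_apply, LinearMap.smul_apply]
  ring

/-- The roots chosen for `g s g⁻¹` need not be the transports of those of `s`, but `κ α ⊗ α^∨` is
determined by the reflection: it is the tensor of `1 - s` on `𝔥*`. Both sides come from computing `g
s g⁻¹ (g ξ)` in two ways. -/
theorem κ_mul_conj (g : G) (s : Refl G) (ξ : Dual ℂ h) (η : h) :
    R.κ (Refl.conj g s) * R.α (Refl.conj g s) (reflRep G g η) *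
      (reflRep G).dual g ξ (R.αv (Refl.conj g s)) = R.κ s * R.α s η * ξ (R.αv s) := by
  have h1 := R.dual_apply (Refl.conj g s) ((reflRep G).dual g ξ)
  have h2 : (reflRep G).dual (Refl.conj g s).1 ((reflRep G).dual g ξ) =
      (reflRep G).dual g ((reflRep G).dual s.1 ξ) := by
    rw [← Module.End.mul_apply, ← Module.End.mul_apply, ← map_mul, ← map_mul]
    congr 2
    simp [Refl.conj]
  rw [h2, R.dual_apply s] at h1
  have h3 := congrArg (fun f => f (reflRep G g η)) h1
  simp only [map_sub, map_smul, LinearMap.sub_apply, LinearMap.smul_apply, dual_reflRep_apply,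
    smul_eq_mul] at h3
  linear_combination h3

/-- The previous identity is evaluated at two pairs of roots: `h2` gives the equality up to a common
factor, and `h1`, where the pairing `2` enters squared, shows that this factor is nonzero. -/
theorem κ_conj (g : G) (s : Refl G) : R.κ (Refl.conj g s) = R.κ s := by
  have hinv : ∀ η, reflRep G g (reflRep G g⁻¹ η) = η := fun η => by
    rw [← Module.End.mul_apply, ← map_mul, mul_inv_cancel, map_one, Module.End.one_apply]
  have hinv' : ∀ ξ, (reflRep G).dual g ((reflRep G).dual g⁻¹ ξ) = ξ := fun η => by
    rw [← Module.End.mul_apply, ← map_mul, mul_inv_cancel, map_one, Module.End.one_apply]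
  have h1 := R.κ_mul_conj g s ((reflRep G).dual g⁻¹ (R.α (Refl.conj g s)))
    (reflRep G g⁻¹ (R.αv (Refl.conj g s)))
  rw [hinv, hinv', R.pairing] at h1
  have h2 := R.κ_mul_conj g s (R.α s) (reflRep G g⁻¹ (R.αv (Refl.conj g s)))
  rw [hinv, R.pairing, R.pairing] at h2
  have e : (reflRep G).dual g (R.α s) (R.αv (Refl.conj g s)) =
      R.α s (reflRep G g⁻¹ (R.αv (Refl.conj g s))) := by
    conv_lhs => rw [← hinv (R.αv (Refl.conj g s)), dual_reflRep_apply]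
  rw [e] at h2
  have hne : R.α s (reflRep G g⁻¹ (R.αv (Refl.conj g s))) ≠ 0 := fun h0 => by
    rw [h0, mul_zero, zero_mul] at h1
    exact R.κ_ne_zero (Refl.conj g s) (by linear_combination h1 / 4)
  have := mul_right_cancel₀ hne (show (R.κ (Refl.conj g s) * 2) * _ = (R.κ s * 2) * _ by
    linear_combination h2)
  linear_combination this / 2

/-- With `κ` cancelled, this is the form that makes the sum over reflections in `[y, x]`
equivariant. -/
theorem α_mul_conj (g : G) (s : Refl G) (ξ : Dual ℂ h) (η : h) :
    R.α (Refl.conj g s) (reflRep G g η) * (reflRep G).dual g ξ (R.αv (Refl.conj g s)) =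
      R.α s η * ξ (R.αv s) := by
  have := R.κ_mul_conj g s ξ η
  rw [R.κ_conj, mul_assoc, mul_assoc] at this
  exact mul_left_cancel₀ (R.κ_ne_zero s) this

end RootChoice

variable (D : CherData G)

theorem CherData.c_conj (g : G) (s : Refl G) : D.c (Refl.conj g s) = D.c s :=
  D.conj g s _ rfl

end Reflections

/-! ### Clifford relations on the spin module. -/

section Spin

namespace Cher

open Module

variable {h : Type u} [AddCommGroup h] [Module ℂ h]

theorem spinX_apply (ξ : Dual ℂ h) (ω : Spin h) :
    spinX ξ ω = (2 : ℂ) • (ExteriorAlgebra.ι ℂ ξ * ω) := rfl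

theorem spinY_apply (η : h) (ω : Spin h) :
    spinY η ω = -CliffordAlgebra.contractLeft (Q := (0 : QuadraticForm ℂ (Dual ℂ h)))
      (Dual.eval ℂ h η) ω := rfl

theorem spinY_one (η : h) : spinY η (1 : Spin h) = 0 := by
  rw [spinY_apply, CliffordAlgebra.contractLeft_one, neg_zero]

theorem spinX_anticomm (ξ ξ' : Dual ℂ h) : spinX ξ * spinX ξ' + spinX ξ' * spinX ξ = 0 := by
  refine LinearMap.ext fun ω => ?_
  simp only [LinearMap.add_apply, Module.End.mul_apply, spinX_apply, mul_smul_comm, ← smul_add,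
    ← mul_assoc, ← add_mul, ExteriorAlgebra.ι_add_mul_swap, zero_mul, smul_zero, LinearMap.zero_apply]

theorem spinY_anticomm (η η' : h) : spinY η * spinY η' + spinY η' * spinY η = 0 := by
  refine LinearMap.ext fun ω => ?_
  simp only [LinearMap.add_apply, Module.End.mul_apply, spinY_apply, map_neg, neg_neg]
  rw [CliffordAlgebra.contractLeft_comm, neg_add_cancel]
  rfl

theorem spinX_swap (ξ ξ' : Dual ℂ h) (ω : Spin h) : spinX ξ (spinX ξ' ω) = -spinX ξ' (spinX ξ ω) :=
  eq_neg_of_add_eq_zero_left (congrArg (fun T => T ω) (spinX_anticomm ξ ξ'))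

theorem spinY_swap (η η' : h) (ω : Spin h) : spinY η (spinY η' ω) = -spinY η' (spinY η ω) :=
  eq_neg_of_add_eq_zero_left (congrArg (fun T => T ω) (spinY_anticomm η η'))

theorem spinX_spinY (ξ : Dual ℂ h) (η : h) :
    spinX ξ * spinY η + spinY η * spinX ξ = (-2 * ξ η) • (1 : End ℂ (Spin h)) := by
  refine LinearMap.ext fun ω => ?_
  have := CliffordAlgebra.contractLeft_ι_mul (Q := (0 : QuadraticForm ℂ (Dual ℂ h)))
    (d := Dual.eval ℂ h η) ξ ω
  simp only [LinearMap.add_apply, Module.End.mul_apply, spinY_apply, spinX_apply, map_smul,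
    LinearMap.smul_apply, Module.End.one_apply, mul_neg, smul_neg]
  rw [show ExteriorAlgebra.ι ℂ ξ = CliffordAlgebra.ι (0 : QuadraticForm ℂ (Dual ℂ h)) ξ from rfl, this,
    Dual.eval_apply, smul_sub, mul_smul, neg_smul, neg_sub]
  abel

theorem spinY_spinX_apply (ξ : Dual ℂ h) (η : h) (ω : Spin h) :
    spinY η (spinX ξ ω) = (-2 * ξ η) • ω - spinX ξ (spinY η ω) :=
  eq_sub_of_add_eq' (congrArg (fun T => T ω) (spinX_spinY ξ η))

theorem spin_induction {P : Spin h → Prop} (one : P 1) (smul : ∀ (a : ℂ) ω, P ω → P (a • ω))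
    (add : ∀ ω ω', P ω → P ω' → P (ω + ω')) (mul : ∀ ξ ω, P ω → P (spinX ξ ω)) (ω : Spin h) : P ω := by
  induction ω using CliffordAlgebra.left_induction with
  | algebraMap r => rw [Algebra.algebraMap_eq_smul_one]; exact smul _ _ one
  | add a b ha hb => exact add _ _ ha hb
  | ι_mul a ξ ha =>
    -- The factor `1/2` undoes the normalisation `ω ↦ 2 ξ ∧ ω` of `spinX`.
    have := smul (1 / 2) _ (mul ξ a ha)
    rwa [spinX_apply, smul_smul, one_div, inv_mul_cancel₀ two_ne_zero, one_smul] at this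

theorem spin_hom_ext {Y : Type*} [AddCommGroup Y] [Module ℂ Y] {S T : Spin h →ₗ[ℂ] Y}
    (one : S 1 = T 1) (mul : ∀ ξ ω, S ω = T ω → S (spinX ξ ω) = T (spinX ξ ω)) : S = T :=
  LinearMap.ext fun ω => spin_induction (P := fun ω => S ω = T ω) one
    (fun a ω h => by rw [map_smul, map_smul, h]) (fun ω ω' h h' => by rw [map_add, map_add, h, h'])
    mul ω

section Number

variable [FiniteDimensional ℂ h]

/-- The operator acting on `⋀^ℓ 𝔥*` by `ℓ`. -/
noncomputable def spinN (h : Type u) [AddCommGroup h] [Module ℂ h] [FiniteDimensional ℂ h] :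
    End ℂ (Spin h) :=
  -(1 / 2 : ℂ) • ∑ j, spinX ((finBasis ℂ h).coord j) * spinY (finBasis ℂ h j)

theorem spinN_apply (ω : Spin h) : spinN h ω =
    -(1 / 2 : ℂ) • ∑ j, spinX ((finBasis ℂ h).coord j) (spinY (finBasis ℂ h j) ω) := by
  simp [spinN]

theorem spinN_one : spinN h 1 = 0 := by
  simp [spinN_apply, spinY_one]

theorem spinN_spinX (ξ : Dual ℂ h) (ω : Spin h) :
    spinN h (spinX ξ ω) = spinX ξ (spinN h ω) + spinX ξ ω := by
  have e : spinX ξ ω = ∑ j, ξ (finBasis ℂ h j) • spinX ((finBasis ℂ h).coord j) ω := by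
    conv_lhs => rw [← (finBasis ℂ h).sum_dual_apply_smul_coord ξ, map_sum, LinearMap.sum_apply]
    simp only [map_smul, LinearMap.smul_apply]
  conv_rhs => enter [2]; rw [e]
  rw [spinN_apply, spinN_apply, map_smul, map_sum, Finset.smul_sum, Finset.smul_sum,
    ← Finset.sum_add_distrib]
  refine Finset.sum_congr rfl fun j _ => ?_
  rw [spinY_spinX_apply, map_sub, map_smul, spinX_swap]
  module

theorem spinN_spinY (η : h) (ω : Spin h) :
    spinN h (spinY η ω) = spinY η (spinN h ω) - spinY η ω := by
  have e : spinY η ω = ∑ j, (finBasis ℂ h).coord j η • spinY (finBasis ℂ h j) ω := by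
    conv_lhs => rw [← (finBasis ℂ h).sum_repr η, map_sum, LinearMap.sum_apply]
    simp only [map_smul, LinearMap.smul_apply]
    rfl
  conv_rhs => enter [2]; rw [e]
  rw [spinN_apply, spinN_apply, map_smul, map_sum, Finset.smul_sum, Finset.smul_sum,
    ← Finset.sum_sub_distrib]
  refine Finset.sum_congr rfl fun j _ => ?_
  rw [spinY_spinX_apply, spinY_swap _ η, map_neg]
  module

theorem spinN_of_mem {ℓ : ℕ} {ω : Spin h} (hω : ω ∈ ⋀[ℂ]^ℓ (Dual ℂ h)) :
    spinN h ω = (ℓ : ℂ) • ω := by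
  induction hω using Submodule.pow_induction_on_left' with
  | algebraMap r =>
    rw [Algebra.algebraMap_eq_smul_one, map_smul, spinN_one]; simp
  | add x y i _ _ hx hy => rw [map_add, hx, hy, smul_add]
  | mem_mul m hm i x _ hx =>
    obtain ⟨ξ, rfl⟩ := hm
    have := spinN_spinX ξ x
    simp only [spinX_apply, map_smul, hx] at this
    rw [smul_comm _ (2 : ℂ), ← smul_add] at this
    have := smul_right_injective _ (two_ne_zero (α := ℂ)) this
    rw [this]
    push_cast
    rw [add_smul, one_smul]

end Number

variable {G : Subgroup (h ≃ₗ[ℂ] h)}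

theorem spinRep_one (g : G) : spinRep G g (1 : Spin h) = 1 :=
  map_one (ExteriorAlgebra.map ((reflRep G).dual g))

theorem spinRep_spinX (g : G) (ξ : Dual ℂ h) (ω : Spin h) :
    spinRep G g (spinX ξ ω) = spinX ((reflRep G).dual g ξ) (spinRep G g ω) := by
  change ExteriorAlgebra.map ((reflRep G).dual g) ((2 : ℂ) • (ExteriorAlgebra.ι ℂ ξ * ω)) =
    (2 : ℂ) • (ExteriorAlgebra.ι ℂ ((reflRep G).dual g ξ) *
      ExteriorAlgebra.map ((reflRep G).dual g) ω)
  rw [map_smul, map_mul, ExteriorAlgebra.map_apply_ι]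

/-- Equivalently, `s ω = ω - κ α_s ∧ ∂_{α_s^∨} ω`. Both sides fix `1` and have the same commutation
with `spinX ξ`, since the Clifford square of `α_s` is zero. This lets the reflections in `[y, x]` be
absorbed into the diagonal action when the Dirac operator is squared. -/
theorem spinRep_refl (R : RootChoice G) (s : Refl G) :
    spinRep G s.1 = 1 + (R.κ s / 2) • (spinX (R.α s) * spinY (R.αv s)) := by
  refine spin_hom_ext ?_ fun ξ ω hω => ?_
  · simp [spinRep_one, spinY_one]
  · have e4 : spinX (R.α s) (spinX (R.α s) (spinY (R.αv s) ω)) = 0 := by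
      have h2 : (2 : ℂ) • spinX (R.α s) (spinX (R.α s) (spinY (R.αv s) ω)) = 0 := by
        rw [two_smul]; exact add_eq_zero_iff_eq_neg.2 (spinX_swap _ _ _)
      exact (smul_eq_zero.1 h2).resolve_left two_ne_zero
    rw [spinRep_spinX, hω, R.dual_apply]
    simp only [LinearMap.add_apply, Module.End.one_apply, LinearMap.smul_apply, Module.End.mul_apply,
      map_sub, map_add, map_smul, LinearMap.sub_apply, e4, smul_zero, spinY_spinX_apply,
      spinX_swap (R.α s) ξ]
    module

end Cher

end Spin

/-! ### Dunkl operators and the PBW model of induced modules. -/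

section Induction

open Module
local infixl:70 " ⊠ " => TensorProduct.map

variable {h : Type u} [AddCommGroup h] [Module ℂ h]

namespace Cher

theorem induction {G : Subgroup (h ≃ₗ[ℂ] h)} [Finite G] {D : CherData G} {P : Cher D → Prop}
    (gen : ∀ z, P (gen D z)) (algebraMap : ∀ r : ℂ, P (algebraMap ℂ (Cher D) r))
    (add : ∀ a b, P a → P b → P (a + b)) (mul : ∀ a b, P a → P b → P (a * b)) (a : Cher D) : P a := by
  obtain ⟨b, rfl⟩ := RingQuot.mkAlgHom_surjective ℂ (CherRel D) a
  induction b using FreeAlgebra.induction with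
  | grade0 r => rw [AlgHom.commutes]; exact algebraMap r
  | grade1 z => exact gen z
  | mul a b ha hb => rw [map_mul]; exact mul _ _ ha hb
  | add a b ha hb => rw [map_add]; exact add _ _ ha hb

end Cher

/-- A module over `ℂ[𝔥*] ⋊ ℂG`: a representation of `G` with commuting operators indexed by `𝔥`. -/
structure YRep (G : Subgroup (h ≃ₗ[ℂ] h)) (N : Type*) [AddCommGroup N] [Module ℂ N] where
  rep : Representation ℂ G N
  y : h →ₗ[ℂ] End ℂ N
  y_comm : ∀ η η' n, y η (y η' n) = y η' (y η n)
  rep_y : ∀ g η n, rep g (y η n) = y (reflRep G g η) (rep g n)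

variable [FiniteDimensional ℂ h] {G : Subgroup (h ≃ₗ[ℂ] h)}

/-- The divided difference operator attached to a reflection. -/
noncomputable def RootChoice.divDiff (R : RootChoice G) (s : Refl G) : End ℂ (Sy (Dual ℂ h)) :=
  (Sy.exists_divDiff (s := (reflRep G).dual s.1) (l := R.κ s • Dual.eval ℂ h (R.αv s))
    (R.α_ne_zero s) fun ξ => R.dual_apply s ξ).choose

theorem RootChoice.divDiff_one (R : RootChoice G) (s : Refl G) : R.divDiff s 1 = 0 :=
  (Sy.exists_divDiff (s := (reflRep G).dual s.1) (l := R.κ s • Dual.eval ℂ h (R.αv s))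
    (R.α_ne_zero s) fun ξ => R.dual_apply s ξ).choose_spec.1

theorem RootChoice.divDiff_mul (R : RootChoice G) (s : Refl G) (ξ : Dual ℂ h) (f : Sy (Dual ℂ h)) :
    R.divDiff s (Sy.ι ξ * f) =
      (R.κ s * ξ (R.αv s)) • Sy.rep (reflRep G).dual s.1 f + Sy.ι ξ * R.divDiff s f :=
  (Sy.exists_divDiff (s := (reflRep G).dual s.1) (l := R.κ s • Dual.eval ℂ h (R.αv s))
    (R.α_ne_zero s) fun ξ => R.dual_apply s ξ).choose_spec.2 ξ f

namespace YRep

variable [Finite G] {N : Type*} [AddCommGroup N] [Module ℂ N] (D : CherData G) (M : YRep G N)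

/-- Multiplication by `𝔥*` on `S(𝔥*) ⊗ N`. -/
noncomputable def opX : Dual ℂ h →ₗ[ℂ] End ℂ (Sy (Dual ℂ h) ⊗[ℂ] N) where
  toFun ξ := Sy.mulι ξ ⊠ 1
  map_add' ξ ξ' := by rw [map_add, TensorProduct.map_add_left]
  map_smul' a ξ := by rw [map_smul, TensorProduct.map_smul_left]; rfl

/-- The diagonal action of `G` on `S(𝔥*) ⊗ N`. -/
noncomputable def opG : Representation ℂ G (Sy (Dual ℂ h) ⊗[ℂ] N) :=
  (Sy.rep (reflRep G).dual).tprod M.rep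

/-- The Dunkl operators on `S(𝔥*) ⊗ N`. -/
noncomputable def opY : h →ₗ[ℂ] End ℂ (Sy (Dual ℂ h) ⊗[ℂ] N) where
  -- `divDiff s` contributes `κ_s ξ(α_s^∨) s` to the commutator with `ξ`; dividing by `κ_s` leaves
  -- the coefficient prescribed by the relation for `[y, x]`.
  toFun η := D.t • (Sy.der (Dual.eval ℂ h η) ⊠ 1) -
    ∑ s : Refl G, (D.c s * D.roots.α s η / D.roots.κ s) • (D.roots.divDiff s ⊠ M.rep s.1) + 1 ⊠ M.y η
  map_add' η η' := by
    simp only [map_add, TensorProduct.map_add_left, TensorProduct.map_add_right, mul_add, add_div,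
      add_smul, Finset.sum_add_distrib, smul_add]
    abel
  map_smul' a η := by
    have e : ∑ s : Refl G, (D.c s * D.roots.α s (a • η) / D.roots.κ s) • (D.roots.divDiff s ⊠ M.rep s.1) =
        a • ∑ s : Refl G, (D.c s * D.roots.α s η / D.roots.κ s) • (D.roots.divDiff s ⊠ M.rep s.1) := by
      rw [Finset.smul_sum]
      refine Finset.sum_congr rfl fun s _ => ?_
      rw [smul_smul, map_smul, smul_eq_mul]
      congr 1
      ring
    rw [e]
    simp only [map_smul, TensorProduct.map_smul_left, TensorProduct.map_smul_right, RingHom.id_apply]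
    module

/-- The commutator of the action of `η ∈ 𝔥` and `ξ ∈ 𝔥*`. -/
noncomputable def opC (η : h) (ξ : Dual ℂ h) : End ℂ (Sy (Dual ℂ h) ⊗[ℂ] N) :=
  (D.t * ξ η) • 1 - ∑ s : Refl G, (D.c s * D.roots.α s η * ξ (D.roots.αv s)) • M.opG s.1

theorem opX_tmul (ξ : Dual ℂ h) (f : Sy (Dual ℂ h)) (n : N) :
    opX ξ (f ⊗ₜ[ℂ] n) = (Sy.ι ξ * f) ⊗ₜ n := rfl

theorem opG_tmul (g : G) (f : Sy (Dual ℂ h)) (n : N) :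
    M.opG g (f ⊗ₜ[ℂ] n) = Sy.rep (reflRep G).dual g f ⊗ₜ M.rep g n := rfl

theorem opG_one (g : G) (n : N) : M.opG g (1 ⊗ₜ[ℂ] n) = 1 ⊗ₜ M.rep g n := by
  rw [opG_tmul, Sy.rep_one]

theorem opY_tmul (η : h) (f : Sy (Dual ℂ h)) (n : N) :
    M.opY D η (f ⊗ₜ[ℂ] n) = D.t • (Sy.der (Dual.eval ℂ h η) f ⊗ₜ n) -
      ∑ s : Refl G, (D.c s * D.roots.α s η / D.roots.κ s) • (D.roots.divDiff s f ⊗ₜ M.rep s.1 n) +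
        f ⊗ₜ M.y η n := by
  simp [opY, LinearMap.sum_apply]

theorem opC_apply (η : h) (ξ : Dual ℂ h) (z : Sy (Dual ℂ h) ⊗[ℂ] N) :
    M.opC D η ξ z = (D.t * ξ η) • z -
      ∑ s : Refl G, (D.c s * D.roots.α s η * ξ (D.roots.αv s)) • M.opG s.1 z := by
  simp [opC, LinearMap.sum_apply]

theorem opY_one (η : h) (n : N) : M.opY D η (1 ⊗ₜ[ℂ] n) = 1 ⊗ₜ M.y η n := by
  rw [opY_tmul, Sy.der_one, TensorProduct.zero_tmul, smul_zero]
  simp [RootChoice.divDiff_one]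

theorem opX_comm (ξ ξ' : Dual ℂ h) (z : Sy (Dual ℂ h) ⊗[ℂ] N) :
    opX ξ (opX ξ' z) = opX ξ' (opX ξ z) := by
  induction z using TensorProduct.induction_on with
  | zero => simp
  | add z z' h h' => simp only [map_add, h, h']
  | tmul f n => rw [opX_tmul, opX_tmul, opX_tmul, opX_tmul, mul_left_comm]

theorem opG_opX (g : G) (ξ : Dual ℂ h) (z : Sy (Dual ℂ h) ⊗[ℂ] N) :
    M.opG g (opX ξ z) = opX ((reflRep G).dual g ξ) (M.opG g z) := by
  induction z using TensorProduct.induction_on with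
  | zero => simp
  | add z z' h h' => simp only [map_add, h, h']
  | tmul f n => rw [opX_tmul, opG_tmul, Sy.rep_mul, opG_tmul, opX_tmul]

theorem opY_opX (η : h) (ξ : Dual ℂ h) (z : Sy (Dual ℂ h) ⊗[ℂ] N) :
    M.opY D η (opX ξ z) = opX ξ (M.opY D η z) + M.opC D η ξ z := by
  induction z using TensorProduct.induction_on with
  | zero => simp
  | add z z' h h' => simp only [map_add, h, h']; abel
  | tmul f n =>
    rw [opX_tmul, opY_tmul, opY_tmul, opC_apply, Sy.der_mul]
    have : ∀ s ∈ (Finset.univ : Finset (Refl G)), (D.c s * D.roots.α s η / D.roots.κ s) •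
        (D.roots.divDiff s (Sy.ι ξ * f) ⊗ₜ[ℂ] M.rep s.1 n) =
        (D.c s * D.roots.α s η * ξ (D.roots.αv s)) • M.opG s.1 (f ⊗ₜ n) +
        (D.c s * D.roots.α s η / D.roots.κ s) • opX ξ (D.roots.divDiff s f ⊗ₜ[ℂ] M.rep s.1 n) :=
      fun s _ => by
        rw [RootChoice.divDiff_mul, TensorProduct.add_tmul, smul_add, opX_tmul, ← TensorProduct.smul_tmul',
          smul_smul, opG_tmul]
        congr 2
        field_simp [D.roots.κ_ne_zero s]
    rw [Finset.sum_congr rfl this, Finset.sum_add_distrib, TensorProduct.add_tmul, ← TensorProduct.smul_tmul',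
      smul_add, smul_smul, Dual.eval_apply, map_add, map_sub, map_smul, map_sum, opX_tmul, opX_tmul]
    simp only [map_smul]
    abel

/-- Conjugation by `g` permutes the reflections, preserving `c` and the tensors `α_s ⊗ α_s^∨`. -/
theorem opG_opC (g : G) (η : h) (ξ : Dual ℂ h) (z : Sy (Dual ℂ h) ⊗[ℂ] N) :
    M.opG g (M.opC D η ξ z) = M.opC D (reflRep G g η) ((reflRep G).dual g ξ) (M.opG g z) := by
  rw [opC_apply, opC_apply, map_sub, map_smul, map_sum, dual_reflRep_apply]
  congr 1
  conv_rhs => rw [← (Refl.conj g).sum_comp]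
  refine Finset.sum_congr rfl fun s _ => ?_
  rw [map_smul, D.c_conj, mul_assoc, mul_assoc, D.roots.α_mul_conj, ← Module.End.mul_apply,
    ← Module.End.mul_apply, ← map_mul, ← map_mul]
  congr 3
  simp [Refl.conj]

/-- Instead of transforming the divided differences, one compares commutators with `𝔥*`: they agree
by `opG_opC`, and the two sides agree on `1 ⊗ N`. -/
theorem opG_opY (g : G) (η : h) (z : Sy (Dual ℂ h) ⊗[ℂ] N) :
    M.opG g (M.opY D η z) = M.opY D (reflRep G g η) (M.opG g z) := by
  induction z using Sy.tensor_induction with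
  | one n => rw [opY_one, opG_one, opG_one, opY_one, M.rep_y]
  | add z z' h h' => simp only [map_add, h, h']
  | mul ξ z hz =>
    change M.opG g (M.opY D η (opX ξ z)) = M.opY D (reflRep G g η) (M.opG g (opX ξ z))
    rw [opY_opX, map_add, opG_opX, opG_opX, opY_opX, hz, opG_opC]

/-- Since `s η' - η'` is a multiple of `α_s(η') α_s^∨`, the commutator of `[η, ξ]` with `η'` is a
sum over `s` with coefficients containing `α_s(η) α_s(η')`, which is symmetric. This is the Jacobi
identity needed for the commutativity of Dunkl operators. -/
theorem opC_opY (η η' : h) (ξ : Dual ℂ h) (z : Sy (Dual ℂ h) ⊗[ℂ] N) :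
    M.opC D η ξ (M.opY D η' z) - M.opY D η' (M.opC D η ξ z) =
      M.opC D η' ξ (M.opY D η z) - M.opY D η (M.opC D η' ξ z) := by
  have key : ∃ κ' : Refl G → ℂ, ∀ η η' : h,
      M.opC D η ξ (M.opY D η' z) - M.opY D η' (M.opC D η ξ z) =
        ∑ s : Refl G, (D.c s * ξ (D.roots.αv s) * κ' s * (D.roots.α s η * D.roots.α s η')) •
          M.opY D (D.roots.αv s) (M.opG s.1 z) := by
    choose κ' hκ using fun s => D.roots.exists_reflRep_apply s
    refine ⟨κ', fun η η' => ?_⟩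
    rw [opC_apply, opC_apply, map_sub, map_smul, map_sum, sub_sub_sub_cancel_left,
      ← Finset.sum_sub_distrib]
    refine Finset.sum_congr rfl fun s _ => ?_
    rw [map_smul, opG_opY, (hκ s).1, map_sub, map_smul, LinearMap.sub_apply, LinearMap.smul_apply]
    module
  obtain ⟨κ', hκ⟩ := key
  rw [hκ, hκ]
  refine Finset.sum_congr rfl fun s _ => ?_
  rw [mul_comm (D.roots.α s η)]

/-- Dunkl's theorem: by `opC_opY` the commutator of two Dunkl operators commutes with `𝔥*`, and it
vanishes on `1 ⊗ N`. -/
theorem opY_comm (η η' : h) (z : Sy (Dual ℂ h) ⊗[ℂ] N) :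
    M.opY D η (M.opY D η' z) = M.opY D η' (M.opY D η z) := by
  induction z using Sy.tensor_induction with
  | one n => rw [opY_one, opY_one, opY_one, opY_one, M.y_comm]
  | add z z' h h' => simp only [map_add, h, h']
  | mul ξ z hz =>
    change M.opY D η (M.opY D η' (opX ξ z)) = M.opY D η' (M.opY D η (opX ξ z))
    rw [opY_opX, opY_opX, map_add, map_add, opY_opX, opY_opX, hz, add_assoc, add_assoc]
    congr 1
    have := M.opC_opY D η η' ξ z
    rw [sub_eq_sub_iff_add_eq_add] at this
    exact this

/-- The action of the generators of `H_{t,c}` on `S(𝔥*) ⊗ N`. -/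
noncomputable def opGen : CherGen G → End ℂ (Sy (Dual ℂ h) ⊗[ℂ] N)
  | .x ξ => opX ξ
  | .y η => M.opY D η
  | .g g => M.opG g

/-- The module over `H_{t,c}` induced from `N`, realised on `S(𝔥*) ⊗ N`. -/
noncomputable def indAct : Cher D →ₐ[ℂ] End ℂ (Sy (Dual ℂ h) ⊗[ℂ] N) :=
  RingQuot.liftAlgHom ℂ ⟨FreeAlgebra.lift ℂ (M.opGen D), by
    intro a b hab
    cases hab with
    | x_add ξ ξ' => simp [opGen]
    | x_smul a ξ => simp [opGen]
    | y_add η η' => simp [opGen]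
    | y_smul a η => simp [opGen]
    | g_one => simp [opGen]
    | g_mul g g' => simp [opGen]
    | y_comm η η' =>
      simp only [map_mul, FreeAlgebra.lift_ι_apply, opGen]
      exact LinearMap.ext fun z => M.opY_comm D η η' z
    | x_comm ξ ξ' =>
      simp only [map_mul, FreeAlgebra.lift_ι_apply, opGen]
      exact LinearMap.ext fun z => opX_comm ξ ξ' z
    | g_y g η =>
      simp only [map_mul, FreeAlgebra.lift_ι_apply, opGen]
      exact LinearMap.ext fun z => M.opG_opY D g η z
    | g_x g ξ =>
      simp only [map_mul, FreeAlgebra.lift_ι_apply, opGen]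
      exact LinearMap.ext fun z => M.opG_opX g ξ z
    | y_x η ξ =>
      rw [map_sub, map_mul, map_mul, map_sub, AlgHom.commutes, map_sum]
      simp only [map_smul, FreeAlgebra.lift_ι_apply, opGen]
      refine LinearMap.ext fun z => ?_
      rw [Algebra.algebraMap_eq_smul_one]
      exact sub_eq_iff_eq_add'.2 (M.opY_opX D η ξ z)⟩

theorem indAct_gen (z : CherGen G) : M.indAct D (Cher.gen D z) = M.opGen D z :=
  (RingQuot.liftAlgHom_mkAlgHom_apply ℂ _ _ (FreeAlgebra.ι ℂ z)).trans (FreeAlgebra.lift_ι_apply _ _)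

section Frobenius

variable {X : Type*} [AddCommGroup X] [Module ℂ X] [Module (Cher D) X] [IsScalarTower ℂ (Cher D) X]

omit [FiniteDimensional ℂ h] in
theorem _root_.Cher.y_smul_x_smul (η : h) (ξ : Dual ℂ h) (m : X) :
    Cher.y D η • Cher.x D ξ • m = Cher.x D ξ • Cher.y D η • m + ((D.t * ξ η) • m -
      ∑ s : Refl G, (D.c s * D.roots.α s η * ξ (D.roots.αv s)) • Cher.g D s.1 • m) := by
  have := congrArg (fun a => a • m) (Cher.y_mul_x D η ξ)
  simp only [sub_smul, algebraMap_smul, Finset.sum_smul, smul_assoc] at this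
  rw [mul_smul (Cher.gen D _), mul_smul (Cher.gen D _)] at this
  exact sub_eq_iff_eq_add'.1 this

/-- Frobenius reciprocity for the induced module. -/
theorem exists_indLift (φ : N →ₗ[ℂ] X) (hg : ∀ g n, φ (M.rep g n) = Cher.g D g • φ n)
    (hy : ∀ η n, φ (M.y η n) = Cher.y D η • φ n) :
    ∃ Φ : Sy (Dual ℂ h) ⊗[ℂ] N →ₗ[ℂ] X, (∀ a z, Φ (M.indAct D a z) = a • Φ z) ∧ ∀ n, Φ (1 ⊗ₜ n) = φ n := by
  obtain ⟨Ψ, hΨ⟩ := Sy.exists_lift (Cher.x D) fun ξ ξ' => by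
    have := Cher.mk_rel (CherRel.x_comm (D := D) ξ ξ')
    rw [map_mul, map_mul] at this
    exact this
  -- Linearity over `S(𝔥*)` forces `f ⊗ n ↦ f(x) φ(n)`. Compatibility with `G` and then with `𝔥`
  -- follows by induction on the degree of `f`.
  let Φ : Sy (Dual ℂ h) ⊗[ℂ] N →ₗ[ℂ] X := TensorProduct.lift
    (((Algebra.lsmul ℂ ℂ X).toLinearMap ∘ₗ Ψ.toLinearMap).compl₂ φ)
  have hΦ : ∀ f n, Φ (f ⊗ₜ n) = Ψ f • φ n := fun f n => rfl
  have hx : ∀ ξ z, Φ (opX ξ z) = Cher.x D ξ • Φ z := fun ξ z => by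
    induction z using TensorProduct.induction_on with
    | zero => simp
    | add z z' h h' => simp only [map_add, h, h', smul_add]
    | tmul f n => rw [opX_tmul, hΦ, hΦ, map_mul, hΨ, mul_smul]
  have hg' : ∀ g z, Φ (M.opG g z) = Cher.g D g • Φ z := fun g z => by
    induction z using Sy.tensor_induction with
    | one n => rw [opG_one, hΦ, hΦ, map_one, one_smul, one_smul, hg]
    | add z z' h h' => simp only [map_add, h, h', smul_add]
    | mul ξ z hz =>
      change Φ (M.opG g (opX ξ z)) = Cher.g D g • Φ (opX ξ z)
      rw [opG_opX, hx, hz, hx, smul_smul, smul_smul, Cher.g_mul_x]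
  have hy' : ∀ η z, Φ (M.opY D η z) = Cher.y D η • Φ z := fun η z => by
    induction z using Sy.tensor_induction with
    | one n => rw [opY_one, hΦ, hΦ, map_one, one_smul, one_smul, hy]
    | add z z' h h' => simp only [map_add, h, h', smul_add]
    | mul ξ z hz =>
      change Φ (M.opY D η (opX ξ z)) = Cher.y D η • Φ (opX ξ z)
      rw [opY_opX, map_add, hx, hz, hx, Cher.y_smul_x_smul, opC_apply, map_sub, map_smul, map_sum]
      simp only [map_smul, hg']
  refine ⟨Φ, fun a => ?_, fun n => by rw [hΦ, map_one, one_smul]⟩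
  induction a using Cher.induction with
  | gen z =>
    intro m
    rw [indAct_gen]
    cases z with
    | x ξ => exact hx ξ m
    | y η => exact hy' η m
    | g g => exact hg' g m
  | algebraMap r => intro m; rw [AlgHom.commutes, algebraMap_smul, Module.algebraMap_end_apply, map_smul]
  | add a b ha hb => intro m; rw [map_add, LinearMap.add_apply, map_add, ha, hb, add_smul]
  | mul a b ha hb => intro m; rw [map_mul, Module.End.mul_apply, ha, hb, mul_smul]

end Frobenius

end YRep

end Induction

/-! ### Graded modules from Euler operators, and graded Frobenius reciprocity. -/

section GradedInduction

open Module
local infixl:70 " ⊠ " => TensorProduct.map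

namespace GrMod

variable {A : Type u} [Ring A] [Algebra ℂ A] {𝒜 : ℤ → Submodule ℂ A}

/-- The operator acting on the `n`-th component by `n`. -/
noncomputable def eul (X : GrMod.{u, v} 𝒜) : End ℂ X := gradedScale X.isInternal fun n => (n : ℂ)

theorem eul_of_mem (X : GrMod.{u, v} 𝒜) {n : ℤ} {m : X} (hm : m ∈ X.deg n) : X.eul m = (n : ℂ) • m :=
  gradedScale_of_mem X.isInternal _ hm

theorem mem_deg_iff (X : GrMod.{u, v} 𝒜) {n : ℤ} {m : X} : m ∈ X.deg n ↔ X.eul m = (n : ℂ) • m :=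
  mem_deg_iff_gradedScale X.isInternal

theorem smul_comm_complex (X : GrMod.{u, v} 𝒜) (c : ℂ) (a : A) (m : X) : a • c • m = c • a • m := by
  have := IsScalarTower.to_smulCommClass' (R := ℂ) (A := A) (M := X)
  exact smul_comm a c m

theorem eul_smul (X : GrMod.{u, v} 𝒜) {i : ℤ} {a : A} (ha : a ∈ 𝒜 i) (m : X) :
    X.eul (a • m) = a • X.eul m + (i : ℂ) • a • m := by
  refine iSup_eq_top_induction (P := fun m => X.eul (a • m) = a • X.eul m + (i : ℂ) • a • m)
    (iSup_deg_eq_top X.isInternal) (fun n m hm => ?_) (fun m m' h h' => ?_) ?_ m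
  · rw [X.eul_of_mem (X.smul_mem ha hm), X.eul_of_mem hm, smul_comm_complex, ← add_smul, add_comm]
    push_cast
    rfl
  · rw [smul_add, map_add, h, h', map_add, smul_add, smul_add]; abel
  · simp

theorem mono_of_injective {X Y : GrMod.{u, v} 𝒜} (f : X ⟶ Y) (hf : Function.Injective f.1) : Mono f :=
  ⟨fun g k e => hom_ext fun x => hf (congrArg (fun l => l.1 x) e)⟩

theorem epi_of_surjective {X Y : GrMod.{u, v} 𝒜} (f : X ⟶ Y) (hf : Function.Surjective f.1) : Epi f :=
  ⟨fun g k e => hom_ext fun y => by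
    obtain ⟨x, rfl⟩ := hf y
    exact congrArg (fun l => l.1 x) e⟩

theorem shortExact_of_exact {X Y Z : GrMod.{u, v} 𝒜} (f : X ⟶ Y) (g : Y ⟶ Z) (w : f ≫ g = 0)
    (hf : Function.Injective f.1) (hg : Function.Surjective g.1)
    (hfg : LinearMap.ker g.1 ≤ LinearMap.range f.1) : (ShortComplex.mk f g w).ShortExact where
  exact := (ShortComplex.mk f g w).exact_of_f_is_kernel (isLimitOfExact f g w hf hfg)
  mono_f := mono_of_injective f hf
  epi_g := epi_of_surjective g hg

end GrMod

variable {h : Type u} [AddCommGroup h] [Module ℂ h] {G : Subgroup (h ≃ₗ[ℂ] h)} [Finite G]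
  (D : CherData G)

namespace Cher

theorem eul_gen_smul {D : CherData G} (X : GrMod.{u, v} (deg D)) (z : CherGen G) (m : X) :
    X.eul (gen D z • m) = gen D z • X.eul m + (genDeg z : ℂ) • gen D z • m :=
  X.eul_smul (gen_mem_deg D z) m

/-- A graded module over `H_{t,c}` from an action on a vector space with a grading operator. -/
noncomputable def ofAct {T : Type v} [AddCommGroup T] [Module ℂ T] (a : Cher D →ₐ[ℂ] End ℂ T)
    (E : End ℂ T) (hE : IsGradingOp E)
    (hgen : ∀ z t, E (a (gen D z) t) = a (gen D z) (E t) + (genDeg z : ℂ) • a (gen D z) t) :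
    GrMod.{u, v} (deg D) where
  carrier := T
  isModule := Module.compHom T a.toRingHom
  isScalarTower := by
    let := Module.compHom T a.toRingHom
    exact ⟨fun c b t => congrArg (fun f => f t) (map_smul a c b)⟩
  deg n := E.eigenspace n
  isInternal := hE.isInternal
  smul_mem := by
    intro i j b t hb ht
    -- The commutation rule of the generators with `E` extends to products of generators, which span
    -- the component of degree `i`.
    have key : ∀ t, E (a b t) = a b (E t) + (i : ℂ) • a b t := by
      induction hb using Submodule.span_induction with
      | mem b hb =>
        obtain ⟨l, rfl, rfl⟩ := hb
        induction l with
        | nil => intro t; simp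
        | cons z l ih =>
          intro t
          rw [List.map_cons, List.prod_cons, map_mul, Module.End.mul_apply, hgen, ih, map_add, map_smul,
            List.map_cons, List.sum_cons]
          push_cast
          module
      | zero => intro t; simp
      | add b b' _ _ h h' =>
        intro t
        rw [map_add, LinearMap.add_apply, map_add, h, h', LinearMap.add_apply]
        module
      | smul c b _ h =>
        intro t
        rw [map_smul, LinearMap.smul_apply, map_smul, h, LinearMap.smul_apply]
        module
    rw [End.mem_eigenspace_iff] at ht ⊢
    change E (a b t) = _ • a b t
    rw [key, ht, map_smul, ← add_smul, add_comm]
    push_cast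
    rfl

end Cher

/-- A graded module over `ℂ[𝔥*] ⋊ ℂG`, the grading being given by the operator `eul`. -/
structure GrYRep (G : Subgroup (h ≃ₗ[ℂ] h)) (N : Type*) [AddCommGroup N] [Module ℂ N] extends
    YRep G N where
  eul : End ℂ N
  isGradingOp : IsGradingOp eul
  eul_rep : ∀ g n, eul (rep g n) = rep g (eul n)
  eul_y : ∀ η n, eul (y η n) = y η (eul n) - y η n

variable [FiniteDimensional ℂ h]

namespace GrYRep

variable {N : Type u} [AddCommGroup N] [Module ℂ N] (M : GrYRep G N)

/-- The grading operator of the induced module. -/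
noncomputable def indEul : End ℂ (Sy (Dual ℂ h) ⊗[ℂ] N) := Sy.eul (Dual ℂ h) ⊠ 1 + 1 ⊠ M.eul

theorem indEul_one (n : N) : M.indEul (1 ⊗ₜ n) = 1 ⊗ₜ M.eul n := by
  simp [indEul]

theorem indEul_opX (ξ : Dual ℂ h) (z : Sy (Dual ℂ h) ⊗[ℂ] N) :
    M.indEul (YRep.opX ξ z) = YRep.opX ξ (M.indEul z) + YRep.opX ξ z := by
  induction z using TensorProduct.induction_on with
  | zero => simp
  | add z z' h h' => simp only [map_add, h, h']; abel
  | tmul f n =>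
    have := congrArg (fun T => T f) (Sy.eul_mulι ξ)
    simp only [Module.End.mul_apply, LinearMap.add_apply, Sy.mulι_apply] at this
    simp only [indEul, YRep.opX_tmul, LinearMap.add_apply, TensorProduct.map_tmul, this, map_add,
      TensorProduct.add_tmul, Module.End.one_apply]
    abel

theorem indEul_opG (g : G) (z : Sy (Dual ℂ h) ⊗[ℂ] N) :
    M.indEul (M.opG g z) = M.opG g (M.indEul z) := by
  induction z using Sy.tensor_induction with
  | one n => rw [YRep.opG_one, indEul_one, indEul_one, YRep.opG_one, M.eul_rep]
  | add z z' h h' => simp only [map_add, h, h']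
  | mul ξ z hz =>
    change M.indEul (M.opG g (YRep.opX ξ z)) = M.opG g (M.indEul (YRep.opX ξ z))
    rw [YRep.opG_opX, indEul_opX, hz, indEul_opX, map_add, YRep.opG_opX, YRep.opG_opX]

theorem indEul_opC (η : h) (ξ : Dual ℂ h) (z : Sy (Dual ℂ h) ⊗[ℂ] N) :
    M.indEul (M.opC D η ξ z) = M.opC D η ξ (M.indEul z) := by
  rw [YRep.opC_apply, YRep.opC_apply, map_sub, map_smul, map_sum]
  simp only [map_smul, indEul_opG]

theorem indEul_opY (η : h) (z : Sy (Dual ℂ h) ⊗[ℂ] N) :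
    M.indEul (M.opY D η z) = M.opY D η (M.indEul z) - M.opY D η z := by
  induction z using Sy.tensor_induction with
  | one n => rw [YRep.opY_one, indEul_one, indEul_one, YRep.opY_one, M.eul_y, TensorProduct.tmul_sub]
  | add z z' h h' => simp only [map_add, h, h']; abel
  | mul ξ z hz =>
    change M.indEul (M.opY D η (YRep.opX ξ z)) =
      M.opY D η (M.indEul (YRep.opX ξ z)) - M.opY D η (YRep.opX ξ z)
    rw [indEul_opX, YRep.opY_opX, map_add, map_add, indEul_opX, hz, indEul_opC, YRep.opY_opX,
      YRep.opY_opX, map_sub]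
    abel

/-- The graded module over `H_{t,c}` induced from a graded module over `ℂ[𝔥*] ⋊ ℂG`. -/
noncomputable def ind : GrMod.{u, u} (Cher.deg D) :=
  Cher.ofAct D (M.indAct D) M.indEul (isGradingOp_tensor Sy.isGradingOp_eul M.isGradingOp) (by
    intro z t
    rw [YRep.indAct_gen]
    cases z with
    | x ξ => 
      simp only [Cher.genDeg, Int.cast_one, one_smul]
      exact M.indEul_opX ξ t
    | y η =>
      simp only [Cher.genDeg, Int.cast_neg, Int.cast_one, neg_smul, one_smul, ← sub_eq_add_neg]
      exact M.indEul_opY D η t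
    | g g =>
      simp only [Cher.genDeg, Int.cast_zero, zero_smul, add_zero]
      exact M.indEul_opG g t)

/-- The inclusion of `N` in the induced module. -/
noncomputable def ins : N →ₗ[ℂ] M.ind D := TensorProduct.mk ℂ (Sy (Dual ℂ h)) N 1

theorem x_smul_ind (ξ : Dual ℂ h) (z : M.ind D) : Cher.x D ξ • z = YRep.opX ξ z :=
  congrArg (fun f => f z) (M.indAct_gen D (.x ξ))

theorem y_smul_ind (η : h) (z : M.ind D) : Cher.y D η • z = M.opY D η z :=
  congrArg (fun f => f z) (M.indAct_gen D (.y η))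

theorem g_smul_ind (g : G) (z : M.ind D) : Cher.g D g • z = M.opG g z :=
  congrArg (fun f => f z) (M.indAct_gen D (.g g))

theorem g_smul_ins (g : G) (n : N) : Cher.g D g • M.ins D n = M.ins D (M.rep g n) :=
  (M.g_smul_ind D g _).trans (M.opG_one g n)

theorem y_smul_ins (η : h) (n : N) : Cher.y D η • M.ins D n = M.ins D (M.y η n) :=
  (M.y_smul_ind D η _).trans (M.opY_one D η n)

theorem mem_deg_ind {n : ℤ} {z : M.ind D} : z ∈ (M.ind D).deg n ↔ M.indEul z = (n : ℂ) • z :=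
  End.mem_eigenspace_iff (f := M.indEul) (x := (z : Sy (Dual ℂ h) ⊗[ℂ] N))

theorem eul_ind (z : M.ind D) : (M.ind D).eul z = M.indEul z := by
  refine iSup_eq_top_induction (P := fun z => (M.ind D).eul z = M.indEul z)
    (iSup_deg_eq_top (M.ind D).isInternal) (fun n z hz => ?_) (fun z z' h h' => ?_) ?_ z
  · rw [(M.ind D).eul_of_mem hz]; exact ((M.mem_deg_ind D).1 hz).symm
  · rw [map_add, h, h']; exact (map_add M.indEul _ _).symm
  · rw [map_zero]; exact (map_zero M.indEul).symm

theorem ind_induction {P : M.ind D → Prop} (ins : ∀ n, P (M.ins D n))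
    (add : ∀ z z', P z → P z' → P (z + z')) (x_smul : ∀ ξ z, P z → P (Cher.x D ξ • z))
    (z : M.ind D) : P z :=
  Sy.tensor_induction (P := P) ins add (fun ξ z hz => (M.x_smul_ind D ξ z) ▸ x_smul ξ z hz) z

theorem ind_hom_ext {X : Type*} [AddCommGroup X] [Module (Cher D) X] {f f' : M.ind D →ₗ[Cher D] X}
    (H : ∀ n, f (M.ins D n) = f' (M.ins D n)) : f = f' :=
  LinearMap.ext fun z => M.ind_induction D (P := fun z => f z = f' z) H
    (fun z z' hz hz' => by rw [map_add, map_add, hz, hz'])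
    (fun ξ z hz => by rw [map_smul, map_smul, hz]) z

/-- Graded Frobenius reciprocity. -/
theorem exists_indHom (X : GrMod.{u, u} (Cher.deg D)) (φ : N →ₗ[ℂ] X)
    (hg : ∀ g n, φ (M.rep g n) = Cher.g D g • φ n) (hy : ∀ η n, φ (M.y η n) = Cher.y D η • φ n)
    (hdeg : ∀ n, φ (M.eul n) = X.eul (φ n)) : ∃ F : M.ind D ⟶ X, ∀ n, F.1 (M.ins D n) = φ n := by
  obtain ⟨Φ, h1, h2⟩ := M.exists_indLift D φ hg hy
  let F : M.ind D →ₗ[Cher D] X :=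
    { toFun := Φ, map_add' := map_add Φ, map_smul' := fun a z => h1 a z }
  -- Preserving degrees amounts to commuting with the Euler operators, which is checked on `N` and
  -- propagated through `𝔥*`.
  have hF : ∀ z, F ((M.ind D).eul z) = X.eul (F z) := fun z => by
    induction z using M.ind_induction D with
    | ins n =>
      rw [eul_ind]
      change Φ (M.indEul (1 ⊗ₜ n)) = X.eul (Φ (1 ⊗ₜ n))
      rw [indEul_one, h2, h2, hdeg]
    | add z z' h h' => rw [map_add, map_add, map_add, map_add, h, h']
    | x_smul ξ z hz =>
      have e1 := Cher.eul_gen_smul (M.ind D) (.x ξ) z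
      have e2 := Cher.eul_gen_smul X (.x ξ) (F z)
      have e3 : ∀ m : X, Cher.x D ξ • m = Cher.gen D (.x ξ) • m := fun m => rfl
      change (M.ind D).eul (Cher.x D ξ • z) = Cher.x D ξ • (M.ind D).eul z +
        ((1 : ℤ) : ℂ) • Cher.x D ξ • z at e1
      change X.eul (Cher.x D ξ • F z) = Cher.x D ξ • X.eul (F z) +
        ((1 : ℤ) : ℂ) • Cher.x D ξ • F z at e2
      rw [Int.cast_one, one_smul] at e1 e2
      rw [e1, F.map_add, F.map_smul, F.map_smul, e2, hz]
  refine ⟨⟨F, fun n z hz => ?_⟩, h2⟩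
  rw [GrMod.mem_deg_iff] at hz ⊢
  have hz' : F ((n : ℂ) • z) = (n : ℂ) • F z := map_smul Φ (n : ℂ) z
  rw [← hF, hz, hz']

section Map

variable {N' : Type u} [AddCommGroup N'] [Module ℂ N'] {M} {M' : GrYRep G N'}

/-- Every generator acts by a sum of operators on `S(𝔥*)` tensored with `1`, a group element or some
`y η` on `N`, and `T` passes through each of these. -/
theorem map_indAct (T : N →ₗ[ℂ] N') (hg : ∀ g n, T (M.rep g n) = M'.rep g (T n))
    (hy : ∀ η n, T (M.y η n) = M'.y η (T n)) (a : Cher D) (z : Sy (Dual ℂ h) ⊗[ℂ] N) :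
    ((LinearMap.id : Sy (Dual ℂ h) →ₗ[ℂ] Sy (Dual ℂ h)) ⊠ T) (M.indAct D a z) =
      M'.indAct D a (((LinearMap.id : Sy (Dual ℂ h) →ₗ[ℂ] Sy (Dual ℂ h)) ⊠ T) z) := by
  induction a using Cher.induction generalizing z with
  | gen w =>
    rw [YRep.indAct_gen, YRep.indAct_gen]
    induction z using TensorProduct.induction_on with
    | zero => simp
    | add z z' h h' => simp only [map_add, h, h']
    | tmul f n =>
      cases w with
      | x ξ => rfl
      | g g =>
        change _ ⊗ₜ[ℂ] T (M.rep g n) = _ ⊗ₜ[ℂ] M'.rep g (T n)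
        rw [hg]
        rfl
      | y η =>
        simp only [YRep.opGen, YRep.opY_tmul, map_add, map_sub, map_sum, map_smul,
          TensorProduct.map_tmul, hg, hy, LinearMap.id_apply]
  | algebraMap r =>
    rw [AlgHom.commutes, AlgHom.commutes, Module.algebraMap_end_apply, map_smul,
      Module.algebraMap_end_apply]
  | add a b ha hb =>
    rw [map_add, map_add, LinearMap.add_apply, LinearMap.add_apply, map_add, ha, hb]
  | mul a b ha hb =>
    rw [map_mul, map_mul, Module.End.mul_apply, Module.End.mul_apply, ha, hb]

theorem map_indEul (T : N →ₗ[ℂ] N') (he : ∀ n, T (M.eul n) = M'.eul (T n))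
    (z : Sy (Dual ℂ h) ⊗[ℂ] N) :
    ((LinearMap.id : Sy (Dual ℂ h) →ₗ[ℂ] Sy (Dual ℂ h)) ⊠ T) (M.indEul z) =
      M'.indEul (((LinearMap.id : Sy (Dual ℂ h) →ₗ[ℂ] Sy (Dual ℂ h)) ⊠ T) z) := by
  induction z using TensorProduct.induction_on with
  | zero => simp
  | add z z' h h' => simp only [map_add, h, h']
  | tmul f n => simp [indEul, he]

/-- Functoriality of induction. -/
noncomputable def indMap (T : N →ₗ[ℂ] N') (hg : ∀ g n, T (M.rep g n) = M'.rep g (T n))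
    (hy : ∀ η n, T (M.y η n) = M'.y η (T n)) (he : ∀ n, T (M.eul n) = M'.eul (T n)) :
    M.ind D ⟶ M'.ind D :=
  ⟨{ toFun := (LinearMap.id : Sy (Dual ℂ h) →ₗ[ℂ] Sy (Dual ℂ h)) ⊠ T
     map_add' := map_add _
     map_smul' := map_indAct D T hg hy }, by
    intro n z hz
    rw [mem_deg_ind] at hz ⊢
    exact (map_indEul T he z).symm.trans ((congrArg _ hz).trans (map_smul _ _ _))⟩

end Map

end GrYRep

/-! ### Standard modules as induced modules. -/

section Standard

/-- A representation of `G` in degree `γ`, with `𝔥` acting by `0`. -/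
noncomputable def GrYRep.triv {V : Type u} [AddCommGroup V] [Module ℂ V] (τ : Representation ℂ G V)
    (γ : ℤ) : GrYRep G V where
  rep := τ
  y := 0
  y_comm _ _ _ := rfl
  rep_y _ _ _ := by simp
  eul := (γ : ℂ) • 1
  isGradingOp := eq_top_iff.2 fun v _ => Submodule.mem_iSup_of_mem γ (by simp)
  eul_rep _ _ := by simp
  eul_y _ _ := by simp

namespace Cher

variable {V : Type u} [AddCommGroup V] [Module ℂ V] (τ : Representation ℂ G V)

/-- The inclusion of `τ` in the standard module. -/
noncomputable def stdIns : V →ₗ[ℂ] std D τ :=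
  ((Submodule.span (Cher D) (stdRel D τ)).mkQ.restrictScalars ℂ) ∘ₗ TensorProduct.mk ℂ (Cher D) V 1

theorem g_smul_stdIns (g : G) (v : V) : Cher.g D g • stdIns D τ v = stdIns D τ (τ g v) := by
  have : (Cher.g D g ⊗ₜ[ℂ] v - 1 ⊗ₜ[ℂ] τ g v : Cher D ⊗[ℂ] V) ∈ Submodule.span (Cher D) (stdRel D τ) :=
    Submodule.subset_span (Or.inr ⟨g, v, rfl⟩)
  have h2 := (Submodule.Quotient.eq _).2 this
  refine Eq.trans ?_ h2
  change Submodule.Quotient.mk (Cher.g D g • ((1 : Cher D) ⊗ₜ[ℂ] v)) = _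
  rw [TensorProduct.smul_tmul', smul_eq_mul, mul_one]

theorem y_smul_stdIns (η : h) (v : V) : y D η • stdIns D τ v = 0 := by
  have : (y D η ⊗ₜ[ℂ] v : Cher D ⊗[ℂ] V) ∈ Submodule.span (Cher D) (stdRel D τ) :=
    Submodule.subset_span (Or.inl ⟨η, v, rfl⟩)
  refine Eq.trans ?_ ((Submodule.Quotient.mk_eq_zero _).2 this)
  change Submodule.Quotient.mk (y D η • ((1 : Cher D) ⊗ₜ[ℂ] v)) = _
  rw [TensorProduct.smul_tmul', smul_eq_mul, mul_one]
  rfl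

theorem stdIns_mem (v : V) : stdIns D τ v ∈ (std D τ).deg 0 :=
  ⟨1 ⊗ₜ v, tmul_mem_deg_free D (one_mem_deg D) v, rfl⟩

theorem std_induction {P : std D τ → Prop} (ins : ∀ (a : Cher D) v, P (a • stdIns D τ v))
    (add : ∀ z z', P z → P z' → P (z + z')) (z : std D τ) : P z := by
  obtain ⟨w, rfl⟩ := Submodule.mkQ_surjective _ z
  have hw : ∀ w : Cher D ⊗[ℂ] V, P ((Submodule.span (Cher D) (stdRel D τ)).mkQ w) := fun w => by
    induction w using TensorProduct.induction_on with
    | zero => 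
      refine Eq.mp (congrArg P ?_) (ins 0 0)
      exact (zero_smul _ _).trans (map_zero (Submodule.span (Cher D) (stdRel D τ)).mkQ).symm
    | tmul a v =>
      have := ins a v
      have e : a • stdIns D τ v = (Submodule.span (Cher D) (stdRel D τ)).mkQ (a ⊗ₜ v) := by
        change Submodule.Quotient.mk (a • ((1 : Cher D) ⊗ₜ[ℂ] v)) = _
        rw [TensorProduct.smul_tmul', smul_eq_mul, mul_one]
        rfl
      rwa [e] at this
    | add w w' h h' => exact (map_add (Submodule.span (Cher D) (stdRel D τ)).mkQ w w') ▸ add _ _ h h'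
  exact hw w

theorem exists_stdLift {X : Type*} [AddCommGroup X] [Module ℂ X] [Module (Cher D) X]
    [IsScalarTower ℂ (Cher D) X] (φ : V →ₗ[ℂ] X) (hg : ∀ g v, φ (τ g v) = Cher.g D g • φ v)
    (hy : ∀ η v, y D η • φ v = 0) :
    ∃ F : std D τ →ₗ[Cher D] X, ∀ v, F (stdIns D τ v) = φ v := by
  let F0 : Cher D ⊗[ℂ] V →ₗ[Cher D] X := TensorProduct.AlgebraTensorModule.lift
    (LinearMap.toSpanSingleton (Cher D) (V →ₗ[ℂ] X) φ)
  have hF0 : ∀ a v, F0 (a ⊗ₜ v) = a • φ v := fun a v => rfl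
  refine ⟨(Submodule.span (Cher D) (stdRel D τ)).liftQ F0 ?_, fun v => (hF0 1 v).trans (one_smul _ _)⟩
  rw [Submodule.span_le]
  rintro _ (⟨η, v, rfl⟩ | ⟨g, v, rfl⟩)
  · exact (hF0 _ _).trans (hy η v)
  · refine (map_sub F0 _ _).trans ?_
    rw [hF0, hF0, one_smul, hg, sub_self]

/-- The standard module is induced from `τ`. -/
theorem exists_indIso_std (γ : ℤ) : ∃ F : (GrYRep.triv τ γ).ind D ⟶ (std D τ).shift γ,
    Function.Bijective F.1 ∧ ∀ v, F.1 ((GrYRep.triv τ γ).ins D v) = stdIns D τ v := by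
  obtain ⟨F, hF⟩ := (GrYRep.triv τ γ).exists_indHom D ((std D τ).shift γ) (stdIns D τ)
    (fun g v => (g_smul_stdIns D τ g v).symm)
    (fun η v => (map_zero (stdIns D τ)).trans (y_smul_stdIns D τ η v).symm) (fun v => by
      have hm : stdIns D τ v ∈ ((std D τ).shift γ).deg γ := by
        change _ ∈ (std D τ).deg (γ - γ)
        rw [sub_self]; exact stdIns_mem D τ v
      refine Eq.trans ?_ (((std D τ).shift γ).eul_of_mem hm).symm
      exact map_smul (stdIns D τ) (γ : ℂ) v)
  -- A left inverse from the universal property of `std` gives injectivity, which is the PBW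
  -- statement; surjectivity holds because `τ` generates `std`.
  obtain ⟨F', hF'⟩ := exists_stdLift D τ (X := (GrYRep.triv τ γ).ind D) ((GrYRep.triv τ γ).ins D)
    (fun g v => ((GrYRep.triv τ γ).g_smul_ins D g v).symm)
    (fun η v => ((GrYRep.triv τ γ).y_smul_ins D η v).trans (map_zero _))
  let F1 : (GrYRep.triv τ γ).ind D →ₗ[Cher D] std D τ := F.1
  have hF1 : ∀ v, F1 ((GrYRep.triv τ γ).ins D v) = stdIns D τ v := hF
  have inj : ∀ z, F' (F1 z) = z := (GrYRep.triv τ γ).ind_induction D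
      (fun v => (congrArg F' (hF1 v)).trans (hF' v))
      (fun z z' h h' => by rw [map_add, map_add, h, h'])
      (fun ξ z h => by rw [map_smul, map_smul, h])
  have surj : ∀ z, ∃ w, F1 w = z := fun z => std_induction D τ (P := fun z => ∃ w, F1 w = z)
    (fun a v => ⟨a • (GrYRep.triv τ γ).ins D v, by rw [map_smul, hF1]⟩)
    (by
      rintro _ _ ⟨w, rfl⟩ ⟨w', rfl⟩
      exact ⟨w + w', map_add F1 _ _⟩) z
  exact ⟨F, ⟨Function.LeftInverse.injective (f := F1) (g := F') inj, surj⟩, hF⟩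

end Cher

end Standard

end GradedInduction

/-! ### Equivariant lifting, complexes cut out by idempotents, exterior projections. -/

section Resolution

open Module
local infixl:70 " ⊠ " => TensorProduct.map

/-- Equivariant lifts along an equivariant map. -/
theorem exists_equivariant_lift {G A B C : Type*} [Group G] [Finite G] [AddCommGroup A] [Module ℂ A]
    [AddCommGroup B] [Module ℂ B] [AddCommGroup C] [Module ℂ C] {ρA : Representation ℂ G A}
    {ρB : Representation ℂ G B} {ρC : Representation ℂ G C} (e : B →ₗ[ℂ] C)
    (he : ∀ g b, e (ρB g b) = ρC g (e b)) (S : Submodule ℂ B) (hS : ∀ g, ∀ b ∈ S, ρB g b ∈ S)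
    (φ : A →ₗ[ℂ] C) (hφ : ∀ g a, φ (ρA g a) = ρC g (φ a)) (hφS : ∀ a, φ a ∈ S.map e) :
    ∃ ψ : A →ₗ[ℂ] B, (∀ g a, ψ (ρA g a) = ρB g (ψ a)) ∧ (∀ a, ψ a ∈ S) ∧ ∀ a, e (ψ a) = φ a := by
  let := Fintype.ofFinite G
  -- A linear lift with values in `S` is averaged over `G`; stability of `S` keeps the average
  -- inside.
  obtain ⟨ψ, hψ⟩ := Module.projective_lifting_property (e.submoduleMap S) (φ.codRestrict _ hφS)
    (e.submoduleMap_surjective S)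
  have hψ' : ∀ a, e (ψ a) = φ a := fun a => congrArg Subtype.val (LinearMap.congr_fun hψ a)
  refine ⟨(Fintype.card G : ℂ)⁻¹ • ∑ g : G, ρB g ∘ₗ S.subtype ∘ₗ ψ ∘ₗ ρA g⁻¹, fun g a => ?_, fun a => ?_,
    fun a => ?_⟩
  · simp only [LinearMap.smul_apply, LinearMap.sum_apply, LinearMap.comp_apply, map_smul, map_sum]
    congr 1
    rw [← Equiv.sum_comp (Equiv.mulLeft g)]
    refine Finset.sum_congr rfl fun k _ => ?_
    rw [Equiv.coe_mulLeft, map_mul, Module.End.mul_apply, ← Module.End.mul_apply (ρA _), ← map_mul]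
    congr 5
    group
  · simp only [LinearMap.smul_apply, LinearMap.sum_apply, LinearMap.comp_apply]
    exact S.smul_mem _ (S.sum_mem fun g _ => hS g _ (ψ _).2)
  · simp only [LinearMap.smul_apply, LinearMap.sum_apply, LinearMap.comp_apply, map_smul, map_sum, he,
      Submodule.subtype_apply, hψ', ← hφ]
    have : ∀ g : G, ρA g (ρA g⁻¹ a) = a := fun g => by
      rw [← Module.End.mul_apply, ← map_mul, mul_inv_cancel, map_one, Module.End.one_apply]
    simp only [this, Finset.sum_const, Finset.card_univ]
    rw [← Nat.cast_smul_eq_nsmul ℂ, smul_smul, inv_mul_cancel₀ (Nat.cast_ne_zero.2 Fintype.card_ne_zero),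
      one_smul]

namespace GrMod

variable {A : Type u} [Ring A] [Algebra ℂ A] {𝒜 : ℤ → Submodule ℂ A}

/-- The fixed points of an endomorphism. -/
noncomputable def fixedBy {P : GrMod.{u, v} 𝒜} (e : P ⟶ P) : Submodule A P := LinearMap.ker (𝟙 P - e).1

theorem mem_fixedBy {P : GrMod.{u, v} 𝒜} {e : P ⟶ P} {x : P} : x ∈ fixedBy e ↔ e.1 x = x := by
  rw [fixedBy, LinearMap.mem_ker]
  change x - e.1 x = 0 ↔ _
  rw [sub_eq_zero, eq_comm]

theorem isHomogeneous_inf {X : GrMod.{u, v} 𝒜} {N N' : Submodule A X} (hN : X.IsHomogeneous N)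
    (hN' : X.IsHomogeneous N') : X.IsHomogeneous (N ⊓ N') := fun n x hx => ⟨hN n x hx.1, hN' n x hx.2⟩

/-- The part of a graded module cut out by an idempotent. -/
noncomputable def part {P : GrMod.{u, v} 𝒜} (e : P ⟶ P) : GrMod.{u, v} 𝒜 :=
  P.sub (fixedBy e) (isHomogeneous_ker _)

/-- The projection onto the part cut out by an idempotent. -/
noncomputable def toPart {P : GrMod.{u, v} 𝒜} (e : P ⟶ P) (he : ∀ x, e.1 (e.1 x) = e.1 x) :
    P ⟶ part e :=
  ⟨e.1.codRestrict _ fun x => mem_fixedBy.2 (he x), fun n x hx => e.2 n x hx⟩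

theorem toPart_coe {P : GrMod.{u, v} 𝒜} (e : P ⟶ P) (he : ∀ x, e.1 (e.1 x) = e.1 x) (x : part e) :
    (toPart e he).1 x.1 = x := Subtype.ext (mem_fixedBy.1 x.2)

/-- The cycles of a complex in the part cut out by an idempotent, together with the last term. -/
noncomputable def cycles {P M : GrMod.{u, v} 𝒜} (e : ℕ → (P ⟶ P)) (d : P ⟶ P) (a : P ⟶ M) :
    ℕ → GrMod.{u, v} 𝒜
  | 0 => M
  | p + 1 => P.sub (fixedBy (e p) ⊓ (LinearMap.ker d.1 ⊓ LinearMap.ker a.1))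
      (isHomogeneous_inf (isHomogeneous_ker _)
        (isHomogeneous_inf (isHomogeneous_ker _) (isHomogeneous_ker _)))

theorem isZero_of_subsingleton {X : GrMod.{u, v} 𝒜} (hX : ∀ x : X, x = 0) : IsZero X :=
  (IsZero.iff_id_eq_zero X).2 (hom_ext fun x => hX x)

theorem isZero_cycles {P M : GrMod.{u, v} 𝒜} (e : ℕ → (P ⟶ P)) (d : P ⟶ P) (a : P ⟶ M) {p : ℕ}
    (hp : ∀ x, (e p).1 x = 0) : IsZero (cycles e d a (p + 1)) :=
  isZero_of_subsingleton fun x => Subtype.ext ((mem_fixedBy.1 x.2.1).symm.trans (hp x.1))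

/-- The whole complex is kept in one module `P` with a single differential, the idempotents `e p`
cutting out its terms. Exactness of `P` as a whole then yields all the syzygy sequences at once.
Index `p + 1` of `cycles` is the kernel inside the `p`-th term, index `0` being reserved for the
resolved module; the condition `a = 0` matters only for `p = 0`, by `ae`. -/
theorem cycles_shortExact {P M : GrMod.{u, v} 𝒜} (e : ℕ → (P ⟶ P)) (d : P ⟶ P) (a : P ⟶ M)
    (he : ∀ p x, (e p).1 ((e p).1 x) = (e p).1 x)
    (de : ∀ p x, d.1 ((e (p + 1)).1 x) = (e p).1 (d.1 x)) (de0 : ∀ x, d.1 ((e 0).1 x) = 0)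
    (ae : ∀ p x, a.1 ((e (p + 1)).1 x) = 0) (ae0 : ∀ x, a.1 ((e 0).1 x) = a.1 x)
    (dd : ∀ x, d.1 (d.1 x) = 0) (ad : ∀ x, a.1 (d.1 x) = 0) (ha : Function.Surjective a.1)
    (ex : ∀ x, d.1 x = 0 → a.1 x = 0 → ∃ z, d.1 z = x) (p : ℕ) :
    ∃ (f : cycles e d a (p + 1) ⟶ part (e p)) (g : part (e p) ⟶ cycles e d a p) (w : f ≫ g = 0),
      (ShortComplex.mk f g w).ShortExact := by
  let f : cycles e d a (p + 1) ⟶ part (e p) :=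
    ⟨Submodule.inclusion inf_le_left, fun n x hx => hx⟩
  have hf : Function.Injective f.1 := Submodule.inclusion_injective
    (inf_le_left : fixedBy (e p) ⊓ (LinearMap.ker d.1 ⊓ LinearMap.ker a.1) ≤ _)
  cases p with
  | zero =>
    let g : part (e 0) ⟶ cycles e d a 0 := P.subι _ _ ≫ a
    have w : f ≫ g = 0 := hom_ext fun x => x.2.2.2
    refine ⟨f, g, w, shortExact_of_exact f g w hf (fun m => ?_) fun x hx => ?_⟩
    · obtain ⟨x, rfl⟩ := ha m
      exact ⟨(toPart (e 0) (he 0)).1 x, ae0 x⟩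
    · exact ⟨⟨x.1, x.2, (congrArg d.1 (mem_fixedBy.1 x.2)).symm.trans (de0 _), hx⟩, rfl⟩
  | succ p =>
    let g : part (e (p + 1)) ⟶ cycles e d a (p + 1) :=
      ⟨LinearMap.codRestrict _ (d.1.comp (fixedBy (e (p + 1))).subtype) fun x =>
        ⟨mem_fixedBy.2 ((de p _).symm.trans (congrArg d.1 (mem_fixedBy.1 x.2))), dd _, ad _⟩,
        fun n x hx => d.2 n _ hx⟩
    have w : f ≫ g = 0 := hom_ext fun x => Subtype.ext x.2.2.1
    refine ⟨f, g, w, shortExact_of_exact f g w hf (fun m => ?_) fun x hx => ?_⟩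
    -- The primitive `z` may have components in every term; projecting it by `e (p + 1)` keeps `d
    -- z`, because `d` intertwines the projections.
    · obtain ⟨z, hz⟩ := ex m.1 m.2.2.1 m.2.2.2
      exact ⟨(toPart (e (p + 1)) (he _)).1 z, Subtype.ext ((de p z).trans
        ((congrArg (e p).1 hz).trans (mem_fixedBy.1 m.2.1)))⟩
    · exact ⟨⟨x.1, x.2, congrArg Subtype.val hx,
        (congrArg a.1 (mem_fixedBy.1 x.2)).symm.trans (ae p _)⟩, rfl⟩

end GrMod

section SpinProj

variable {h : Type u} [AddCommGroup h] [Module ℂ h] [FiniteDimensional ℂ h]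

namespace Cher

theorem iSup_exteriorPower : ⨆ p : ℕ, ⋀[ℂ]^p (Dual ℂ h) = ⊤ :=
  (DirectSum.Decomposition.isInternal fun p : ℕ => ⋀[ℂ]^p (Dual ℂ h)).submodule_iSup_eq_top

theorem exteriorPower_eq_bot {p : ℕ} (hp : finrank ℂ h < p) : ⋀[ℂ]^p (Dual ℂ h) = ⊥ := by
  rw [← Submodule.finrank_eq_zero (R := ℂ)]
  rw [exteriorPower.finrank_eq, Subspace.dual_finrank_eq, Nat.choose_eq_zero_of_lt hp]

/-- The projection of `⋀ 𝔥*` onto `⋀^p 𝔥*`. -/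
noncomputable def spinProj (h : Type u) [AddCommGroup h] [Module ℂ h] (p : ℕ) : End ℂ (Spin h) :=
  GradedAlgebra.proj (fun p : ℕ => ⋀[ℂ]^p (Dual ℂ h)) p

theorem spinProj_mem (p : ℕ) (ω : Spin h) : spinProj h p ω ∈ ⋀[ℂ]^p (Dual ℂ h) :=
  SetLike.coe_mem (DirectSum.decompose (fun p : ℕ => ⋀[ℂ]^p (Dual ℂ h)) ω p)

theorem spinProj_of_mem {p : ℕ} {ω : Spin h} (hω : ω ∈ ⋀[ℂ]^p (Dual ℂ h)) : spinProj h p ω = ω :=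
  DirectSum.decompose_of_mem_same (fun p : ℕ => ⋀[ℂ]^p (Dual ℂ h)) hω

theorem spinProj_of_mem_ne {p q : ℕ} (hpq : q ≠ p) {ω : Spin h} (hω : ω ∈ ⋀[ℂ]^q (Dual ℂ h)) :
    spinProj h p ω = 0 :=
  DirectSum.decompose_of_mem_ne (fun p : ℕ => ⋀[ℂ]^p (Dual ℂ h)) hω hpq

theorem spinProj_spinProj (p : ℕ) (ω : Spin h) : spinProj h p (spinProj h p ω) = spinProj h p ω :=
  spinProj_of_mem (spinProj_mem p ω)

theorem spinProj_eq_zero {p : ℕ} (hp : finrank ℂ h < p) (ω : Spin h) : spinProj h p ω = 0 := by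
  have := spinProj_mem p ω
  rwa [exteriorPower_eq_bot hp, Submodule.mem_bot] at this

theorem sum_spinProj (ω : Spin h) : ∑ p ∈ Finset.range (finrank ℂ h + 1), spinProj h p ω = ω := by
  refine iSup_eq_top_induction (P := fun ω => ∑ p ∈ Finset.range (finrank ℂ h + 1), spinProj h p ω = ω)
    iSup_exteriorPower (fun q ω hω => ?_) (fun ω ω' H H' => ?_) ?_ ω
  · rw [Finset.sum_eq_single q (fun p _ hp => spinProj_of_mem_ne hp.symm hω), spinProj_of_mem hω]
    intro hq
    rw [spinProj_of_mem hω]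
    rw [exteriorPower_eq_bot (by simpa [Nat.lt_succ_iff] using hq), Submodule.mem_bot] at hω
    exact hω
  · simp only [map_add, Finset.sum_add_distrib, H, H']
  · simp

theorem spinProj_comp {T : End ℂ (Spin h)} {k : ℕ}
    (hT : ∀ p, ∀ ω ∈ ⋀[ℂ]^p (Dual ℂ h), T ω ∈ ⋀[ℂ]^(p + k) (Dual ℂ h)) (p : ℕ) (ω : Spin h) :
    spinProj h (p + k) (T ω) = T (spinProj h p ω) := by
  refine iSup_eq_top_induction (P := fun ω => spinProj h (p + k) (T ω) = T (spinProj h p ω))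
    iSup_exteriorPower (fun q ω hω => ?_) (fun ω ω' H H' => ?_) ?_ ω
  · by_cases hq : q = p
    · subst hq
      rw [spinProj_of_mem (hT _ _ hω), spinProj_of_mem hω]
    · rw [spinProj_of_mem_ne (by omega) (hT _ _ hω), spinProj_of_mem_ne hq hω, map_zero]
  · simp only [map_add, H, H']
  · simp

theorem spinX_mem (ξ : Dual ℂ h) {p : ℕ} {ω : Spin h} (hω : ω ∈ ⋀[ℂ]^p (Dual ℂ h)) :
    spinX ξ ω ∈ ⋀[ℂ]^(p + 1) (Dual ℂ h) := by
  rw [spinX_apply]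
  refine Submodule.smul_mem _ _ ?_
  have := SetLike.mul_mem_graded (A := fun p : ℕ => ⋀[ℂ]^p (Dual ℂ h)) (i := 1) (j := p)
    (show ExteriorAlgebra.ι ℂ ξ ∈ _ by simp) hω
  rwa [add_comm] at this

theorem spinProj_spinX (ξ : Dual ℂ h) (p : ℕ) (ω : Spin h) :
    spinProj h (p + 1) (spinX ξ ω) = spinX ξ (spinProj h p ω) :=
  spinProj_comp (fun _ _ hω => spinX_mem ξ hω) p ω

theorem spinProj_zero_spinX (ξ : Dual ℂ h) (ω : Spin h) : spinProj h 0 (spinX ξ ω) = 0 := by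
  refine iSup_eq_top_induction (P := fun ω => spinProj h 0 (spinX ξ ω) = 0)
    iSup_exteriorPower (fun q ω hω => ?_) (fun ω ω' H H' => ?_) ?_ ω
  · exact spinProj_of_mem_ne (Nat.succ_ne_zero q) (spinX_mem ξ hω)
  · simp only [map_add, H, H', add_zero]
  · simp

theorem spinProj_zero (ω : Spin h) :
    spinProj h 0 ω = ExteriorAlgebra.algebraMapInv (R := ℂ) (M := Dual ℂ h) ω • 1 := by
  have : spinProj h 0 = LinearMap.toSpanSingleton ℂ (Spin h) 1 ∘ₗ
      (ExteriorAlgebra.algebraMapInv (R := ℂ) (M := Dual ℂ h)).toLinearMap := by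
    refine spin_hom_ext ?_ fun ξ ω _ => ?_
    · rw [spinProj_of_mem (by simp)]; simp
    · rw [spinProj_zero_spinX, spinX_apply]
      simp [ExteriorAlgebra.algebraMapInv]
  exact LinearMap.congr_fun this ω

theorem spinProj_one : spinProj h 0 (1 : Spin h) = 1 := spinProj_of_mem (by simp)

theorem spinProj_succ_one (p : ℕ) : spinProj h (p + 1) (1 : Spin h) = 0 :=
  spinProj_of_mem_ne (Nat.succ_ne_zero p).symm (by simp)

variable {G : Subgroup (h ≃ₗ[ℂ] h)}

theorem spinRep_mem (g : G) {p : ℕ} {ω : Spin h} (hω : ω ∈ ⋀[ℂ]^p (Dual ℂ h)) :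
    spinRep G g ω ∈ ⋀[ℂ]^p (Dual ℂ h) := by
  have : (⋀[ℂ]^p (Dual ℂ h)).map (ExteriorAlgebra.map ((reflRep G).dual g)).toLinearMap ≤
      ⋀[ℂ]^p (Dual ℂ h) := by
    rw [ExteriorAlgebra.exteriorPower, Submodule.map_pow]
    refine pow_le_pow_left' ?_ p
    rintro _ ⟨_, ⟨ξ, rfl⟩, rfl⟩
    exact ⟨(reflRep G).dual g ξ, (ExteriorAlgebra.map_apply_ι _ _).symm⟩
  exact this ⟨ω, hω, rfl⟩

theorem spinProj_spinRep (g : G) (p : ℕ) (ω : Spin h) :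
    spinProj h p (spinRep G g ω) = spinRep G g (spinProj h p ω) :=
  spinProj_comp (k := 0) (fun _ _ hω => spinRep_mem g hω) p ω

theorem spinN_spinProj (p : ℕ) (ω : Spin h) : spinN h (spinProj h p ω) = (p : ℂ) • spinProj h p ω :=
  spinN_of_mem (spinProj_mem p ω)

theorem spinProj_spinN (p : ℕ) (ω : Spin h) : spinProj h p (spinN h ω) = (p : ℂ) • spinProj h p ω := by
  rw [← spinN_spinProj]
  refine spinProj_comp (k := 0) (T := spinN h) (fun q ω hω => ?_) p ω
  rw [spinN_of_mem hω]
  exact Submodule.smul_mem _ _ hω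

theorem spinN_spinRep (g : G) (ω : Spin h) : spinN h (spinRep G g ω) = spinRep G g (spinN h ω) := by
  refine iSup_eq_top_induction (P := fun ω => spinN h (spinRep G g ω) = spinRep G g (spinN h ω))
    iSup_exteriorPower (fun q ω hω => ?_) (fun ω ω' H H' => ?_) ?_ ω
  · rw [spinN_of_mem (spinRep_mem g hω), spinN_of_mem hω, map_smul]
  · simp only [map_add, H, H']
  · simp

end Cher

end SpinProj

end Resolution

/-! ### The Koszul complex of `S(𝔥)`. -/

section Koszul

open Module
local infixl:70 " ⊠ " => TensorProduct.map

theorem IsGradingOp.const_sub {X : Type*} [AddCommGroup X] [Module ℂ X] {E : End ℂ X}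
    (hE : IsGradingOp E) (γ : ℤ) : IsGradingOp ((γ : ℂ) • 1 - E) := by
  rw [IsGradingOp, eq_top_iff, ← hE, iSup_le_iff]
  refine fun n x hx => Submodule.mem_iSup_of_mem (γ - n) ?_
  rw [End.mem_eigenspace_iff] at hx ⊢
  rw [LinearMap.sub_apply, LinearMap.smul_apply, Module.End.one_apply, hx, ← sub_smul]
  push_cast
  rfl

theorem tmul_map_sum_left {ι X Y X' Y' : Type*} [AddCommGroup X] [Module ℂ X] [AddCommGroup Y] [Module ℂ Y]
    [AddCommGroup X'] [Module ℂ X'] [AddCommGroup Y'] [Module ℂ Y'] (s : Finset ι) (f : ι → X →ₗ[ℂ] X')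
    (g : Y →ₗ[ℂ] Y') : (∑ i ∈ s, f i) ⊠ g = ∑ i ∈ s, f i ⊠ g :=
  TensorProduct.ext' fun x y => by simp [LinearMap.sum_apply, TensorProduct.sum_tmul]

theorem tmul_map_sum_right {ι X Y X' Y' : Type*} [AddCommGroup X] [Module ℂ X] [AddCommGroup Y] [Module ℂ Y]
    [AddCommGroup X'] [Module ℂ X'] [AddCommGroup Y'] [Module ℂ Y'] (s : Finset ι) (f : X →ₗ[ℂ] X')
    (g : ι → Y →ₗ[ℂ] Y') : f ⊠ (∑ i ∈ s, g i) = ∑ i ∈ s, f ⊠ g i :=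
  TensorProduct.ext' fun x y => by simp [LinearMap.sum_apply, TensorProduct.tmul_sum]

namespace Sy

variable {E : Type*} [AddCommGroup E] [Module ℂ E] [FiniteDimensional ℂ E]

/-- The value of a polynomial at `0`. -/
noncomputable def constCoeff : Sy E →ₗ[ℂ] ℂ := (MvPolynomial.aeval fun _ => (0 : ℂ)).toLinearMap

theorem constCoeff_one : constCoeff (1 : Sy E) = 1 := map_one (MvPolynomial.aeval fun _ => (0 : ℂ))

theorem constCoeff_mul (e : E) (f : Sy E) : constCoeff (ι e * f) = 0 := by
  have h1 : constCoeff ∘ₗ (ι : E →ₗ[ℂ] Sy E) = 0 := (finBasis ℂ E).ext fun i => by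
    simp [constCoeff]
  have h2 : MvPolynomial.aeval (fun _ => (0 : ℂ)) (ι e : Sy E) = 0 := LinearMap.congr_fun h1 e
  change MvPolynomial.aeval (fun _ => (0 : ℂ)) (ι e * f : Sy E) = 0
  rw [map_mul, h2, zero_mul]

theorem constCoeff_eul (f : Sy E) : constCoeff (eul E f) = 0 := by
  rw [eul, LinearMap.sum_apply, map_sum]
  exact Finset.sum_eq_zero fun i _ => constCoeff_mul _ _

theorem constCoeff_rep {G : Type*} [Monoid G] (ρ : Representation ℂ G E) (g : G) (f : Sy E) :
    constCoeff (rep ρ g f) = constCoeff f := by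
  induction f using Sy.induction with
  | C a =>
    have : (MvPolynomial.C a : Sy E) = a • 1 := by rw [MvPolynomial.smul_eq_C_mul, mul_one]
    rw [this, map_smul, rep_one]
  | add f f' h h' => rw [map_add, map_add, map_add, h, h']
  | mul e f h => rw [rep_mul, constCoeff_mul, constCoeff_mul]

theorem eul_mul (e : E) (f : Sy E) : eul E (ι e * f) = ι e * eul E f + ι e * f :=
  LinearMap.congr_fun (eul_mulι e) f

theorem eul_rep {G : Type*} [Monoid G] (ρ : Representation ℂ G E) (g : G) (f : Sy E) :
    eul E (rep ρ g f) = rep ρ g (eul E f) := by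
  induction f using Sy.induction with
  | C a =>
    have : (MvPolynomial.C a : Sy E) = a • 1 := by rw [MvPolynomial.smul_eq_C_mul, mul_one]
    rw [this, map_smul, rep_one, map_smul, eul_one, smul_zero, map_zero]
  | add f f' h h' => rw [map_add, map_add, map_add, map_add, h, h']
  | mul e f h => rw [rep_mul, eul_mul, h, eul_mul, map_add, rep_mul, rep_mul]

/-- The homogeneous components of the symmetric algebra. -/
noncomputable def homog (E : Type*) [AddCommGroup E] [Module ℂ E] [FiniteDimensional ℂ E] :
    ℕ → Submodule ℂ (Sy E)
  -- Taking constants rather than the kernel of `eul` here makes elements of degree `0` visibly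
  -- scalar; that the two coincide is not needed at this point.
  | 0 => Submodule.span ℂ {1}
  | n + 1 => (eul E).eigenspace ((n + 1 : ℕ) : ℂ)

theorem eul_of_mem_homog {n : ℕ} {f : Sy E} (hf : f ∈ homog E n) : eul E f = (n : ℂ) • f := by
  cases n with
  | zero =>
    obtain ⟨a, rfl⟩ := Submodule.mem_span_singleton.1 hf
    rw [map_smul, eul_one]; simp
  | succ n => exact End.mem_eigenspace_iff.1 hf

theorem iSup_homog : ⨆ n, homog E n = ⊤ := by
  rw [eq_top_iff]
  rintro f -
  induction f using Sy.induction with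
  | C a =>
    refine Submodule.mem_iSup_of_mem 0 (Submodule.mem_span_singleton.2 ⟨a, ?_⟩)
    rw [MvPolynomial.smul_eq_C_mul, mul_one]
  | add f f' h h' => exact Submodule.add_mem _ h h'
  | mul e f h =>
    induction h using Submodule.iSup_induction' with
    | mem n f hf =>
      refine Submodule.mem_iSup_of_mem (n + 1) (End.mem_eigenspace_iff.2 ?_)
      rw [eul_mul, eul_of_mem_homog hf, mul_smul_comm]
      push_cast
      module
    | zero => rw [mul_zero]; exact Submodule.zero_mem _
    | add f f' _ _ h h' => rw [mul_add]; exact Submodule.add_mem _ h h'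

end Sy

variable {h : Type u} [AddCommGroup h] [Module ℂ h] [FiniteDimensional ℂ h]
  {V : Type u} [AddCommGroup V] [Module ℂ V]

namespace Koszul

open Cher

/-- The space `(⋀ 𝔥*)* ⊗ V`. -/
abbrev Gens (h : Type u) [AddCommGroup h] [Module ℂ h] (V : Type u) [AddCommGroup V] [Module ℂ V] :
    Type u := Dual ℂ (Spin h) ⊗[ℂ] V

/-- The transpose of an operator on `⋀ 𝔥*`, acting on `(⋀ 𝔥*)* ⊗ V`. -/
noncomputable def tr : End ℂ (Spin h) →ₗ[ℂ] End ℂ (Gens h V) where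
  toFun T := T.dualMap ⊠ 1
  map_add' S T := TensorProduct.ext' fun u v =>
    (congrArg (fun u' : Dual ℂ (Spin h) => u' ⊗ₜ[ℂ] v) (LinearMap.comp_add S T u)).trans
      (TensorProduct.add_tmul _ _ _)
  map_smul' c T := TensorProduct.ext' fun u v =>
    (congrArg (fun u' : Dual ℂ (Spin h) => u' ⊗ₜ[ℂ] v) (LinearMap.comp_smul u c T)).trans
      (TensorProduct.smul_tmul' _ _ _)

theorem tr_tmul (T : End ℂ (Spin h)) (u : Dual ℂ (Spin h)) (v : V) :
    tr T (u ⊗ₜ[ℂ] v) = (u ∘ₗ T) ⊗ₜ v := rfl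

theorem tr_mul (S T : End ℂ (Spin h)) : (tr S * tr T : End ℂ (Gens h V)) = tr (T * S) :=
  TensorProduct.ext' fun _ _ => rfl

theorem tr_one : (tr 1 : End ℂ (Gens h V)) = 1 := TensorProduct.ext' fun _ _ => rfl

variable {G : Subgroup (h ≃ₗ[ℂ] h)}

/-- The action of `G` on `(⋀ 𝔥*)* ⊗ V`. -/
noncomputable def gensRep (τ : Representation ℂ G V) : Representation ℂ G (Gens h V) :=
  (spinRep G).dual.tprod τ

theorem gensRep_tmul (τ : Representation ℂ G V) (g : G) (u : Dual ℂ (Spin h)) (v : V) :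
    gensRep τ g (u ⊗ₜ[ℂ] v) = (u ∘ₗ spinRep G g⁻¹) ⊗ₜ τ g v := rfl

/-- Transposition reverses composition and the dual action involves `g⁻¹`; the two reversals cancel,
so intertwining relations survive unchanged. -/
theorem gensRep_tr (τ : Representation ℂ G V) (g : G) {S T : End ℂ (Spin h)}
    (hST : ∀ ω, spinRep G g (S ω) = T (spinRep G g ω)) (w : Gens h V) :
    gensRep τ g (tr S w) = tr T (gensRep τ g w) := by
  induction w using TensorProduct.induction_on with
  | zero => simp
  | add w w' H H' => simp only [map_add, H, H']
  | tmul u v =>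
    rw [tr_tmul, gensRep_tmul, gensRep_tmul, tr_tmul]
    congr 1
    refine LinearMap.ext fun ω => congrArg u ?_
    have h1 : ∀ ω, spinRep G g (spinRep G g⁻¹ ω) = ω := fun ω => by
      rw [← Module.End.mul_apply, ← map_mul, mul_inv_cancel, map_one, Module.End.one_apply]
    have h2 : ∀ ω, spinRep G g⁻¹ (spinRep G g ω) = ω := fun ω => by
      rw [← Module.End.mul_apply, ← map_mul, inv_mul_cancel, map_one, Module.End.one_apply]
    change S (spinRep G g⁻¹ ω) = spinRep G g⁻¹ (T ω)
    rw [← h2 (S (spinRep G g⁻¹ ω)), hST, h1]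

/-- The map `u ⊗ v ↦ u(1) v`. -/
noncomputable def gensAug : Gens h V →ₗ[ℂ] V :=
  (TensorProduct.lid ℂ V).toLinearMap ∘ₗ (Dual.eval ℂ (Spin h) 1 ⊠ LinearMap.id)

theorem gensAug_tmul (u : Dual ℂ (Spin h)) (v : V) : gensAug (u ⊗ₜ[ℂ] v) = u 1 • v := rfl

theorem gensAug_tr {T : End ℂ (Spin h)} {a : ℂ} (hT : T 1 = a • 1) (w : Gens h V) :
    gensAug (tr T w) = a • gensAug w := by
  induction w using TensorProduct.induction_on with
  | zero => simp
  | add w w' H H' => simp only [map_add, H, H', smul_add]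
  | tmul u v =>
    rw [tr_tmul, gensAug_tmul, gensAug_tmul, LinearMap.comp_apply, hT, map_smul, smul_assoc]

theorem gensAug_gensRep (τ : Representation ℂ G V) (g : G) (w : Gens h V) :
    gensAug (gensRep τ g w) = τ g (gensAug w) := by
  induction w using TensorProduct.induction_on with
  | zero => simp
  | add w w' H H' => simp only [map_add, H, H']
  | tmul u v => rw [gensRep_tmul, gensAug_tmul, gensAug_tmul, map_smul, LinearMap.comp_apply, spinRep_one]

/-- The map `v ↦ ε ⊗ v`, where `ε` is the projection onto `⋀⁰ 𝔥* = ℂ`. -/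
noncomputable def gensSec : V →ₗ[ℂ] Gens h V :=
  TensorProduct.mk ℂ (Dual ℂ (Spin h)) V (ExteriorAlgebra.algebraMapInv (R := ℂ) (M := Dual ℂ h)).toLinearMap

theorem gensAug_gensSec (v : V) : gensAug (gensSec (h := h) v) = v := by
  change (ExteriorAlgebra.algebraMapInv (R := ℂ) (M := Dual ℂ h)) 1 • v = v
  rw [map_one, one_smul]

theorem tr_spinProj_zero (w : Gens h V) : tr (spinProj h 0) w = gensSec (gensAug w) := by
  induction w using TensorProduct.induction_on with
  | zero => simp
  | add w w' H H' => simp only [map_add, H, H']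
  | tmul u v =>
    rw [tr_tmul, gensAug_tmul, map_smul]
    change _ = u 1 • (_ ⊗ₜ[ℂ] v)
    rw [TensorProduct.smul_tmul']
    congr 1
    refine LinearMap.ext fun ω => ?_
    rw [LinearMap.comp_apply, spinProj_zero, map_smul, smul_eq_mul, mul_comm]
    rfl

theorem sum_tr_spinProj (w : Gens h V) :
    ∑ p ∈ Finset.range (finrank ℂ h + 1), tr (spinProj h p) w = w := by
  have : ∑ p ∈ Finset.range (finrank ℂ h + 1), spinProj h p = 1 :=
    LinearMap.ext fun ω => by rw [LinearMap.sum_apply]; exact sum_spinProj ω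
  rw [← LinearMap.sum_apply, ← map_sum, this, tr_one]
  rfl

theorem tr_spinN_tr_spinProj (p : ℕ) (w : Gens h V) :
    tr (spinN h) (tr (spinProj h p) w) = (p : ℂ) • tr (spinProj h p) w := by
  have : spinProj h p * spinN h = (p : ℂ) • spinProj h p := LinearMap.ext fun ω => spinProj_spinN p ω
  rw [← Module.End.mul_apply, tr_mul, this, map_smul]
  rfl

theorem isGradingOp_tr_spinN : IsGradingOp (tr (spinN h) : End ℂ (Gens h V)) := by
  rw [IsGradingOp, eq_top_iff]
  rintro w -
  rw [← sum_tr_spinProj w]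
  refine Submodule.sum_mem _ fun p _ => Submodule.mem_iSup_of_mem (p : ℤ) (End.mem_eigenspace_iff.2 ?_)
  rw [tr_spinN_tr_spinProj]
  norm_cast

/-- The underlying space `S(𝔥) ⊗ (⋀ 𝔥*)* ⊗ V` of the Koszul complex. -/
abbrev Kos (h : Type u) [AddCommGroup h] [Module ℂ h] [FiniteDimensional ℂ h] (V : Type u)
    [AddCommGroup V] [Module ℂ V] : Type u := Sy h ⊗[ℂ] Gens h V

/-- The Koszul differential. -/
noncomputable def diff : End ℂ (Kos h V) :=
  ∑ j, Sy.mulι (finBasis ℂ h j) ⊠ tr (spinX ((finBasis ℂ h).coord j))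

/-- The de Rham differential on the Koszul complex. -/
noncomputable def codiff : End ℂ (Kos h V) :=
  ∑ j, Sy.der ((finBasis ℂ h).coord j) ⊠ tr (spinY (finBasis ℂ h j))

/-- The total degree on the Koszul complex. -/
noncomputable def weight : End ℂ (Kos h V) := Sy.eul h ⊠ 1 + 1 ⊠ tr (spinN h)

theorem isGradingOp_weight : IsGradingOp (weight : End ℂ (Kos h V)) :=
  isGradingOp_tensor Sy.isGradingOp_eul isGradingOp_tr_spinN

theorem diff_sq : (diff * diff : End ℂ (Kos h V)) = 0 := by
  refine sum_tmul_sq (fun i j => Sy.mulι_comm _ _) fun i j => ?_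
  rw [tr_mul, tr_mul, ← map_add, spinX_anticomm, map_zero]

/-- Cartan's formula. In `sum_tmul_anticomm` the Clifford relation contributes the polynomial degree
and the Weyl relation `[∂, y] = 1` the exterior degree; `-2` is the Clifford normalisation. -/
theorem diff_codiff : (diff * codiff + codiff * diff : End ℂ (Kos h V)) = (-2 : ℂ) • weight := by
  rw [diff, codiff, sum_tmul_anticomm]
  have e1 : ∀ i j, tr (spinX ((finBasis ℂ h).coord i)) * tr (spinY (finBasis ℂ h j)) +
      tr (spinY (finBasis ℂ h j)) * tr (spinX ((finBasis ℂ h).coord i)) =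
      (if i = j then (-2 : ℂ) else 0) • (1 : End ℂ (Gens h V)) := fun i j => by
    rw [tr_mul, tr_mul, ← map_add, add_comm, spinX_spinY, map_smul, tr_one, Basis.coord_apply,
      Basis.repr_self, Finsupp.single_apply]
    simp only [eq_comm (a := j)]
    split <;> simp
  have e2 : ∀ i j, Sy.der ((finBasis ℂ h).coord j) * Sy.mulι (finBasis ℂ h i) -
      Sy.mulι (finBasis ℂ h i) * Sy.der ((finBasis ℂ h).coord j) =
      (if i = j then (1 : ℂ) else 0) • (1 : End ℂ (Sy h)) := fun i j => by
    rw [Sy.der_mulι, add_sub_cancel_left, Basis.coord_apply, Basis.repr_self, Finsupp.single_apply]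
  have e3 : ∀ i j, (Sy.mulι (finBasis ℂ h i) * Sy.der ((finBasis ℂ h).coord j)) ⊠
      (tr (spinX ((finBasis ℂ h).coord i)) * tr (spinY (finBasis ℂ h j)) +
        tr (spinY (finBasis ℂ h j)) * tr (spinX ((finBasis ℂ h).coord i)) : End ℂ (Gens h V)) +
      (Sy.der ((finBasis ℂ h).coord j) * Sy.mulι (finBasis ℂ h i) -
        Sy.mulι (finBasis ℂ h i) * Sy.der ((finBasis ℂ h).coord j)) ⊠
      (tr (spinY (finBasis ℂ h j)) * tr (spinX ((finBasis ℂ h).coord i))) =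
      if i = j then ((-2 : ℂ) • (Sy.mulι (finBasis ℂ h i) * Sy.der ((finBasis ℂ h).coord i))) ⊠ 1 +
        1 ⊠ tr (spinX ((finBasis ℂ h).coord i) * spinY (finBasis ℂ h i)) else 0 := fun i j => by
    rw [e1, e2, tr_mul]
    split
    · subst_vars
      rw [one_smul, TensorProduct.map_smul_right, TensorProduct.map_smul_left]
    · rw [zero_smul, zero_smul, TensorProduct.map_zero_right, TensorProduct.map_zero_left, add_zero]
  simp only [e3, Finset.sum_ite_eq, Finset.mem_univ, if_true, Finset.sum_add_distrib]
  have h1 : ∑ i, ((-2 : ℂ) • (Sy.mulι (finBasis ℂ h i) * Sy.der ((finBasis ℂ h).coord i))) ⊠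
      (1 : End ℂ (Gens h V)) = (-2 : ℂ) • (Sy.eul h ⊠ 1) := by
    rw [Sy.eul, ← TensorProduct.map_smul_left, Finset.smul_sum, tmul_map_sum_left]
  have h2 : ∑ i, (1 : End ℂ (Sy h)) ⊠ (tr (spinX ((finBasis ℂ h).coord i) * spinY (finBasis ℂ h i)) :
      End ℂ (Gens h V)) = (-2 : ℂ) • (1 ⊠ tr (spinN h)) := by
    rw [← TensorProduct.map_smul_right, ← map_smul, spinN, smul_smul, ← tmul_map_sum_right,
      ← map_sum]
    norm_num
  rw [h1, h2, weight, smul_add]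

end Koszul

end Koszul

/-! ### Exactness of the Koszul complex and the resolution of standard modules. -/

section KoszulResolution

open Module
local infixl:70 " ⊠ " => TensorProduct.map

variable {h : Type u} [AddCommGroup h] [Module ℂ h] [FiniteDimensional ℂ h]
  {V : Type u} [AddCommGroup V] [Module ℂ V]

namespace Koszul

open Cher

theorem diff_diff (k : Kos h V) : diff (diff k) = 0 := LinearMap.congr_fun diff_sq k

/-- Up to the factor `-2`, both sides are `diff codiff diff`, by Cartan's formula and `diff² = 0`.
-/
theorem diff_weight (k : Kos h V) : diff (weight k) = weight (diff k) := by
  have h1 : (-2 : ℂ) • (diff * weight) = (-2 : ℂ) • (weight * diff : End ℂ (Kos h V)) := by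
    rw [← mul_smul_comm, ← smul_mul_assoc, ← diff_codiff, mul_add, add_mul, ← mul_assoc, diff_sq, zero_mul,
      zero_add, mul_assoc codiff, diff_sq, mul_zero, add_zero, mul_assoc]
  exact LinearMap.congr_fun (smul_right_injective _ (by norm_num : (-2 : ℂ) ≠ 0) h1) k

/-- The projection onto the `p`-th term of the Koszul complex. -/
noncomputable def proj (p : ℕ) : End ℂ (Kos h V) := 1 ⊠ tr (spinProj h p)

theorem proj_tmul (p : ℕ) (q : Sy h) (w : Gens h V) : proj p (q ⊗ₜ w) = q ⊗ₜ tr (spinProj h p) w := rfl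

theorem proj_proj (p : ℕ) (k : Kos h V) : proj p (proj p k) = proj p k := by
  have : (proj p * proj p : End ℂ (Kos h V)) = proj p := by
    rw [proj, ← TensorProduct.map_mul, tr_mul, one_mul]
    congr 2
    exact LinearMap.ext fun ω => spinProj_spinProj p ω
  exact LinearMap.congr_fun this k

theorem diff_proj_succ (p : ℕ) (k : Kos h V) : diff (proj (p + 1) k) = proj p (diff k) := by
  have : (diff * proj (p + 1) : End ℂ (Kos h V)) = proj p * diff := by
    rw [diff, proj, proj, Finset.sum_mul, Finset.mul_sum]
    refine Finset.sum_congr rfl fun j _ => ?_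
    rw [← TensorProduct.map_mul, ← TensorProduct.map_mul, tr_mul, tr_mul, one_mul, mul_one]
    congr 2
    exact LinearMap.ext fun ω => spinProj_spinX _ p ω
  exact LinearMap.congr_fun this k

theorem diff_proj_zero (k : Kos h V) : diff (proj 0 k) = 0 := by
  have : (diff * proj 0 : End ℂ (Kos h V)) = 0 := by
    rw [diff, proj, Finset.sum_mul]
    refine Finset.sum_eq_zero fun j _ => ?_
    have e : spinProj h 0 * spinX ((finBasis ℂ h).coord j) = 0 :=
      LinearMap.ext fun ω => spinProj_zero_spinX _ ω
    rw [← TensorProduct.map_mul, tr_mul, e, map_zero, TensorProduct.map_zero_right]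
  exact LinearMap.congr_fun this k

theorem proj_eq_zero {p : ℕ} (hp : finrank ℂ h < p) (k : Kos h V) : proj p k = 0 := by
  have e : spinProj h p = 0 := LinearMap.ext fun ω => spinProj_eq_zero hp ω
  rw [proj, e, map_zero, TensorProduct.map_zero_right]
  rfl

/-- The augmentation of the Koszul complex. -/
noncomputable def aug : Kos h V →ₗ[ℂ] V :=
  (TensorProduct.lid ℂ V).toLinearMap ∘ₗ (Sy.constCoeff ⊠ gensAug)

theorem aug_tmul (q : Sy h) (w : Gens h V) : aug (q ⊗ₜ w) = Sy.constCoeff q • gensAug w := rfl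

/-- The section of the augmentation of the Koszul complex. -/
noncomputable def sec : V →ₗ[ℂ] Kos h V := TensorProduct.mk ℂ (Sy h) (Gens h V) 1 ∘ₗ gensSec

theorem aug_sec (v : V) : aug (sec (h := h) v) = v :=
  (aug_tmul _ _).trans (by rw [Sy.constCoeff_one, one_smul, gensAug_gensSec])

theorem aug_mulι (η : h) (k : Kos h V) : aug ((Sy.mulι η ⊠ (1 : End ℂ (Gens h V))) k) = 0 := by
  induction k using TensorProduct.induction_on with
  | zero => simp
  | add k k' H H' => simp only [map_add, H, H', add_zero]
  | tmul q w => rw [TensorProduct.map_tmul, aug_tmul, Sy.mulι_apply, Sy.constCoeff_mul, zero_smul]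

theorem aug_diff (k : Kos h V) : aug (diff k) = 0 := by
  rw [diff, LinearMap.sum_apply, map_sum]
  refine Finset.sum_eq_zero fun j _ => ?_
  have : Sy.mulι (finBasis ℂ h j) ⊠ tr (spinX ((finBasis ℂ h).coord j)) =
      (Sy.mulι (finBasis ℂ h j) ⊠ 1) * ((1 : End ℂ (Sy h)) ⊠ (tr (spinX ((finBasis ℂ h).coord j)) :
        End ℂ (Gens h V))) := by
    rw [← TensorProduct.map_mul, one_mul, mul_one]
  rw [this]
  exact aug_mulι _ _

theorem aug_one_tr {T : End ℂ (Spin h)} {a : ℂ} (hT : T 1 = a • 1) (k : Kos h V) :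
    aug (((1 : End ℂ (Sy h)) ⊠ tr T) k) = a • aug k := by
  induction k using TensorProduct.induction_on with
  | zero => simp
  | add k k' H H' => simp only [map_add, H, H', smul_add]
  | tmul q w =>
    rw [TensorProduct.map_tmul, aug_tmul, gensAug_tr hT, aug_tmul, smul_comm]
    rfl

theorem aug_proj_zero (k : Kos h V) : aug (proj 0 k) = aug k :=
  (aug_one_tr (a := 1) (by rw [spinProj_one, one_smul]) k).trans (one_smul _ _)

theorem aug_proj_succ (p : ℕ) (k : Kos h V) : aug (proj (p + 1) k) = 0 :=
  (aug_one_tr (a := 0) (by rw [spinProj_succ_one, zero_smul]) k).trans (zero_smul _ _)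

theorem aug_weight (k : Kos h V) : aug (weight k) = 0 := by
  have h1 : aug (((1 : End ℂ (Sy h)) ⊠ tr (spinN h)) k) = 0 :=
    (aug_one_tr (a := 0) (by rw [spinN_one, zero_smul]) k).trans (zero_smul _ _)
  have h2 : ∀ k : Kos h V, aug ((Sy.eul h ⊠ (1 : End ℂ (Gens h V))) k) = 0 := fun k => by
    induction k using TensorProduct.induction_on with
    | zero => simp
    | add k k' H H' => simp only [map_add, H, H', add_zero]
    | tmul q w => rw [TensorProduct.map_tmul, aug_tmul, Sy.constCoeff_eul, zero_smul]
  rw [weight, LinearMap.add_apply, map_add, h1, h2, add_zero]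

theorem weight_mulι (η : h) (k : Kos h V) : weight ((Sy.mulι η ⊠ (1 : End ℂ (Gens h V))) k) =
    (Sy.mulι η ⊠ (1 : End ℂ (Gens h V))) (weight k) + (Sy.mulι η ⊠ (1 : End ℂ (Gens h V))) k := by
  induction k using TensorProduct.induction_on with
  | zero => simp
  | add k k' H H' => simp only [map_add, H, H']; abel
  | tmul q w =>
    simp only [weight, LinearMap.add_apply, TensorProduct.map_tmul, map_add, Sy.mulι_apply, Sy.eul_mul,
      TensorProduct.add_tmul, Module.End.one_apply]
    abel

/-- In positive weight, Cartan's formula makes `-½ codiff / weight` a contracting homotopy, and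
weight `0` is exactly the image of `sec`. -/
theorem exists_homotopy : ∃ H : End ℂ (Kos h V), ∀ k, diff (H k) + H (diff k) = k - sec (aug k) := by
  have hI := (isGradingOp_weight (h := h) (V := V)).isInternal
  -- The inverse of the weight; the convention `0⁻¹ = 0` makes it vanish in weight `0`.
  set R : End ℂ (Kos h V) := gradedScale hI fun n => (n : ℂ)⁻¹ with hR
  have hcomm : ∀ k, diff (R k) = R (diff k) := fun k => LinearMap.congr_fun
    (gradedScale_comp hI hI (fun n => (n : ℂ)⁻¹) diff fun n k hk => by
      rw [End.mem_eigenspace_iff] at hk ⊢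
      rw [← diff_weight, hk, map_smul]) k
  have key : ∀ k, weight (R k) = k - sec (aug k) := fun k => by
    induction k using TensorProduct.induction_on with
    | zero => simp
    | add k k' H H' => simp only [map_add, H, H']; abel
    | tmul q w =>
      refine iSup_eq_top_induction (P := fun q => ∀ w : Gens h V, weight (R (q ⊗ₜ w)) = q ⊗ₜ w - sec (aug (q ⊗ₜ w)))
        Sy.iSup_homog (fun n q hq w => ?_) (fun q q' H H' w => ?_) ?_ q w
      · have hp : ∀ p, weight (R (q ⊗ₜ tr (spinProj h p) w)) =
            q ⊗ₜ tr (spinProj h p) w - sec (aug (q ⊗ₜ tr (spinProj h p) w)) := fun p => by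
          have hw : weight (q ⊗ₜ tr (spinProj h p) w) = (((n + p : ℕ) : ℤ) : ℂ) • (q ⊗ₜ[ℂ] tr (spinProj h p) w) := by
            rw [weight, LinearMap.add_apply, TensorProduct.map_tmul, TensorProduct.map_tmul,
              Sy.eul_of_mem_homog hq, tr_spinN_tr_spinProj, TensorProduct.tmul_smul,
              ← TensorProduct.smul_tmul', Module.End.one_apply, Module.End.one_apply, ← add_smul]
            push_cast
            rfl
          -- Weight `0` forces a constant polynomial and exterior degree `0`, where `sec ∘ aug` is
          -- the identity and `R` is zero. In positive weight `aug` vanishes by `aug_weight`.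
          by_cases h0 : n + p = 0
          · obtain ⟨rfl, rfl⟩ : n = 0 ∧ p = 0 := by omega
            rw [hR, gradedScale_of_mem hI _ (End.mem_eigenspace_iff.2 hw)]
            obtain ⟨a, rfl⟩ := Submodule.mem_span_singleton.1 hq
            simp only [add_zero, Nat.cast_zero, Int.cast_zero, inv_zero, zero_smul, map_zero]
            rw [eq_comm, sub_eq_zero, tr_spinProj_zero, ← TensorProduct.smul_tmul', map_smul, map_smul]
            congr 1
            rw [show (1 : Sy h) ⊗ₜ[ℂ] gensSec (gensAug w) = sec (gensAug w) from rfl, aug_sec]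
          · have hne : ((((n + p : ℕ) : ℤ) : ℂ)) ≠ 0 := by exact_mod_cast h0
            have ha : aug (q ⊗ₜ[ℂ] tr (spinProj h p) w) = 0 := by
              have := congrArg aug hw
              rw [aug_weight, map_smul, eq_comm, smul_eq_zero] at this
              exact this.resolve_left hne
            rw [hR, gradedScale_of_mem hI _ (End.mem_eigenspace_iff.2 hw), map_smul, hw, smul_smul,
              inv_mul_cancel₀ hne, one_smul, ha, map_zero, sub_zero]
        conv_lhs => rw [← sum_tr_spinProj w]
        conv_rhs => rw [← sum_tr_spinProj w]
        simp only [TensorProduct.tmul_sum, map_sum, hp, Finset.sum_sub_distrib]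
      · simp only [TensorProduct.add_tmul, map_add, H, H']; abel
      · intro w; simp
  refine ⟨(-(1 / 2) : ℂ) • (codiff * R), fun k => ?_⟩
  have h1 := LinearMap.congr_fun (diff_codiff (h := h) (V := V)) (R k)
  change diff (codiff (R k)) + codiff (diff (R k)) = (-2 : ℂ) • weight (R k) at h1
  change diff ((-(1 / 2) : ℂ) • codiff (R k)) + (-(1 / 2) : ℂ) • codiff (R (diff k)) = _
  rw [map_smul, ← smul_add, ← hcomm, h1, key, smul_smul]
  norm_num

variable {G : Subgroup (h ≃ₗ[ℂ] h)} [Finite G] (τ : Representation ℂ G V) (γ : ℤ)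

theorem gensRep_tr_spinN (g : G) (w : Gens h V) :
    tr (spinN h) (gensRep τ g w) = gensRep τ g (tr (spinN h) w) :=
  (gensRep_tr τ g (fun ω => (spinN_spinRep g ω).symm) w).symm

theorem gensRep_tr_spinProj (g : G) (p : ℕ) (w : Gens h V) :
    tr (spinProj h p) (gensRep τ g w) = gensRep τ g (tr (spinProj h p) w) :=
  (gensRep_tr τ g (fun ω => (spinProj_spinRep g p ω).symm) w).symm

/-- The Koszul complex, as a graded module over `ℂ[𝔥*] ⋊ ℂG`. -/
noncomputable def koszul : GrYRep G (Kos h V) where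
  rep := (Sy.rep (reflRep G)).tprod (gensRep τ)
  y :=
    { toFun η := Sy.mulι η ⊠ 1
      map_add' η η' := by rw [map_add, TensorProduct.map_add_left]
      map_smul' a η := by rw [map_smul, TensorProduct.map_smul_left]; rfl }
  y_comm η η' k := LinearMap.congr_fun (f := (Sy.mulι η ⊠ 1) * (Sy.mulι η' ⊠ 1))
    (g := (Sy.mulι η' ⊠ 1) * (Sy.mulι η ⊠ 1)) (by
      rw [← TensorProduct.map_mul, ← TensorProduct.map_mul, Sy.mulι_comm]) k
  rep_y g η k := by
    induction k using TensorProduct.induction_on with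
    | zero => simp
    | add k k' H H' => simp only [map_add, H, H']
    | tmul q w =>
      change Sy.rep (reflRep G) g (Sy.ι η * q) ⊗ₜ[ℂ] gensRep τ g w = _
      rw [Sy.rep_mul]
      rfl
  -- Elements of `𝔥` lower the degree by one, and so do the exterior generators: the `p`-th term is
  -- generated in degree `γ - p`, which makes the differential homogeneous of degree `0`.
  eul := (γ : ℂ) • 1 - weight
  isGradingOp := isGradingOp_weight.const_sub γ
  eul_rep g k := by
    have : weight (((Sy.rep (reflRep G)).tprod (gensRep τ)) g k) =
        ((Sy.rep (reflRep G)).tprod (gensRep τ)) g (weight k) := by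
      induction k using TensorProduct.induction_on with
      | zero => simp
      | add k k' H H' => simp only [map_add, H, H']
      | tmul q w =>
        rw [weight, LinearMap.add_apply, LinearMap.add_apply, map_add]
        change (Sy.eul h (Sy.rep (reflRep G) g q)) ⊗ₜ[ℂ] (gensRep τ g w) +
          (Sy.rep (reflRep G) g q) ⊗ₜ[ℂ] (tr (spinN h) (gensRep τ g w)) = _
        rw [Sy.eul_rep, gensRep_tr_spinN]
        rfl
    rw [LinearMap.sub_apply, LinearMap.sub_apply, map_sub, this, LinearMap.smul_apply, LinearMap.smul_apply,
      map_smul]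
    rfl
  eul_y η k := by
    change (γ : ℂ) • (Sy.mulι η ⊠ (1 : End ℂ (Gens h V))) k - weight ((Sy.mulι η ⊠ (1 : End ℂ (Gens h V))) k) =
      (Sy.mulι η ⊠ (1 : End ℂ (Gens h V))) ((γ : ℂ) • k - weight k) - (Sy.mulι η ⊠ (1 : End ℂ (Gens h V))) k
    rw [weight_mulι, map_sub, map_smul]
    abel

theorem koszul_rep_tmul (g : G) (q : Sy h) (w : Gens h V) :
    (koszul τ γ).rep g (q ⊗ₜ w) = Sy.rep (reflRep G) g q ⊗ₜ gensRep τ g w := rfl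

theorem koszul_y_tmul (η : h) (q : Sy h) (w : Gens h V) :
    (koszul τ γ).y η (q ⊗ₜ w) = (Sy.ι η * q) ⊗ₜ w := rfl

theorem koszul_eul (k : Kos h V) : (koszul τ γ).eul k = (γ : ℂ) • k - weight k := rfl

/-- The differential is the action of the canonical tensor `∑ yⱼ ⊗ xⱼ`, which is `G`-invariant by
`sum_basis_smul`. -/
theorem diff_rep (g : G) (k : Kos h V) : diff ((koszul τ γ).rep g k) = (koszul τ γ).rep g (diff k) := by
  let B : Dual ℂ h →ₗ[ℂ] h →ₗ[ℂ] End ℂ (Kos h V) := LinearMap.mk₂ ℂ (fun ξ η => Sy.mulι η ⊠ tr (spinX ξ))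
    (fun ξ ξ' η => by rw [map_add, map_add, TensorProduct.map_add_right])
    (fun c ξ η => by rw [map_smul, map_smul, TensorProduct.map_smul_right])
    (fun ξ η η' => by rw [map_add, TensorProduct.map_add_left])
    (fun c ξ η => by rw [map_smul, TensorProduct.map_smul_left])
  have h1 : ∀ ξ η, (koszul τ γ).rep g (B ξ η k) =
      B ((reflRep G).dual g ξ) (reflRep G g η) ((koszul τ γ).rep g k) := fun ξ η => by
    induction k using TensorProduct.induction_on with
    | zero => simp
    | add k k' H H' => simp only [map_add, H, H']
    | tmul q w =>
      change Sy.rep (reflRep G) g (Sy.ι η * q) ⊗ₜ[ℂ] gensRep τ g (tr (spinX ξ) w) =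
        (Sy.ι (reflRep G g η) * Sy.rep (reflRep G) g q) ⊗ₜ[ℂ] tr (spinX ((reflRep G).dual g ξ)) (gensRep τ g w)
      rw [Sy.rep_mul, gensRep_tr τ g (spinRep_spinX g ξ)]
  have h2 : ∀ k, diff k = ∑ j, B.compr₂ (LinearMap.applyₗ k) ((finBasis ℂ h).coord j) (finBasis ℂ h j) :=
    fun k => LinearMap.sum_apply _ _ _
  rw [h2, h2, ← sum_basis_smul _ g, map_sum]
  exact Finset.sum_congr rfl fun j _ => (h1 _ _).symm

theorem diff_y (η : h) (k : Kos h V) : diff ((koszul τ γ).y η k) = (koszul τ γ).y η (diff k) := by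
  have : diff * (Sy.mulι η ⊠ (1 : End ℂ (Gens h V))) = (Sy.mulι η ⊠ 1) * diff := by
    rw [diff, Finset.sum_mul, Finset.mul_sum]
    refine Finset.sum_congr rfl fun j _ => ?_
    rw [← TensorProduct.map_mul, ← TensorProduct.map_mul, Sy.mulι_comm, one_mul, mul_one]
  exact LinearMap.congr_fun this k

theorem diff_eul (k : Kos h V) : diff ((koszul τ γ).eul k) = (koszul τ γ).eul (diff k) := by
  rw [koszul_eul, koszul_eul, map_sub, map_smul, diff_weight]

theorem proj_rep (p : ℕ) (g : G) (k : Kos h V) :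
    proj p ((koszul τ γ).rep g k) = (koszul τ γ).rep g (proj p k) := by
  induction k using TensorProduct.induction_on with
  | zero => simp
  | add k k' H H' => simp only [map_add, H, H']
  | tmul q w => rw [koszul_rep_tmul, proj_tmul, proj_tmul, koszul_rep_tmul, gensRep_tr_spinProj]

theorem proj_y (p : ℕ) (η : h) (k : Kos h V) :
    proj p ((koszul τ γ).y η k) = (koszul τ γ).y η (proj p k) := by
  induction k using TensorProduct.induction_on with
  | zero => simp
  | add k k' H H' => simp only [map_add, H, H']
  | tmul q w => rfl

theorem proj_weight (p : ℕ) (k : Kos h V) : proj p (weight k) = weight (proj p k) := by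
  have : (proj p * weight : End ℂ (Kos h V)) = weight * proj p := by
    rw [proj, weight, mul_add, add_mul]
    simp only [← TensorProduct.map_mul, one_mul, mul_one, tr_mul]
    congr 3
    exact LinearMap.ext fun ω => (spinN_spinProj p ω).trans (spinProj_spinN p ω).symm
  exact LinearMap.congr_fun this k

theorem proj_eul (p : ℕ) (k : Kos h V) : proj p ((koszul τ γ).eul k) = (koszul τ γ).eul (proj p k) := by
  rw [koszul_eul, koszul_eul, map_sub, map_smul, proj_weight]

theorem aug_rep (g : G) (k : Kos h V) :
    aug ((koszul τ γ).rep g k) = (GrYRep.triv τ γ).rep g (aug k) := by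
  induction k using TensorProduct.induction_on with
  | zero => simp
  | add k k' H H' => simp only [map_add, H, H']
  | tmul q w =>
    rw [koszul_rep_tmul, aug_tmul, aug_tmul, Sy.constCoeff_rep, gensAug_gensRep, map_smul]
    rfl

theorem aug_y (η : h) (k : Kos h V) :
    aug ((koszul τ γ).y η k) = (GrYRep.triv τ γ).y η (aug k) := aug_mulι η k

theorem aug_eul (k : Kos h V) : aug ((koszul τ γ).eul k) = (GrYRep.triv τ γ).eul (aug k) := by
  rw [koszul_eul, map_sub, map_smul, aug_weight, sub_zero]
  rfl

variable (D : CherData G)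

/-- The differential of the Koszul resolution. -/
noncomputable def resDiff : (koszul τ γ).ind D ⟶ (koszul τ γ).ind D :=
  GrYRep.indMap D diff (diff_rep τ γ) (diff_y τ γ) (diff_eul τ γ)

/-- The projections onto the terms of the Koszul resolution. -/
noncomputable def resProj (p : ℕ) : (koszul τ γ).ind D ⟶ (koszul τ γ).ind D :=
  GrYRep.indMap D (proj p) (proj_rep τ γ p) (proj_y τ γ p) (proj_eul τ γ p)

/-- The augmentation of the Koszul resolution. -/
noncomputable def resAug : (koszul τ γ).ind D ⟶ (GrYRep.triv τ γ).ind D :=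
  GrYRep.indMap D aug (aug_rep τ γ) (aug_y τ γ) (aug_eul τ γ)

/-- The terms of the Koszul resolution of a standard module. -/
noncomputable def term (p : ℕ) : GrMod.{u, u} (Cher.deg D) := GrMod.part (resProj τ γ D p)

theorem resProj_resProj (p : ℕ) (x : (koszul τ γ).ind D) :
    (resProj τ γ D p).1 ((resProj τ γ D p).1 x) = (resProj τ γ D p).1 x := by
  have : ((1 : End ℂ (Sy (Dual ℂ h))) ⊠ (proj p : End ℂ (Kos h V))) * (1 ⊠ proj p) = 1 ⊠ proj p := by
    rw [← TensorProduct.map_mul, one_mul]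
    congr 1
    exact LinearMap.ext (proj_proj p)
  exact LinearMap.congr_fun this x

/-- The Koszul resolution of the standard module. -/
theorem exists_resolution : ∃ Z : ℕ → GrMod.{u, u} (Cher.deg D), Z 0 = (Cher.std D τ).shift γ ∧
    (∀ p, ∃ (f : Z (p + 1) ⟶ term τ γ D p) (g : term τ γ D p ⟶ Z p) (w : f ≫ g = 0),
      (ShortComplex.mk f g w).ShortExact) ∧ IsZero (Z (finrank ℂ h + 2)) := by
  obtain ⟨F, ⟨hF1, hF2⟩, -⟩ := Cher.exists_indIso_std D τ γ
  -- The homotopy is merely `ℂ`-linear. This suffices, because induction is `S(𝔥*) ⊗ -` on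
  -- underlying spaces and exactness concerns only those.
  obtain ⟨H, hH⟩ := exists_homotopy (h := h) (V := V)
  have ext : ∀ {N : Type u} [AddCommGroup N] [Module ℂ N] {S T : Kos h V →ₗ[ℂ] N} (hST : ∀ k, S k = T k)
      (x : Sy (Dual ℂ h) ⊗[ℂ] Kos h V),
      ((LinearMap.id : Sy (Dual ℂ h) →ₗ[ℂ] Sy (Dual ℂ h)) ⊠ S) x =
        ((LinearMap.id : Sy (Dual ℂ h) →ₗ[ℂ] Sy (Dual ℂ h)) ⊠ T) x := fun hST x => by
    rw [LinearMap.ext hST]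
  have comp : ∀ {N N' : Type u} [AddCommGroup N] [Module ℂ N] [AddCommGroup N'] [Module ℂ N']
      (S : N →ₗ[ℂ] N') (T : Kos h V →ₗ[ℂ] N) (x : Sy (Dual ℂ h) ⊗[ℂ] Kos h V),
      ((LinearMap.id : Sy (Dual ℂ h) →ₗ[ℂ] Sy (Dual ℂ h)) ⊠ S)
        (((LinearMap.id : Sy (Dual ℂ h) →ₗ[ℂ] Sy (Dual ℂ h)) ⊠ T) x) =
        ((LinearMap.id : Sy (Dual ℂ h) →ₗ[ℂ] Sy (Dual ℂ h)) ⊠ (S ∘ₗ T)) x := fun S T x => by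
    rw [← LinearMap.comp_apply, ← TensorProduct.map_comp, LinearMap.id_comp]
  have zero : ∀ {N : Type u} [AddCommGroup N] [Module ℂ N] {S : Kos h V →ₗ[ℂ] N} (hS : ∀ k, S k = 0)
      (x : Sy (Dual ℂ h) ⊗[ℂ] Kos h V),
      ((LinearMap.id : Sy (Dual ℂ h) →ₗ[ℂ] Sy (Dual ℂ h)) ⊠ S) x = 0 := fun hS x => by
    rw [show _ = (0 : _ →ₗ[ℂ] _) from LinearMap.ext hS, TensorProduct.map_zero_right]
    rfl
  refine ⟨GrMod.cycles (resProj τ γ D) (resDiff τ γ D) (resAug τ γ D ≫ F), rfl,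
    GrMod.cycles_shortExact _ _ _ (resProj_resProj τ γ D) (fun p x => ?_) (fun x => ?_) (fun p x => ?_)
      (fun x => ?_) (fun x => ?_) (fun x => ?_) (fun x => ?_) (fun x hd ha => ?_),
    -- `cycles` at index `p + 1` lies in the `p`-th term, which is zero for `p = dim 𝔥 + 1`; hence
    -- the bound `dim 𝔥 + 2`.
    GrMod.isZero_cycles _ _ _ (fun x => zero (proj_eq_zero (Nat.lt_succ_self _)) x)⟩
  · exact (comp _ _ x).trans ((ext (diff_proj_succ p) x).trans (comp _ _ x).symm)
  · exact (comp _ _ x).trans (zero diff_proj_zero x)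
  · refine (congrArg F.1 ?_).trans (map_zero F.1)
    exact (comp _ _ x).trans (zero (aug_proj_succ p) x)
  · refine congrArg F.1 ?_
    exact (comp _ _ x).trans (ext aug_proj_zero x)
  · exact (comp _ _ x).trans (zero diff_diff x)
  · refine (congrArg F.1 ?_).trans (map_zero F.1)
    exact (comp _ _ x).trans (zero aug_diff x)
  · obtain ⟨z, rfl⟩ := hF2 x
    refine ⟨((LinearMap.id : Sy (Dual ℂ h) →ₗ[ℂ] Sy (Dual ℂ h)) ⊠ sec) z, congrArg F.1 ?_⟩
    have e : ((LinearMap.id : Sy (Dual ℂ h) →ₗ[ℂ] Sy (Dual ℂ h)) ⊠ aug) ∘ₗ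
        ((LinearMap.id : Sy (Dual ℂ h) →ₗ[ℂ] Sy (Dual ℂ h)) ⊠ (sec : V →ₗ[ℂ] Kos h V)) = LinearMap.id := by
      rw [← TensorProduct.map_comp, LinearMap.id_comp,
        show aug ∘ₗ sec = LinearMap.id from LinearMap.ext aug_sec, TensorProduct.map_id]
    exact LinearMap.congr_fun e z
  · have ha' : ((LinearMap.id : Sy (Dual ℂ h) →ₗ[ℂ] Sy (Dual ℂ h)) ⊠ aug) x = 0 :=
      hF1 (ha.trans (map_zero F.1).symm)
    have hd' : ((LinearMap.id : Sy (Dual ℂ h) →ₗ[ℂ] Sy (Dual ℂ h)) ⊠ diff) x = 0 := hd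
    refine ⟨((LinearMap.id : Sy (Dual ℂ h) →ₗ[ℂ] Sy (Dual ℂ h)) ⊠ H) x, ?_⟩
    have e : ∀ x : Sy (Dual ℂ h) ⊗[ℂ] Kos h V,
        ((LinearMap.id : Sy (Dual ℂ h) →ₗ[ℂ] Sy (Dual ℂ h)) ⊠ diff) x = 0 →
        ((LinearMap.id : Sy (Dual ℂ h) →ₗ[ℂ] Sy (Dual ℂ h)) ⊠ aug) x = 0 →
        ((LinearMap.id : Sy (Dual ℂ h) →ₗ[ℂ] Sy (Dual ℂ h)) ⊠ diff)
          (((LinearMap.id : Sy (Dual ℂ h) →ₗ[ℂ] Sy (Dual ℂ h)) ⊠ H) x) = x := fun x hd ha => by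
      have e := ext (S := diff ∘ₗ H + H ∘ₗ diff + sec ∘ₗ aug) (T := LinearMap.id)
        (fun k => (congrArg (· + sec (aug k)) (hH k)).trans (sub_add_cancel _ _)) x
      rw [TensorProduct.map_add_right, TensorProduct.map_add_right, TensorProduct.map_id,
        LinearMap.add_apply, LinearMap.add_apply, ← comp, ← comp, ← comp, hd, ha, map_zero, map_zero,
        add_zero, add_zero] at e
      exact e
    exact e x hd' ha'

end Koszul

end KoszulResolution

/-! ### Morphisms out of the terms of the resolution. -/

section KoszulHom

open Module
local infixl:70 " ⊠ " => TensorProduct.map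

variable {h : Type u} [AddCommGroup h] [Module ℂ h] [FiniteDimensional ℂ h]
  {V : Type u} [AddCommGroup V] [Module ℂ V]

instance Cher.finiteDimensional_spin : FiniteDimensional ℂ (Cher.Spin h) := by
  have h1 : (⊤ : Submodule ℂ (Cher.Spin h)) = ⨆ p ∈ Finset.range (finrank ℂ h + 1), ⋀[ℂ]^p (Dual ℂ h) := by
    refine (eq_top_iff.2 fun ω _ => ?_).symm
    rw [← Cher.sum_spinProj ω]
    exact Submodule.sum_mem _ fun p hp => Submodule.mem_iSup_of_mem p
      (Submodule.mem_iSup_of_mem hp (Cher.spinProj_mem p ω))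
  have : ∀ p, FiniteDimensional ℂ (⋀[ℂ]^p (Dual ℂ h)) := fun p => inferInstance
  rw [FiniteDimensional, Module.finite_def, h1]
  exact Submodule.fg_biSup _ _ fun p _ => Module.Finite.iff_fg.1 (this p)

section Contraction

variable {Y : Type*} [AddCommGroup Y] [Module ℂ Y] {S : Type*} [AddCommGroup S] [Module ℂ S]

/-- The contraction of the second factor of a tensor product with a linear form. -/
noncomputable def contr : Dual ℂ S →ₗ[ℂ] Y ⊗[ℂ] S →ₗ[ℂ] Y where
  toFun u := (TensorProduct.rid ℂ Y).toLinearMap ∘ₗ (LinearMap.id ⊠ u)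
  map_add' u u' := by rw [TensorProduct.map_add_right, LinearMap.comp_add]
  map_smul' c u := by rw [TensorProduct.map_smul_right, LinearMap.comp_smul]; rfl

theorem contr_tmul (u : Dual ℂ S) (m : Y) (ω : S) : contr u (m ⊗ₜ[ℂ] ω) = u ω • m := rfl

theorem contr_map {Y' : Type*} [AddCommGroup Y'] [Module ℂ Y'] (u : Dual ℂ S) (A : Y →ₗ[ℂ] Y')
    (T : S →ₗ[ℂ] S) (z : Y ⊗[ℂ] S) : contr u ((A ⊠ T) z) = A (contr (u ∘ₗ T) z) := by
  induction z using TensorProduct.induction_on with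
  | zero => simp
  | add z z' H H' => simp only [map_add, H, H']
  | tmul m ω => rw [TensorProduct.map_tmul, contr_tmul, contr_tmul, map_smul]; rfl

theorem sum_contr_coord {ι : Type*} [Fintype ι] [DecidableEq ι] (b : Basis ι ℂ S) (z : Y ⊗[ℂ] S) :
    ∑ i, contr (b.coord i) z ⊗ₜ b i = z := by
  induction z using TensorProduct.induction_on with
  | zero => simp
  | add z z' H H' => simp only [map_add, TensorProduct.add_tmul, Finset.sum_add_distrib, H, H']
  | tmul m ω =>
    simp only [contr_tmul, TensorProduct.smul_tmul, ← TensorProduct.tmul_sum]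
    congr 1
    exact b.sum_repr ω

theorem contr_ext [FiniteDimensional ℂ S] {z z' : Y ⊗[ℂ] S} (H : ∀ u, contr u z = contr u z') : z = z' := by
  rw [← sum_contr_coord (finBasis ℂ S) z, ← sum_contr_coord (finBasis ℂ S) z']
  simp only [H]

end Contraction

namespace Koszul

open Cher

variable {G : Subgroup (h ≃ₗ[ℂ] h)} [Finite G] (τ : Representation ℂ G V) (γ : ℤ) (D : CherData G) (p : ℕ)

/-- The generators of the `p`-th term of the Koszul resolution. -/
noncomputable def gen : Gens h V →ₗ[ℂ] term τ γ D p :=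
  ((GrMod.toPart (resProj τ γ D p) (resProj_resProj τ γ D p)).1.restrictScalars ℂ) ∘ₗ
    (koszul τ γ).ins D ∘ₗ TensorProduct.mk ℂ (Sy h) (Gens h V) 1

theorem gen_coe (w : Gens h V) :
    (gen τ γ D p w).1 = (koszul τ γ).ins D (1 ⊗ₜ tr (spinProj h p) w) := rfl

theorem gen_gensRep (g : G) (w : Gens h V) :
    gen τ γ D p (gensRep τ g w) = Cher.g D g • gen τ γ D p w := by
  refine Subtype.ext ?_
  have := (koszul τ γ).g_smul_ins D g (1 ⊗ₜ tr (spinProj h p) w)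
  rw [koszul_rep_tmul, Sy.rep_one, ← gensRep_tr_spinProj] at this
  exact this.symm

theorem gen_tr_spinProj (w : Gens h V) : gen τ γ D p (tr (spinProj h p) w) = gen τ γ D p w := by
  refine Subtype.ext ?_
  rw [gen_coe, gen_coe]
  congr 1
  exact proj_proj p (1 ⊗ₜ w)

theorem gen_mem_deg (w : Gens h V) : gen τ γ D p w ∈ (term τ γ D p).deg (γ - p) := by
  change (koszul τ γ).ins D (1 ⊗ₜ tr (spinProj h p) w) ∈ ((koszul τ γ).ind D).deg (γ - p)
  refine ((koszul τ γ).mem_deg_ind D).2 ?_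
  have e : (koszul τ γ).eul (1 ⊗ₜ tr (spinProj h p) w) =
      ((γ - p : ℤ) : ℂ) • ((1 : Sy h) ⊗ₜ[ℂ] tr (spinProj h p) w) := by
    rw [koszul_eul, weight, LinearMap.add_apply, TensorProduct.map_tmul, TensorProduct.map_tmul, Sy.eul_one,
      tr_spinN_tr_spinProj, TensorProduct.zero_tmul, zero_add, Module.End.one_apply, TensorProduct.tmul_smul,
      Int.cast_sub, Int.cast_natCast]
    module
  exact ((koszul τ γ).indEul_one _).trans ((congrArg (TensorProduct.mk ℂ (Sy (Dual ℂ h)) (Kos h V) 1) e).trans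
    (map_smul _ _ _))

variable {τ γ D p}

/-- The term is a quotient of the induced Koszul module, which is generated from `1 ⊗ 1 ⊗ w` by
applying `𝔥` and then `𝔥*`. -/
theorem term_hom_ext {Y : GrMod.{u, u} (Cher.deg D)} {F F' : term τ γ D p ⟶ Y}
    (H : ∀ w, F.1 (gen τ γ D p w) = F'.1 (gen τ γ D p w)) : F = F' := by
  let π := GrMod.toPart (resProj τ γ D p) (resProj_resProj τ γ D p)
  let L : (koszul τ γ).ind D →ₗ[Cher D] Y := F.1 ∘ₗ π.1
  let L' : (koszul τ γ).ind D →ₗ[Cher D] Y := F'.1 ∘ₗ π.1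
  have key : ∀ k : Kos h V, L ((koszul τ γ).ins D k) = L' ((koszul τ γ).ins D k) := fun k => by
    induction k using Sy.tensor_induction with
    | one w => exact H w
    | add k k' hk hk' => rw [map_add, map_add, map_add, hk, hk']
    | mul η k hk =>
      have : (koszul τ γ).ins D ((Sy.mulι η ⊠ 1) k) =
        Cher.y D η • (koszul τ γ).ins D k := ((koszul τ γ).y_smul_ins D η k).symm
      rw [this, map_smul, map_smul, hk]
  have h2 := (koszul τ γ).ind_hom_ext D key
  refine GrMod.hom_ext fun x => ?_
  rw [← GrMod.toPart_coe (resProj τ γ D p) (resProj_resProj τ γ D p) x]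
  exact LinearMap.congr_fun h2 x.1

/-- The universal property of `H ⊗_{ℂG} (⋀^p 𝔥 ⊗ τ)`: `φ` is first extended along `S(𝔥)` to the
Koszul module, then by Frobenius reciprocity. Hypothesis `hp` says that `φ` sees only the `p`-th
exterior piece. -/
theorem exists_termHom {Y : GrMod.{u, u} (Cher.deg D)} (φ : Gens h V →ₗ[ℂ] Y)
    (hg : ∀ g w, φ (gensRep τ g w) = Cher.g D g • φ w) (hp : ∀ w, φ (tr (spinProj h p) w) = φ w)
    (hd : ∀ w, φ w ∈ Y.deg (γ - p)) : ∃ F : term τ γ D p ⟶ Y, ∀ w, F.1 (gen τ γ D p w) = φ w := by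
  obtain ⟨Ψ, hΨ⟩ := Sy.exists_lift (Cher.y D) fun η η' => by
    have := Cher.mk_rel (CherRel.y_comm (D := D) η η')
    rw [map_mul, map_mul] at this
    exact this
  let Φ : Kos h V →ₗ[ℂ] Y := TensorProduct.lift (((Algebra.lsmul ℂ ℂ Y).toLinearMap ∘ₗ Ψ.toLinearMap).compl₂ φ)
  have hΦ : ∀ f w, Φ (f ⊗ₜ w) = Ψ f • φ w := fun f w => rfl
  have hΦ1 : ∀ w, Φ (1 ⊗ₜ w) = φ w := fun w => by rw [hΦ, map_one, one_smul]
  have hy : ∀ η k, Φ ((koszul τ γ).y η k) = Cher.y D η • Φ k := fun η k => by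
    induction k using TensorProduct.induction_on with
    | zero => simp
    | add z z' h h' => simp only [map_add, h, h', smul_add]
    | tmul f n => rw [koszul_y_tmul, hΦ, hΦ, map_mul, hΨ, mul_smul]
  -- Seeing only the `p`-th piece, `φ` has exterior weight `p`, which matches the degree `γ - p` of
  -- its values.
  have hN : ∀ w, φ (tr (spinN h) w) = (p : ℂ) • φ w := fun w => by
    have e : (tr (spinProj h p) * tr (spinN h) : End ℂ (Gens h V)) = (p : ℂ) • tr (spinProj h p) := by
      rw [tr_mul, ← map_smul]
      exact congrArg tr (LinearMap.ext fun ω => spinN_spinProj p ω)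
    rw [← hp (tr (spinN h) w)]
    refine (congrArg φ (LinearMap.congr_fun e w)).trans ?_
    rw [LinearMap.smul_apply, map_smul, hp]
  obtain ⟨F, hF⟩ := (koszul τ γ).exists_indHom D Y Φ (fun g k => by
    induction k using Sy.tensor_induction with
    | one w => rw [koszul_rep_tmul, Sy.rep_one, hΦ1, hΦ1, hg]
    | add z z' h h' => simp only [map_add, h, h', smul_add]
    | mul η k h =>
      change Φ ((koszul τ γ).rep g ((koszul τ γ).y η k)) = Cher.g D g • Φ ((koszul τ γ).y η k)
      rw [(koszul τ γ).rep_y, hy, hy, h, smul_smul, smul_smul, Cher.g_mul_y]) hy (fun k => by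
    induction k using Sy.tensor_induction with
    | one w =>
      rw [koszul_eul, weight, LinearMap.add_apply, TensorProduct.map_tmul, TensorProduct.map_tmul,
        Sy.eul_one, TensorProduct.zero_tmul, zero_add, map_sub, map_smul, hΦ1, Module.End.one_apply, hΦ1, hN,
        Y.eul_of_mem (hd w), ← sub_smul]
      push_cast
      rfl
    | add z z' h h' => simp only [map_add, h, h']
    | mul η k h =>
      have e2 := Cher.eul_gen_smul Y (.y η) (Φ k)
      change Y.eul (Cher.y D η • Φ k) = Cher.y D η • Y.eul (Φ k) +
        ((-1 : ℤ) : ℂ) • Cher.y D η • Φ k at e2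
      change Φ ((koszul τ γ).eul ((koszul τ γ).y η k)) = Y.eul (Φ ((koszul τ γ).y η k))
      rw [(koszul τ γ).eul_y, map_sub, hy, hy, h, e2]
      push_cast
      rw [neg_smul, one_smul, sub_eq_add_neg])
  refine ⟨((koszul τ γ).ind D).subι (GrMod.fixedBy (resProj τ γ D p)) (GrMod.isHomogeneous_ker _) ≫ F, fun w => ?_⟩
  exact (hF _).trans ((hΦ1 _).trans (hp w))

/-- A morphism out of the term is a `G`-map on generators living in one degree, and such maps lift
along surjections by averaging over `G`. -/
theorem projective_term : Projective (term τ γ D p) where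
  factors {B C} f e _ := by
    have he := GrMod.epi_surjective e
    obtain ⟨ψ, h1, h2, h3⟩ := exists_equivariant_lift (ρA := gensRep τ) (ρB := Cher.rep B) (ρC := Cher.rep C)
      (e.1.restrictScalars ℂ) (fun g b => map_smul e.1 _ b) (B.deg (γ - p))
      (fun g b hb => by
        have := B.smul_mem (Cher.gen_mem_deg D (.g g)) hb
        rw [Cher.genDeg, zero_add] at this
        exact this)
      ((f.1.restrictScalars ℂ) ∘ₗ gen τ γ D p) (fun g w => by
        rw [LinearMap.comp_apply, gen_gensRep]
        exact map_smul f.1 _ _)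
      (fun w => by
        obtain ⟨b, hb⟩ := he (f.1 (gen τ γ D p w))
        refine ⟨B.proj (γ - p) b, gradedProj_mem _ _ _, ?_⟩
        change e.1 (B.proj (γ - p) b) = f.1 (gen τ γ D p w)
        rw [← GrMod.proj_hom, hb]
        exact gradedProj_same _ (f.2 _ _ (gen_mem_deg τ γ D p w)))
    -- The averaged lift need not factor through the `p`-th exterior piece; precomposing with the
    -- projection corrects this without changing its image under `e` on generators.
    obtain ⟨F, hF⟩ := exists_termHom (τ := τ) (γ := γ) (D := D) (p := p) (ψ ∘ₗ tr (spinProj h p))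
      (fun g w => by
        rw [LinearMap.comp_apply, gensRep_tr_spinProj, h1]; rfl)
      (fun w => by
        rw [LinearMap.comp_apply, LinearMap.comp_apply, ← Module.End.mul_apply, tr_mul]
        congr 2
        exact congrArg tr (LinearMap.ext fun ω => spinProj_spinProj p ω))
      (fun w => h2 _)
    refine ⟨F, term_hom_ext fun w => ?_⟩
    change e.1 (F.1 _) = _
    rw [hF]
    refine (h3 _).trans ?_
    rw [LinearMap.comp_apply, gen_tr_spinProj]
    rfl

section Hom

variable (τ γ p) (Y : GrMod.{u, u} (Cher.deg D))

/-- Equivariant maps from `τ` to `Y_{γ - p} ⊗ ⋀^p 𝔥*`. -/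
noncomputable def homBideg : Submodule ℂ (V →ₗ[ℂ] Y ⊗[ℂ] Spin h) where
  carrier := {f | (∀ g v, f (τ g v) = diracRep Y g (f v)) ∧
    (∀ v, ((1 : End ℂ Y) ⊠ spinProj h p) (f v) = f v) ∧
    ∀ v, (Y.eul ⊠ (1 : End ℂ (Spin h))) (f v) = ((γ - p : ℤ) : ℂ) • f v}
  add_mem' {f f'} hf hf' := ⟨fun g v => by simp only [LinearMap.add_apply, hf.1, hf'.1, map_add],
    fun v => by simp only [LinearMap.add_apply, hf.2.1, hf'.2.1, map_add],
    fun v => by simp only [LinearMap.add_apply, hf.2.2, hf'.2.2, map_add, smul_add]⟩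
  zero_mem' := ⟨fun g v => by simp, fun v => by simp, fun v => by simp⟩
  smul_mem' c f hf := ⟨fun g v => by simp only [LinearMap.smul_apply, hf.1, map_smul],
    fun v => by simp only [LinearMap.smul_apply, hf.2.1, map_smul],
    fun v => by simp only [LinearMap.smul_apply, hf.2.2, map_smul, smul_comm c]⟩

/-- The linear map from `V` to `Y ⊗ ⋀ 𝔥*` attached to a morphism from a term of the Koszul resolution. -/
noncomputable def ofTermHom : (term τ γ D p ⟶ Y) →ₗ[ℂ] V →ₗ[ℂ] Y ⊗[ℂ] Spin h where
  toFun F := ∑ i, (TensorProduct.mk ℂ Y (Spin h)).flip (finBasis ℂ (Spin h) i) ∘ₗ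
    (F.1.restrictScalars ℂ) ∘ₗ gen τ γ D p ∘ₗ
      TensorProduct.mk ℂ (Dual ℂ (Spin h)) V ((finBasis ℂ (Spin h)).coord i)
  map_add' F F' := by
    rw [← Finset.sum_add_distrib]
    refine Finset.sum_congr rfl fun i _ => LinearMap.ext fun v => ?_
    exact TensorProduct.add_tmul _ _ _
  map_smul' c F := by
    rw [Finset.smul_sum]
    refine Finset.sum_congr rfl fun i _ => LinearMap.ext fun v => ?_
    exact (TensorProduct.smul_tmul' _ _ _).symm

/-- Contraction undoes the expansion in the basis of `⋀ 𝔥*`. With `contr_ext`, conditions on maps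
into `Y ⊗ ⋀ 𝔥*` become conditions on generators. -/
theorem contr_ofTermHom (F : term τ γ D p ⟶ Y) (u : Dual ℂ (Spin h)) (v : V) :
    contr u (ofTermHom τ γ p Y F v) = F.1 (gen τ γ D p (u ⊗ₜ v)) := by
  have h1 : ofTermHom τ γ p Y F v = ∑ i, F.1 (gen τ γ D p ((finBasis ℂ (Spin h)).coord i ⊗ₜ v)) ⊗ₜ
      finBasis ℂ (Spin h) i := LinearMap.sum_apply _ _ _
  have h2 : ∑ i, u (finBasis ℂ (Spin h) i) • (finBasis ℂ (Spin h)).coord i = u :=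
    (finBasis ℂ (Spin h)).sum_dual_apply_smul_coord u
  have h3 : ∀ (c : ℂ) x, F.1 (c • x) = c • F.1 x := fun c x => LinearMap.map_smul_of_tower F.1 c x
  conv_rhs => rw [← h2, TensorProduct.sum_tmul, map_sum, map_sum]
  rw [h1, map_sum]
  refine Finset.sum_congr rfl fun i _ => ?_
  rw [contr_tmul, ← TensorProduct.smul_tmul', map_smul, h3]

theorem ofTermHom_injective : Function.Injective (ofTermHom τ γ p Y (D := D)) := fun F F' H => by
  refine term_hom_ext fun w => ?_
  induction w using TensorProduct.induction_on with
  | zero => rw [map_zero, map_zero, map_zero]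
  | add w w' h h' => rw [map_add, map_add, map_add, h, h']
  | tmul u v => rw [← contr_ofTermHom, ← contr_ofTermHom, H]

theorem contr_diracRep (u : Dual ℂ (Spin h)) (g : G) (z : Y ⊗[ℂ] Spin h) :
    contr u (diracRep Y g z) = Cher.g D g • contr (u ∘ₗ spinRep G g) z :=
  contr_map u (Cher.rep Y g) (spinRep G g) z

/-- By duality for the finite-dimensional space `⋀ 𝔥*`, the three conditions of `homBideg` translate
into the hypotheses of `exists_termHom`: equivariance, exterior degree `p`, values in degree `γ -
p`. -/
theorem range_ofTermHom : LinearMap.range (ofTermHom τ γ p Y (D := D)) = homBideg τ γ p Y := by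
  apply le_antisymm
  · rintro _ ⟨F, rfl⟩
    refine ⟨fun g v => contr_ext fun u => ?_, fun v => contr_ext fun u => ?_, fun v => contr_ext fun u => ?_⟩
    · have e : gensRep τ g ((u ∘ₗ spinRep G g) ⊗ₜ v) = u ⊗ₜ τ g v := by
        rw [gensRep_tmul]
        congr 1
        refine LinearMap.ext fun ω => congrArg u ?_
        rw [← Module.End.mul_apply, ← map_mul, mul_inv_cancel, map_one, Module.End.one_apply]
      rw [contr_diracRep, contr_ofTermHom, contr_ofTermHom, ← e, gen_gensRep, map_smul]
    · rw [contr_map, contr_ofTermHom, Module.End.one_apply, contr_ofTermHom]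
      exact congrArg F.1 (gen_tr_spinProj τ γ D p (u ⊗ₜ v))
    · rw [contr_map, map_smul, contr_ofTermHom]
      rw [contr_ofTermHom]
      exact Y.eul_of_mem (F.2 _ _ (gen_mem_deg τ γ D p (u ⊗ₜ v)))
  · rintro f ⟨h1, h2, h3⟩
    let φ : Gens h V →ₗ[ℂ] Y := TensorProduct.lift (contr.compl₂ f)
    have hφ : ∀ u v, φ (u ⊗ₜ v) = contr u (f v) := fun u v => rfl
    obtain ⟨F, hF⟩ := exists_termHom (τ := τ) (γ := γ) (D := D) (p := p) φ (fun g w => by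
      induction w using TensorProduct.induction_on with
      | zero => simp
      | add w w' h h' => simp only [map_add, h, h', smul_add]
      | tmul u v =>
        have e : (u ∘ₗ spinRep G g⁻¹) ∘ₗ spinRep G g = u := LinearMap.ext fun ω => congrArg u (by
          rw [← Module.End.mul_apply, ← map_mul, inv_mul_cancel, map_one, Module.End.one_apply])
        rw [gensRep_tmul, hφ, hφ, h1, contr_diracRep, e]) (fun w => by
      induction w using TensorProduct.induction_on with
      | zero => simp
      | add w w' h h' => simp only [map_add, h, h']
      | tmul u v =>
        rw [tr_tmul, hφ, hφ]
        conv_rhs => rw [← h2, contr_map]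
        rfl) (fun w => by
      rw [GrMod.mem_deg_iff]
      induction w using TensorProduct.induction_on with
      | zero => simp
      | add w w' h h' => simp only [map_add, h, h', smul_add]
      | tmul u v =>
        rw [hφ, ← map_smul, ← h3, contr_map]
        rfl)
    exact ⟨F, LinearMap.ext fun v => contr_ext fun u => by rw [contr_ofTermHom, hF, hφ]⟩

/-- Morphisms from a term of the Koszul resolution. -/
noncomputable def homEquiv : (term τ γ D p ⟶ Y) ≃ₗ[ℂ] homBideg τ γ p Y :=
  (LinearEquiv.ofInjective _ (ofTermHom_injective τ γ p Y)).trans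
    (LinearEquiv.ofEq _ _ (range_ofTermHom τ γ p Y))

/-- All such maps take values in the image of `Y_{γ-p} ⊗ ⋀ 𝔥*`. -/
theorem finiteDimensional_homBideg [FiniteDimensional ℂ V] (hY : FiniteDimensional ℂ (Y.deg (γ - p))) :
    FiniteDimensional ℂ (homBideg τ γ p Y) := by
  let R := LinearMap.range ((Y.deg (γ - p)).subtype ⊠ (LinearMap.id : Spin h →ₗ[ℂ] Spin h))
  have hR : ∀ f ∈ homBideg τ γ p Y, ∀ v, f v ∈ R := fun f hf v => by
    rw [← sum_contr_coord (finBasis ℂ (Spin h)) (f v)]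
    refine Submodule.sum_mem _ fun i _ => ?_
    have : contr ((finBasis ℂ (Spin h)).coord i) (f v) ∈ Y.deg (γ - p) := by
      rw [GrMod.mem_deg_iff, ← map_smul, ← hf.2.2, contr_map]
      rfl
    exact ⟨⟨_, this⟩ ⊗ₜ finBasis ℂ (Spin h) i, rfl⟩
  let ι : homBideg τ γ p Y →ₗ[ℂ] V →ₗ[ℂ] R :=
    { toFun f := f.1.codRestrict R (hR f.1 f.2)
      map_add' _ _ := rfl
      map_smul' _ _ := rfl }
  refine Module.Finite.of_injective ι fun f f' H => Subtype.ext (LinearMap.ext fun v => ?_)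
  exact congrArg Subtype.val (LinearMap.congr_fun H v)

end Hom

/-- The Euler characteristic of `Ext` from a standard module. -/
theorem hasExtEuler_std [FiniteDimensional ℂ V] (τ : Representation ℂ G V) (γ : ℤ)
    (Y : GrMod.{u, u} (Cher.deg D)) (hY : ∀ n, FiniteDimensional ℂ (Y.deg n)) :
    HasExtEuler.{u + 1} ((std D τ).shift γ) Y (finrank ℂ h + 2)
      (∑ p ∈ Finset.range (finrank ℂ h + 2), (-1) ^ p * (finrank ℂ (homBideg τ γ p Y) : ℤ)) := by
  obtain ⟨Z, h0, hS, hZ⟩ := exists_resolution τ γ D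
  rw [← h0]
  have := HasExtEuler.of_resolution.{u + 1} Y (finrank ℂ h + 2) Z (term τ γ D) hS (fun p => projective_term)
    (fun p => by
      have := finiteDimensional_homBideg τ γ p Y (hY _)
      exact Module.Finite.equiv (homEquiv τ γ p Y).symm) hZ
  simpa only [fun p => (homEquiv τ γ p Y).finrank_eq] using this

end Koszul

end KoszulHom

/-! ### Total degree and parity on `Y ⊗ S*`. -/

section DiracIndex

open Module
local infixl:70 " ⊠ " => TensorProduct.map

theorem gradedProj_comm {X : Type v} [AddCommGroup X] [Module ℂ X] {deg : ℤ → Submodule ℂ X}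
    (hX : DirectSum.IsInternal deg) {Y : Type v} [AddCommGroup Y] [Module ℂ Y] {deg' : ℤ → Submodule ℂ Y}
    (hY : DirectSum.IsInternal deg') (T : X →ₗ[ℂ] Y) (hT : ∀ n, ∀ x ∈ deg n, T x ∈ deg' n) (n : ℤ) (x : X) :
    T (gradedProj hX n x) = gradedProj hY n (T x) := by
  refine iSup_eq_top_induction (P := fun x => T (gradedProj hX n x) = gradedProj hY n (T x))
    (iSup_deg_eq_top hX) (fun k x hx => ?_) (fun x x' H H' => ?_) ?_ x
  · by_cases hk : n = k
    · subst hk; rw [gradedProj_same _ hx, gradedProj_same _ (hT _ _ hx)]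
    · rw [gradedProj_ne _ hk hx, gradedProj_ne _ hk (hT _ _ hx), map_zero]
  · simp only [map_add, H, H']
  · simp

variable {h : Type u} [AddCommGroup h] [Module ℂ h] [FiniteDimensional ℂ h]
  {V : Type u} [AddCommGroup V] [Module ℂ V] {G : Subgroup (h ≃ₗ[ℂ] h)} [Finite G] {D : CherData G}

namespace Cher

variable (Y : GrMod.{u, u} (Cher.deg D))

/-- The operator acting by `n` on the component of total degree `n`. -/
noncomputable def totalEul : End ℂ (Y ⊗[ℂ] Spin h) := Y.eul ⊠ 1 + 1 ⊠ spinN h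

theorem totalEul_tmul {n : ℤ} {p : ℕ} {m : Y} {ω : Spin h} (hm : m ∈ Y.deg n) (hω : ω ∈ ⋀[ℂ]^p (Dual ℂ h)) :
    totalEul Y (m ⊗ₜ ω) = ((n + p : ℤ) : ℂ) • (m ⊗ₜ[ℂ] ω) := by
  rw [totalEul, LinearMap.add_apply, TensorProduct.map_tmul, TensorProduct.map_tmul, Y.eul_of_mem hm,
    spinN_of_mem hω, TensorProduct.tmul_smul, ← TensorProduct.smul_tmul', Module.End.one_apply,
    Module.End.one_apply]
  push_cast
  module

theorem tensor_homogeneous_induction {P : Y ⊗[ℂ] Spin h → Prop}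
    (tmul : ∀ (n : ℤ) (p : ℕ), ∀ m ∈ Y.deg n, ∀ ω ∈ ⋀[ℂ]^p (Dual ℂ h), P (m ⊗ₜ ω))
    (add : ∀ z z', P z → P z' → P (z + z')) (zero : P 0) (z : Y ⊗[ℂ] Spin h) : P z := by
  induction z using TensorProduct.induction_on with
  | zero => exact zero
  | add z z' H H' => exact add _ _ H H'
  | tmul m ω =>
    refine iSup_eq_top_induction (P := fun m => P (m ⊗ₜ ω)) (iSup_deg_eq_top Y.isInternal)
      (fun n m hm => ?_) (fun m m' H H' => ?_) ?_ m
    · refine iSup_eq_top_induction (P := fun ω => P (m ⊗ₜ ω)) iSup_exteriorPower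
        (fun p ω hω => tmul n p m hm ω hω) (fun ω ω' H H' => ?_) ?_ ω
      · rw [TensorProduct.tmul_add]; exact add _ _ H H'
      · rwa [TensorProduct.tmul_zero]
    · rw [TensorProduct.add_tmul]; exact add _ _ H H'
    · rwa [TensorProduct.zero_tmul]

theorem tmul_mem_totalDeg {n : ℤ} {p : ℕ} {m : Y} {ω : Spin h} (hm : m ∈ Y.deg n)
    (hω : ω ∈ ⋀[ℂ]^p (Dual ℂ h)) : m ⊗ₜ ω ∈ totalDeg Y (n + p) :=
  Submodule.subset_span ⟨p, m, ω, by rwa [add_sub_cancel_right], hω, rfl⟩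

theorem iSup_totalDeg : ⨆ n, totalDeg Y n = ⊤ := by
  refine eq_top_iff.2 fun z _ => ?_
  induction z using tensor_homogeneous_induction with
  | tmul n p m hm ω hω => exact Submodule.mem_iSup_of_mem _ (tmul_mem_totalDeg Y hm hω)
  | add z z' H H' => exact Submodule.add_mem _ (H trivial) (H' trivial)
  | zero => exact Submodule.zero_mem _

theorem totalDeg_le (n : ℤ) : totalDeg Y n ≤ (totalEul Y).eigenspace (n : ℂ) := by
  rw [totalDeg, Submodule.span_le]
  rintro _ ⟨p, m, ω, hm, hω, rfl⟩
  refine End.mem_eigenspace_iff.2 ?_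
  rw [totalEul_tmul Y hm hω, sub_add_cancel]

theorem isInternal_eigenspace_totalEul :
    DirectSum.IsInternal fun n : ℤ => (totalEul Y).eigenspace (n : ℂ) := by
  refine IsGradingOp.isInternal ?_
  rw [IsGradingOp, eq_top_iff, ← iSup_totalDeg Y]
  exact iSup_mono (totalDeg_le Y)

/-- The spans lie in independent eigenspaces and together fill the space, so each fills its
eigenspace; total degree can then be tested with an operator. -/
theorem totalDeg_eq (n : ℤ) : totalDeg Y n = (totalEul Y).eigenspace (n : ℂ) :=
  eq_of_le_of_iSup_eq_top (isInternal_eigenspace_totalEul Y) (totalDeg_le Y) (iSup_totalDeg Y) n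

theorem mem_totalDeg {n : ℤ} {z : Y ⊗[ℂ] Spin h} :
    z ∈ totalDeg Y n ↔ totalEul Y z = (n : ℂ) • z := by
  rw [totalDeg_eq, End.mem_eigenspace_iff]

theorem isInternal_totalDeg : DirectSum.IsInternal (totalDeg Y) := by
  rw [show totalDeg Y = _ from funext (totalDeg_eq Y)]
  exact isInternal_eigenspace_totalEul Y

/-- The projection of `Y ⊗ ⋀ 𝔥*` onto `Y ⊗ ⋀^p 𝔥*`. -/
noncomputable def formProj (p : ℕ) : End ℂ (Y ⊗[ℂ] Spin h) := 1 ⊠ spinProj h p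

theorem formProj_tmul (p : ℕ) (m : Y) (ω : Spin h) : formProj Y p (m ⊗ₜ ω) = m ⊗ₜ spinProj h p ω := rfl

theorem formProj_formProj (p : ℕ) (z : Y ⊗[ℂ] Spin h) : formProj Y p (formProj Y p z) = formProj Y p z := by
  induction z using TensorProduct.induction_on with
  | zero => simp
  | add z z' H H' => simp only [map_add, H, H']
  | tmul m ω => rw [formProj_tmul, formProj_tmul, spinProj_spinProj]

theorem formProj_formProj_of_ne {p q : ℕ} (hpq : p ≠ q) (z : Y ⊗[ℂ] Spin h) :
    formProj Y p (formProj Y q z) = 0 := by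
  induction z using TensorProduct.induction_on with
  | zero => simp
  | add z z' H H' => simp only [map_add, H, H', add_zero]
  | tmul m ω =>
    rw [formProj_tmul, formProj_tmul, spinProj_of_mem_ne hpq.symm (spinProj_mem _ _), TensorProduct.tmul_zero]

theorem sum_formProj {N : ℕ} (hN : finrank ℂ h < N) (z : Y ⊗[ℂ] Spin h) :
    ∑ p ∈ Finset.range N, formProj Y p z = z := by
  induction z using TensorProduct.induction_on with
  | zero => simp
  | add z z' H H' => simp only [map_add, Finset.sum_add_distrib, H, H']
  | tmul m ω =>
    simp only [formProj_tmul, ← TensorProduct.tmul_sum]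
    congr 1
    rw [← Finset.sum_subset (Finset.range_subset_range.2 hN), sum_spinProj]
    exact fun p _ hp => spinProj_eq_zero (by simpa [Nat.lt_succ_iff] using hp) ω

theorem formProj_diracRep (p : ℕ) (g : G) (z : Y ⊗[ℂ] Spin h) :
    formProj Y p (diracRep Y g z) = diracRep Y g (formProj Y p z) := by
  induction z using TensorProduct.induction_on with
  | zero => simp
  | add z z' H H' => simp only [map_add, H, H']
  | tmul m ω =>
    change _ ⊗ₜ[ℂ] spinProj h p (spinRep G g ω) = _ ⊗ₜ[ℂ] spinRep G g (spinProj h p ω)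
    rw [spinProj_spinRep]
    rfl

theorem eul_formProj (p : ℕ) (z : Y ⊗[ℂ] Spin h) :
    (Y.eul ⊠ (1 : End ℂ (Spin h))) (formProj Y p z) = formProj Y p (totalEul Y z) - (p : ℂ) • formProj Y p z := by
  induction z using TensorProduct.induction_on with
  | zero => simp
  | add z z' H H' => simp only [map_add, H, H', smul_add]; abel
  | tmul m ω =>
    rw [totalEul, LinearMap.add_apply, TensorProduct.map_tmul, TensorProduct.map_tmul, map_add, formProj_tmul,
      formProj_tmul, formProj_tmul, TensorProduct.map_tmul, spinProj_spinN, TensorProduct.tmul_smul,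
      Module.End.one_apply, Module.End.one_apply, Module.End.one_apply, add_sub_cancel_right]

theorem totalEul_formProj (p : ℕ) (z : Y ⊗[ℂ] Spin h) :
    totalEul Y (formProj Y p z) = formProj Y p (totalEul Y z) := by
  have h1 : (1 ⊠ spinN h : End ℂ (Y ⊗[ℂ] Spin h)) (formProj Y p z) = (p : ℂ) • formProj Y p z := by
    induction z using TensorProduct.induction_on with
    | zero => simp
    | add z z' H H' => simp only [map_add, H, H', smul_add]
    | tmul m ω => rw [formProj_tmul, TensorProduct.map_tmul, spinN_spinProj, TensorProduct.tmul_smul]; rfl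
  rw [totalEul, LinearMap.add_apply, eul_formProj, h1]
  exact sub_add_cancel _ _

theorem formProj_mem_parityPart (p : ℕ) (z : Y ⊗[ℂ] Spin h) : formProj Y p z ∈ parityPart Y (p : ZMod 2) := by
  induction z using TensorProduct.induction_on with
  | zero => rw [map_zero]; exact Submodule.zero_mem _
  | add z z' H H' => rw [map_add]; exact Submodule.add_mem _ H H'
  | tmul m ω => exact Submodule.subset_span ⟨p, m, _, rfl, spinProj_mem p ω, rfl⟩

theorem formProj_eq_zero_of_mem_parityPart {ε : ZMod 2} {z : Y ⊗[ℂ] Spin h} (hz : z ∈ parityPart Y ε) {p : ℕ}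
    (hp : (p : ZMod 2) ≠ ε) : formProj Y p z = 0 := by
  induction hz using Submodule.span_induction with
  | mem _ hz =>
    obtain ⟨l, m, ω, hl, hω, rfl⟩ := hz
    rw [formProj_tmul, spinProj_of_mem_ne (by rintro rfl; exact hp hl) hω, TensorProduct.tmul_zero]
  | zero => rw [map_zero]
  | add _ _ _ _ h₁ h₂ => rw [map_add, h₁, h₂, add_zero]
  | smul c _ _ h => rw [map_smul, h, smul_zero]

theorem mem_parityPart_of_formProj {ε : ZMod 2} {z : Y ⊗[ℂ] Spin h}
    (H : ∀ p : ℕ, (p : ZMod 2) ≠ ε → formProj Y p z = 0) : z ∈ parityPart Y ε := by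
  rw [← sum_formProj Y (Nat.lt_succ_self _) z]
  refine Submodule.sum_mem _ fun p _ => ?_
  by_cases hp : (p : ZMod 2) = ε
  · rw [← hp]; exact formProj_mem_parityPart Y p z
  · rw [H p hp]; exact Submodule.zero_mem _

variable (τ : Representation ℂ G V) (γ : ℤ)

/-- Equivariant maps from `τ` to the component of total degree `γ` of `Y ⊗ S^±`. -/
noncomputable def homSpin (ε : ZMod 2) : Submodule ℂ (V →ₗ[ℂ] Y ⊗[ℂ] Spin h) where
  carrier := {f | (∀ g v, f (τ g v) = diracRep Y g (f v)) ∧ (∀ v, f v ∈ parityPart Y ε) ∧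
    ∀ v, f v ∈ totalDeg Y γ}
  add_mem' {f f'} hf hf' := ⟨fun g v => by simp only [LinearMap.add_apply, hf.1, hf'.1, map_add],
    fun v => Submodule.add_mem _ (hf.2.1 v) (hf'.2.1 v), fun v => Submodule.add_mem _ (hf.2.2 v) (hf'.2.2 v)⟩
  zero_mem' := ⟨fun g v => by simp, fun v => Submodule.zero_mem _, fun v => Submodule.zero_mem _⟩
  smul_mem' c f hf := ⟨fun g v => by simp only [LinearMap.smul_apply, hf.1, map_smul],
    fun v => Submodule.smul_mem _ c (hf.2.1 v), fun v => Submodule.smul_mem _ c (hf.2.2 v)⟩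

variable {Y τ γ} in
theorem formProj_comp_mem {ε : ZMod 2} {f : V →ₗ[ℂ] Y ⊗[ℂ] Spin h} (hf : f ∈ homSpin Y τ γ ε) (p : ℕ) :
    formProj Y p ∘ₗ f ∈ Koszul.homBideg τ γ p Y := by
  refine ⟨fun g v => ?_, fun v => formProj_formProj Y p (f v), fun v => ?_⟩
  · rw [LinearMap.comp_apply, hf.1, formProj_diracRep]; rfl
  · rw [LinearMap.comp_apply, eul_formProj, (mem_totalDeg Y).1 (hf.2.2 v), map_smul]
    push_cast
    module

variable {Y τ γ} in
theorem homBideg_le {p : ℕ} {f : V →ₗ[ℂ] Y ⊗[ℂ] Spin h} (hf : f ∈ Koszul.homBideg τ γ p Y) :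
    f ∈ homSpin Y τ γ (p : ZMod 2) := by
  refine ⟨hf.1, fun v => ?_, fun v => ?_⟩
  · rw [← hf.2.1 v]; exact formProj_mem_parityPart Y p (f v)
  · rw [mem_totalDeg]
    have h1 : formProj Y p (f v) = f v := hf.2.1 v
    have h2 := eul_formProj Y p (f v)
    rw [← totalEul_formProj, h1, hf.2.2 v] at h2
    rw [eq_sub_iff_add_eq] at h2
    rw [← h2]
    push_cast
    module

/-- The components of an equivariant map to `Y ⊗ S^±` in the exterior powers. -/
noncomputable def homSpinToPi (ε : ZMod 2) (N : ℕ) : homSpin Y τ γ ε →ₗ[ℂ]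
    ∀ p : {p : Fin N // ((p : ℕ) : ZMod 2) = ε}, Koszul.homBideg τ γ (p.1 : ℕ) Y :=
  LinearMap.pi fun p => LinearMap.codRestrict (Koszul.homBideg τ γ (p.1 : ℕ) Y)
    (LinearMap.compRight ℂ (formProj Y p.1) ∘ₗ (homSpin Y τ γ ε).subtype)
    (fun f => formProj_comp_mem f.2 p.1)

theorem homSpinToPi_apply (ε : ZMod 2) (N : ℕ) (f : homSpin Y τ γ ε)
    (p : {p : Fin N // ((p : ℕ) : ZMod 2) = ε}) (v : V) :
    (homSpinToPi Y τ γ ε N f p).1 v = formProj Y p.1 (f.1 v) := rfl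

theorem homSpinToPi_injective (ε : ZMod 2) {N : ℕ} (hN : finrank ℂ h < N) :
    Function.Injective (homSpinToPi Y τ γ ε N) := by
  intro f f' H
  refine Subtype.ext (LinearMap.ext fun v => ?_)
  rw [← sum_formProj Y hN (f.1 v), ← sum_formProj Y hN (f'.1 v)]
  refine Finset.sum_congr rfl fun p hp => ?_
  by_cases hpε : (p : ZMod 2) = ε
  · have h1 := homSpinToPi_apply Y τ γ ε N f ⟨⟨p, Finset.mem_range.1 hp⟩, hpε⟩ v
    rw [H, homSpinToPi_apply] at h1
    exact h1.symm
  · rw [formProj_eq_zero_of_mem_parityPart Y (f.2.2.1 v) hpε,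
      formProj_eq_zero_of_mem_parityPart Y (f'.2.2.1 v) hpε]

theorem homSpinToPi_surjective (ε : ZMod 2) (N : ℕ) :
    Function.Surjective (homSpinToPi Y τ γ ε N) := by
  intro F
  have hmem : ∑ q, (F q).1 ∈ homSpin Y τ γ ε := Submodule.sum_mem _ fun q _ => by
    have := homBideg_le (F q).2
    rwa [q.2] at this
  refine ⟨⟨∑ q, (F q).1, hmem⟩, funext fun p => Subtype.ext (LinearMap.ext fun v => ?_)⟩
  rw [homSpinToPi_apply, LinearMap.sum_apply, map_sum, Finset.sum_eq_single p]
  · exact (F p).2.2.1 v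
  · intro q _ hq
    have h1 : formProj Y q.1 ((F q).1 v) = (F q).1 v := (F q).2.2.1 v
    rw [← h1, formProj_formProj_of_ne]
    intro e
    exact hq (Subtype.ext (Fin.ext e.symm))
  · intro hp; exact absurd (Finset.mem_univ p) hp

/-- The decomposition of equivariant maps to `Y ⊗ S^±` according to the degree in `S^±`. -/
noncomputable def homSpinEquiv (ε : ZMod 2) {N : ℕ} (hN : finrank ℂ h < N) : homSpin Y τ γ ε ≃ₗ[ℂ]
    ∀ p : {p : Fin N // ((p : ℕ) : ZMod 2) = ε}, Koszul.homBideg τ γ (p.1 : ℕ) Y :=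
  LinearEquiv.ofBijective (homSpinToPi Y τ γ ε N)
    ⟨homSpinToPi_injective Y τ γ ε hN, homSpinToPi_surjective Y τ γ ε N⟩

/-- Maps into total degree `γ` split by exterior degree `p`, even `p` forming one parity and odd `p`
the other, so the signs `(-1)^p` produce the difference. Any range of `p` reaching past `dim 𝔥`
would do. -/
theorem finrank_homSpin [FiniteDimensional ℂ V] (hY : ∀ n, FiniteDimensional ℂ (Y.deg n)) :
    (∀ ε, FiniteDimensional ℂ (homSpin Y τ γ ε)) ∧
    ∑ p ∈ Finset.range (finrank ℂ h + 2), (-1) ^ p * (finrank ℂ (Koszul.homBideg τ γ p Y) : ℤ) =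
      finrank ℂ (homSpin Y τ γ 0) - finrank ℂ (homSpin Y τ γ 1) := by
  have hN : finrank ℂ h < finrank ℂ h + 2 := by omega
  have hfin : ∀ p, FiniteDimensional ℂ (Koszul.homBideg τ γ p Y) := fun p =>
    Koszul.finiteDimensional_homBideg τ γ p Y (hY _)
  refine ⟨fun ε => Module.Finite.equiv (homSpinEquiv Y τ γ ε hN).symm, ?_⟩
  have hε : ∀ ε, finrank ℂ (homSpin Y τ γ ε) = ∑ p ∈ Finset.range (finrank ℂ h + 2),
      if (p : ZMod 2) = ε then finrank ℂ (Koszul.homBideg τ γ p Y) else 0 := fun ε => by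
    have hfree : ∀ p : {p : Fin (finrank ℂ h + 2) // ((p : ℕ) : ZMod 2) = ε},
        Module.Free ℂ (Koszul.homBideg τ γ (p.1 : ℕ) Y) := fun p =>
      @Module.Free.of_divisionRing ℂ (Koszul.homBideg τ γ (p.1 : ℕ) Y) _ (Submodule.addCommGroup _) _
    rw [(homSpinEquiv Y τ γ ε hN).finrank_eq, Module.finrank_pi_fintype, Finset.sum_range,
      ← Finset.sum_filter, ← Finset.sum_subtype_eq_sum_filter]
    exact Finset.sum_congr (by ext; simp) fun _ _ => rfl
  rw [hε, hε, Nat.cast_sum, Nat.cast_sum, ← Finset.sum_sub_distrib]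
  refine Finset.sum_congr rfl fun p _ => ?_
  rcases Nat.even_or_odd p with hp | hp
  · have : (p : ZMod 2) = 0 := (ZMod.natCast_eq_zero_iff_even).2 hp
    simp [this, hp.neg_one_pow]
  · have : (p : ZMod 2) = 1 := (ZMod.natCast_eq_one_iff_odd).2 hp
    simp [this, hp.neg_one_pow]

end Cher

end DiracIndex

/-! ### Multiplicities in Dirac cohomology as Euler characteristics. -/

section DiracIndexFormula

open Module
local infixl:70 " ⊠ " => TensorProduct.map

section SemiLinearAlgebra

variable {M N : Type*} [AddCommMonoid M] [Module ℂ M] [AddCommMonoid N] [Module ℂ N]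

/-! Rank–nullity and monotonicity of dimensions, for additive groups that are only given as additive
monoids. -/

theorem finrank_range_add_finrank_ker_complex [Module.Finite ℂ M] (F : M →ₗ[ℂ] N) :
    finrank ℂ (LinearMap.range F) + finrank ℂ (LinearMap.ker F) = finrank ℂ M := by
  let := Module.addCommMonoidToAddCommGroup ℂ (M := M)
  let := Module.addCommMonoidToAddCommGroup ℂ (M := N)
  exact LinearMap.finrank_range_add_finrank_ker F

theorem finite_of_le_complex {S T : Submodule ℂ M} (hST : S ≤ T) [Module.Finite ℂ T] : Module.Finite ℂ S := by
  let := Module.addCommMonoidToAddCommGroup ℂ (M := M)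
  exact Module.Finite.of_injective (Submodule.inclusion hST) (Submodule.inclusion_injective hST)

theorem finrank_le_of_le_complex {S T : Submodule ℂ M} (hST : S ≤ T) [Module.Finite ℂ T] :
    finrank ℂ S ≤ finrank ℂ T := by
  let := Module.addCommMonoidToAddCommGroup ℂ (M := M)
  exact LinearMap.finrank_le_finrank_of_injective (f := Submodule.inclusion hST) (Submodule.inclusion_injective hST)

theorem finrank_eq_inf_ker_add_map (S : Submodule ℂ M) [Module.Finite ℂ S] (T : M →ₗ[ℂ] N) :
    finrank ℂ S = finrank ℂ ↥(S ⊓ LinearMap.ker T) + finrank ℂ (S.map T) := by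
  have h1 := finrank_range_add_finrank_ker_complex (T.domRestrict S)
  have h3 : LinearMap.ker (T.domRestrict S) = (S ⊓ LinearMap.ker T).comap S.subtype := by
    ext f
    exact ⟨fun hf => ⟨f.2, hf⟩, fun hf => hf.2⟩
  rw [LinearMap.range_domRestrict, h3, (Submodule.comapSubtypeEquivOfLe inf_le_left).finrank_eq] at h1
  omega

end SemiLinearAlgebra

variable {h : Type u} [AddCommGroup h] [Module ℂ h] [FiniteDimensional ℂ h]
  {V : Type u} [AddCommGroup V] [Module ℂ V] {G : Subgroup (h ≃ₗ[ℂ] h)} [Finite G] {D : CherData G}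

namespace Cher

/-- `spinY` lowers the eigenvalue of `spinN` by one, so the component in degree `q` has to vanish
unless `q = p - 1`. Stating it with `q + 1` avoids natural subtraction. -/
theorem spinProj_spinY_eq_zero (η : h) {p q : ℕ} (hpq : q + 1 ≠ p) {ω : Spin h}
    (hω : ω ∈ ⋀[ℂ]^p (Dual ℂ h)) : spinProj h q (spinY η ω) = 0 := by
  have h1 := spinProj_spinN q (spinY η ω)
  rw [spinN_spinY, spinN_of_mem hω, map_smul, map_sub, map_smul] at h1
  have h2 : ((q : ℂ) + 1 - p) • spinProj h q (spinY η ω) = 0 := by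
    rw [sub_smul, add_smul, ← h1, one_smul]
    exact sub_eq_zero.2 (sub_add_cancel _ _)
  refine (smul_eq_zero.1 h2).resolve_left fun h3 => hpq ?_
  exact_mod_cast sub_eq_zero.1 h3

variable (Y : GrMod.{u, u} (Cher.deg D))

theorem dirac_apply_tmul (m : Y) (ω : Spin h) : dirac Y (m ⊗ₜ ω) =
    ∑ j, ((x D ((finBasis ℂ h).coord j) • m) ⊗ₜ spinY (finBasis ℂ h j) ω +
      (y D (finBasis ℂ h j) • m) ⊗ₜ spinX ((finBasis ℂ h).coord j) ω) := by
  rw [dirac, LinearMap.sum_apply]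
  rfl

theorem dirac_mem_parityPart {ε : ZMod 2} {z : Y ⊗[ℂ] Spin h} (hz : z ∈ parityPart Y ε) :
    dirac Y z ∈ parityPart Y (ε + 1) := by
  induction hz using Submodule.span_induction with
  | mem _ hz =>
    obtain ⟨p, m, ω, rfl, hω, rfl⟩ := hz
    rw [dirac_apply_tmul]
    refine Submodule.sum_mem _ fun j _ => Submodule.add_mem _ ?_ ?_
    · refine mem_parityPart_of_formProj Y fun q hq => ?_
      rw [formProj_tmul, spinProj_spinY_eq_zero _ _ hω, TensorProduct.tmul_zero]
      rintro rfl
      refine hq ?_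
      push_cast
      rw [add_assoc, CharTwo.add_self_eq_zero, add_zero]
    · exact Submodule.subset_span ⟨p + 1, _, _, by push_cast; rfl, spinX_mem _ hω, rfl⟩
  | zero => rw [map_zero]; exact Submodule.zero_mem _
  | add _ _ _ _ h₁ h₂ => rw [map_add]; exact Submodule.add_mem _ h₁ h₂
  | smul c _ _ h => rw [map_smul]; exact Submodule.smul_mem _ _ h

theorem totalEul_dirac (z : Y ⊗[ℂ] Spin h) : totalEul Y (dirac Y z) = dirac Y (totalEul Y z) := by
  induction z using tensor_homogeneous_induction with
  | tmul n p m hm ω hω =>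
    rw [totalEul_tmul Y hm hω, map_smul, dirac_apply_tmul, map_sum, Finset.smul_sum]
    refine Finset.sum_congr rfl fun j _ => ?_
    rw [map_add, smul_add]
    congr 1
    · have h1 : Y.eul (x D ((finBasis ℂ h).coord j) • m) = ((1 + n : ℤ) : ℂ) • (x D ((finBasis ℂ h).coord j) • m) :=
        Y.eul_of_mem (Y.smul_mem (gen_mem_deg D (.x _)) hm)
      rw [totalEul, LinearMap.add_apply, TensorProduct.map_tmul, TensorProduct.map_tmul, h1, spinN_spinY,
        spinN_of_mem hω, LinearMap.map_smul, TensorProduct.tmul_sub, TensorProduct.tmul_smul, ← TensorProduct.smul_tmul',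
        Module.End.one_apply, Module.End.one_apply]
      push_cast
      module
    · have h1 : Y.eul (y D (finBasis ℂ h j) • m) = ((-1 + n : ℤ) : ℂ) • (y D (finBasis ℂ h j) • m) :=
        Y.eul_of_mem (Y.smul_mem (gen_mem_deg D (.y _)) hm)
      rw [totalEul, LinearMap.add_apply, TensorProduct.map_tmul, TensorProduct.map_tmul, h1, spinN_spinX,
        spinN_of_mem hω, LinearMap.map_smul, TensorProduct.tmul_add, TensorProduct.tmul_smul, ← TensorProduct.smul_tmul',
        Module.End.one_apply, Module.End.one_apply]
      push_cast
      module
  | add z z' H H' => simp only [map_add, H, H']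
  | zero => simp

theorem dirac_mem_totalDeg {n : ℤ} {z : Y ⊗[ℂ] Spin h} (hz : z ∈ totalDeg Y n) :
    dirac Y z ∈ totalDeg Y n := by
  rw [mem_totalDeg] at hz ⊢
  rw [totalEul_dirac, hz, map_smul]

theorem gradedProj_mem_parityPart {ε : ZMod 2} {z : Y ⊗[ℂ] Spin h} (hz : z ∈ parityPart Y ε) (n : ℤ) :
    gradedProj (isInternal_totalDeg Y) n z ∈ parityPart Y ε := by
  refine mem_parityPart_of_formProj Y fun p hp => ?_
  rw [gradedProj_comm (isInternal_totalDeg Y) (isInternal_totalDeg Y) (formProj Y p) (fun k w hw => ?_),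
    formProj_eq_zero_of_mem_parityPart Y hz hp, map_zero]
  rw [mem_totalDeg] at hw ⊢
  rw [totalEul_formProj, hw, map_smul]

theorem diracRep_mem_totalDeg {n : ℤ} (g : G) {z : Y ⊗[ℂ] Spin h} (hz : z ∈ totalDeg Y n) :
    diracRep Y g z ∈ totalDeg Y n := by
  induction hz using Submodule.span_induction with
  | mem _ hz =>
    obtain ⟨p, m, ω, hm, hω, rfl⟩ := hz
    refine Submodule.subset_span ⟨p, rep Y g m, spinRep G g ω, ?_, spinRep_mem g hω, rfl⟩
    have := Y.smul_mem (gen_mem_deg D (.g g)) hm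
    rwa [genDeg, zero_add] at this
  | zero => rw [map_zero]; exact Submodule.zero_mem _
  | add _ _ _ _ h₁ h₂ => rw [map_add]; exact Submodule.add_mem _ h₁ h₂
  | smul c _ _ h => rw [map_smul]; exact Submodule.smul_mem _ _ h

variable (τ : Representation ℂ G V) (γ : ℤ)

variable {Y τ γ} in
theorem dirac_comp_mem {ε : ZMod 2} {f : V →ₗ[ℂ] Y ⊗[ℂ] Spin h} (hf : f ∈ homSpin Y τ γ ε) :
    dirac Y ∘ₗ f ∈ homSpin Y τ γ (ε + 1) :=
  ⟨fun g v => by rw [LinearMap.comp_apply, hf.1, ← diracRep_comp_dirac]; rfl,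
    fun v => dirac_mem_parityPart Y (hf.2.1 v), fun v => dirac_mem_totalDeg Y (hf.2.2 v)⟩

/-- Equivariant maps with values in the kernel of the Dirac operator. -/
noncomputable def homKer (ε : ZMod 2) : Submodule ℂ (V →ₗ[ℂ] Y ⊗[ℂ] Spin h) :=
  homSpin Y τ γ ε ⊓ LinearMap.ker (LinearMap.compRight ℂ (dirac Y))

/-- Compositions of equivariant maps with the Dirac operator. -/
noncomputable def homIm (ε : ZMod 2) : Submodule ℂ (V →ₗ[ℂ] Y ⊗[ℂ] Spin h) :=
  (homSpin Y τ γ (ε + 1)).map (LinearMap.compRight ℂ (dirac Y))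

variable {Y τ γ} in
theorem mem_diracKer {ε : ZMod 2} {f : V →ₗ[ℂ] Y ⊗[ℂ] Spin h} (hf : f ∈ homKer Y τ γ ε) (v : V) :
    f v ∈ diracKer Y ε :=
  ⟨LinearMap.congr_fun hf.2 v, hf.1.2.1 v⟩

/-- The map to Dirac cohomology. -/
noncomputable def homKerToCoh (ε : ZMod 2) : homKer Y τ γ ε →ₗ[ℂ] V →ₗ[ℂ] DiracCoh Y ε where
  toFun f := Submodule.mkQ _ ∘ₗ f.1.codRestrict (diracKer Y ε) (mem_diracKer f.2)
  map_add' f f' := rfl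
  map_smul' c f := rfl

/-- `Hom_G(τ, -)` is exact for finite `G`: maps into cohomology lift equivariantly, and in the
prescribed degree, to the kernel. -/
theorem range_homKerToCoh (ε : ZMod 2) :
    LinearMap.range (homKerToCoh Y τ γ ε) = homDiracCoh Y τ ε γ := by
  apply le_antisymm
  · rintro _ ⟨f, rfl⟩
    refine ⟨fun g v => ?_, fun v => ⟨⟨f.1 v, mem_diracKer f.2 v⟩, f.2.1.2.2 v, rfl⟩⟩
    change Submodule.mkQ _ (⟨f.1 (τ g v), _⟩ : diracKer Y ε) = Submodule.mkQ _ (diracKerRep Y ε g ⟨f.1 v, _⟩)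
    congr 1
    exact Subtype.ext (f.2.1.1 g v)
  · intro φ hφ
    obtain ⟨ψ, h1, h2, h3⟩ := exists_equivariant_lift (ρA := τ) (ρB := diracKerRep Y ε)
      (ρC := diracCohRep Y ε) (Submodule.mkQ _) (fun g b => rfl)
      ((totalDeg Y γ).submoduleOf (diracKer Y ε))
      (fun g b hb => diracRep_mem_totalDeg Y g hb) φ hφ.1 hφ.2
    refine ⟨⟨(diracKer Y ε).subtype ∘ₗ ψ, ⟨fun g v => ?_, fun v => (ψ v).2.2, fun v => h2 v⟩,
      LinearMap.ext fun v => (ψ v).2.1⟩, LinearMap.ext fun v => h3 v⟩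
    change ((ψ (τ g v) : diracKer Y ε) : Y ⊗[ℂ] Spin h) = _
    rw [h1]
    rfl

theorem ker_homKerToCoh (ε : ZMod 2) :
    LinearMap.ker (homKerToCoh Y τ γ ε) = (homIm Y τ γ ε).comap (homKer Y τ γ ε).subtype := by
  ext f
  constructor
  · intro hf
    -- A preimage under `D` may be replaced by its component of degree `γ`, since `D` preserves
    -- degree; these pointwise preimages are then assembled equivariantly.
    have hf' : ∀ v, f.1 v ∈ (parityPart Y (ε + 1) ⊓ totalDeg Y γ).map (dirac Y) := fun v => by
      have h1 := (Submodule.Quotient.mk_eq_zero _).1 (LinearMap.congr_fun hf v)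
      obtain ⟨-, w, hw, hwv⟩ := h1
      refine ⟨gradedProj (isInternal_totalDeg Y) γ w,
        ⟨gradedProj_mem_parityPart Y hw γ, gradedProj_mem _ _ _⟩, ?_⟩
      rw [gradedProj_comm (isInternal_totalDeg Y) (isInternal_totalDeg Y) (dirac Y)
        (fun n z hz => dirac_mem_totalDeg Y hz), hwv]
      exact gradedProj_same _ (f.2.1.2.2 v)
    obtain ⟨ψ, h1, h2, h3⟩ := exists_equivariant_lift (ρA := τ) (ρB := diracRep Y) (ρC := diracRep Y)
      (dirac Y) (fun g b => (diracRep_comp_dirac Y g b).symm) (parityPart Y (ε + 1) ⊓ totalDeg Y γ)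
      (fun g b hb => ⟨diracRep_mem_parityPart Y _ g b hb.1, diracRep_mem_totalDeg Y g hb.2⟩) f.1 f.2.1.1 hf'
    exact ⟨ψ, ⟨h1, fun v => (h2 v).1, fun v => (h2 v).2⟩, LinearMap.ext h3⟩
  · rintro ⟨ψ, hψ, hf⟩
    refine LinearMap.ext fun v => (Submodule.Quotient.mk_eq_zero _).2 ⟨mem_diracKer f.2 v, ψ v, hψ.2.1 v, ?_⟩
    exact LinearMap.congr_fun hf v

theorem finrank_homSpin_eq_add [hW : ∀ ε, FiniteDimensional ℂ (homSpin Y τ γ ε)] (ε : ZMod 2) :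
    finrank ℂ (homSpin Y τ γ ε) = finrank ℂ (homKer Y τ γ ε) + finrank ℂ (homIm Y τ γ (ε + 1)) := by
  have h1 := finrank_eq_inf_ker_add_map (homSpin Y τ γ ε) (LinearMap.compRight ℂ (dirac Y))
  rw [h1, homIm, add_assoc, CharTwo.add_self_eq_zero, add_zero, homKer]

/-- If the square of the Dirac operator is scalar on an isotypic component, the multiplicity in the Dirac
index is the Euler characteristic. -/
theorem diracIndexMult_eq (hW : ∀ ε, FiniteDimensional ℂ (homSpin Y τ γ ε)) (κ : ℂ)
    (hκ : ∀ ε, ∀ f ∈ homSpin Y τ γ ε, ∀ v, dirac Y (dirac Y (f v)) = κ • f v) :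
    diracIndexMult Y τ γ = finrank ℂ (homSpin Y τ γ 0) - finrank ℂ (homSpin Y τ γ 1) := by
  have hK : ∀ ε, FiniteDimensional ℂ (homKer Y τ γ ε) := fun ε =>
    finite_of_le_complex (T := homSpin Y τ γ ε) inf_le_left
  have hle : ∀ ε, homIm Y τ γ ε ≤ homSpin Y τ γ ε := fun ε => by
    rintro _ ⟨f, hf, rfl⟩
    have := dirac_comp_mem hf
    rwa [add_assoc, CharTwo.add_self_eq_zero, add_zero] at this
  have hsum : ∀ ε, finrank ℂ (homDiracCoh Y τ ε γ) +
      finrank ℂ ((homIm Y τ γ ε).comap (homKer Y τ γ ε).subtype) = finrank ℂ (homKer Y τ γ ε) := fun ε => by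
    have := finrank_range_add_finrank_ker_complex (homKerToCoh Y τ γ ε)
    rwa [range_homKerToCoh, ker_homKerToCoh] at this
  have h0 := finrank_homSpin_eq_add Y τ γ 0
  have h1 := finrank_homSpin_eq_add Y τ γ 1
  have h2 := hsum 0
  have h3 := hsum 1
  have e2 : (1 + 1 : ZMod 2) = 0 := CharTwo.add_self_eq_zero 1
  rw [zero_add] at h0
  rw [e2] at h1
  rw [diracIndexMult]
  -- If `κ = 0`, then `D` squares to zero on these spaces, and this is the Euler characteristic of a
  -- two-periodic complex. If `κ ≠ 0`, then `D` embeds each parity in the other, so the dimensions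
  -- agree and the cohomology vanishes.
  by_cases hk : κ = 0
  · have hB : ∀ ε, homIm Y τ γ ε ≤ homKer Y τ γ ε := fun ε => by
      refine fun f hf => ⟨hle ε hf, ?_⟩
      obtain ⟨f, hf, rfl⟩ := hf
      refine LinearMap.ext fun v => ?_
      refine (hκ _ f hf v).trans ?_
      rw [hk, zero_smul]; rfl
    rw [(Submodule.comapSubtypeEquivOfLe (hB _)).finrank_eq] at h2 h3
    omega
  · have hK0 : ∀ ε, finrank ℂ (homKer Y τ γ ε) = 0 := fun ε => by
      rw [show homKer Y τ γ ε = ⊥ from ?_, finrank_bot]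
      refine eq_bot_iff.2 fun f hf => LinearMap.ext fun v => ?_
      have h5 := hκ ε f hf.1 v
      have h6 : dirac Y (f v) = 0 := LinearMap.congr_fun hf.2 v
      rw [h6, map_zero] at h5
      exact (smul_eq_zero.1 h5.symm).resolve_left hk
    have hle' : ∀ ε, finrank ℂ (homIm Y τ γ ε) ≤ finrank ℂ (homSpin Y τ γ ε) := fun ε =>
      finrank_le_of_le_complex (hle ε)
    have := hK0 0
    have := hK0 1
    have := hle' 0
    have := hle' 1
    omega

end Cher

end DiracIndexFormula

/-! ### The square of the Dirac operator. -/

section DiracSquare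

open Module
local infixl:70 " ⊠ " => TensorProduct.map

variable {h : Type u} [AddCommGroup h] [Module ℂ h] [FiniteDimensional ℂ h]
  {V : Type u} [AddCommGroup V] [Module ℂ V] {G : Subgroup (h ≃ₗ[ℂ] h)} [Finite G]

namespace Cher

section reflSum

variable (D : CherData G) {M N : Type*} [AddCommMonoid M] [Module ℂ M] [AddCommMonoid N] [Module ℂ N]

/-- The action of the central element `∑ₛ c(s) κ(s)⁻¹ s` of the group algebra. -/
noncomputable def reflSum (ρ : Representation ℂ G M) : End ℂ M :=
  ∑ s : Refl G, (D.c s / D.roots.κ s) • ρ s.1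

theorem reflSum_apply (ρ : Representation ℂ G M) (m : M) :
    reflSum D ρ m = ∑ s : Refl G, (D.c s / D.roots.κ s) • ρ s.1 m := by
  rw [reflSum, LinearMap.sum_apply]
  rfl

theorem map_reflSum (ρ : Representation ℂ G M) (ρ' : Representation ℂ G N) (f : M →ₗ[ℂ] N)
    (hf : ∀ g m, f (ρ g m) = ρ' g (f m)) (m : M) : f (reflSum D ρ m) = reflSum D ρ' (f m) := by
  simp only [reflSum_apply, map_sum, map_smul, hf]

theorem reflSum_comm (ρ : Representation ℂ G M) (g : G) (m : M) :
    reflSum D ρ (ρ g m) = ρ g (reflSum D ρ m) := by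
  rw [reflSum_apply, reflSum_apply, map_sum, ← Equiv.sum_comp (Refl.conj g)]
  refine Finset.sum_congr rfl fun s _ => ?_
  rw [D.c_conj, D.roots.κ_conj, map_smul, ← Module.End.mul_apply, ← map_mul, ← Module.End.mul_apply, ← map_mul]
  congr 3
  simp [Refl.conj]

end reflSum

/-- Schur's lemma; the sum is central because `c` and `κ` are invariant under conjugation. -/
theorem exists_reflSum_eq_smul (D : CherData G) [FiniteDimensional ℂ V] (τ : Representation ℂ G V)
    (hτ : τ.IsIrreducible) : ∃ z : ℂ, ∀ v, reflSum D τ v = z • v := by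
  obtain ⟨z, hz⟩ := (Representation.IsIrreducible.algebraMap_intertwiningMap_bijective_of_isAlgClosed
    (ρ := τ)).2 (LinearMap.intertwiningMap_of_isIntertwiningMap τ τ (reflSum D τ) (reflSum_comm D τ))
  exact ⟨z, fun v => (congrArg (fun f => f v) hz).symm⟩

variable {D : CherData G} (Y : GrMod.{u, u} (Cher.deg D))

theorem x_mul_x_comm (ξ ξ' : Dual ℂ h) : x D ξ * x D ξ' = x D ξ' * x D ξ :=
  (map_mul (mk D) _ _).symm.trans ((mk_rel (.x_comm _ _)).trans (map_mul _ _ _))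

theorem y_mul_y_comm (η η' : h) : y D η * y D η' = y D η' * y D η :=
  (map_mul (mk D) _ _).symm.trans ((mk_rel (.y_comm _ _)).trans (map_mul _ _ _))

theorem y_smul_x_smul_sub (η : h) (ξ : Dual ℂ h) (m : Y) : y D η • x D ξ • m - x D ξ • y D η • m =
    (D.t * ξ η) • m - ∑ s : Refl G, (D.c s * D.roots.α s η * ξ (D.roots.αv s)) • rep Y s.1 m := by
  have := congrArg (fun a => act Y a m) (y_mul_x D η ξ)
  rw [Algebra.algebraMap_eq_smul_one] at this
  simp only [map_sub, map_mul (act Y), map_sum, map_smul, map_one] at this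
  refine this.trans ?_
  rw [LinearMap.sub_apply, LinearMap.sum_apply]
  rfl

/-- The Euler element `∑ⱼ xⱼ yⱼ - ∑ₛ c(s) κ(s)⁻¹ s`. -/
noncomputable def eulerOp : End ℂ Y :=
  ∑ j, act Y (x D ((finBasis ℂ h).coord j)) * act Y (y D (finBasis ℂ h j)) - reflSum D (rep Y)

theorem eulerOp_apply (m : Y) : eulerOp Y m =
    ∑ j, x D ((finBasis ℂ h).coord j) • y D (finBasis ℂ h j) • m - reflSum D (rep Y) m := by
  rw [eulerOp, LinearMap.sub_apply, LinearMap.sum_apply]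
  rfl

theorem sum_apply_smul_x (ξ : Dual ℂ h) :
    x D ξ = ∑ j, ξ (finBasis ℂ h j) • x D ((finBasis ℂ h).coord j) := by
  conv_lhs => rw [← (finBasis ℂ h).sum_dual_apply_smul_coord ξ, map_sum]
  simp only [map_smul]

/-- The reflections produced by `[y, ξ]` cancel against those produced by moving `ξ` past `∑ c(s)
κ(s)⁻¹ s`, because `s ξ = (ξ - κ ξ(α_s^∨) α_s) s`. Only `[eu, ξ] = t ξ` survives. -/
theorem eulerOp_x_smul (ξ : Dual ℂ h) (m : Y) :
    eulerOp Y (x D ξ • m) = x D ξ • eulerOp Y m + D.t • x D ξ • m := by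
  have h1 : ∀ j, x D ((finBasis ℂ h).coord j) • y D (finBasis ℂ h j) • x D ξ • m =
      x D ξ • x D ((finBasis ℂ h).coord j) • y D (finBasis ℂ h j) • m +
      D.t • (ξ (finBasis ℂ h j) • x D ((finBasis ℂ h).coord j)) • m -
      ∑ s : Refl G, (D.c s * ξ (D.roots.αv s)) •
        (D.roots.α s (finBasis ℂ h j) • x D ((finBasis ℂ h).coord j)) • rep Y s.1 m := fun j => by
    rw [← sub_add_cancel (y D (finBasis ℂ h j) • x D ξ • m) (x D ξ • y D (finBasis ℂ h j) • m),
      y_smul_x_smul_sub, smul_add, smul_sub, Finset.smul_sum]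
    have h2 : x D ((finBasis ℂ h).coord j) • x D ξ • y D (finBasis ℂ h j) • m =
        x D ξ • x D ((finBasis ℂ h).coord j) • y D (finBasis ℂ h j) • m := by
      rw [← mul_smul, x_mul_x_comm, mul_smul]
    rw [h2, Y.smul_comm_complex]
    have h3 : ∀ s : Refl G, x D ((finBasis ℂ h).coord j) •
        (D.c s * D.roots.α s (finBasis ℂ h j) * ξ (D.roots.αv s)) • rep Y s.1 m =
        (D.c s * ξ (D.roots.αv s)) •
        (D.roots.α s (finBasis ℂ h j) • x D ((finBasis ℂ h).coord j)) • rep Y s.1 m := fun s => by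
      rw [Y.smul_comm_complex, smul_assoc, smul_smul]
      congr 1
      ring
    rw [Finset.sum_congr rfl fun s _ => h3 s, smul_assoc, ← smul_smul]
    abel
  have h4 : ∀ s : Refl G, rep Y s.1 (x D ξ • m) =
      x D ξ • rep Y s.1 m - (D.roots.κ s * ξ (D.roots.αv s)) • x D (D.roots.α s) • rep Y s.1 m := fun s => by
    have := LinearMap.congr_fun (rep_comp_x Y s.1 ξ) m
    refine this.trans ?_
    rw [D.roots.dual_apply, map_sub, map_smul]
    change (x D ξ - (D.roots.κ s * ξ (D.roots.αv s)) • x D (D.roots.α s)) • rep Y s.1 m = _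
    rw [sub_smul, smul_assoc]
  rw [eulerOp_apply, eulerOp_apply, Finset.sum_congr rfl fun j _ => h1 j, Finset.sum_sub_distrib,
    Finset.sum_add_distrib, ← Finset.smul_sum, ← Finset.smul_sum, ← Finset.sum_smul, ← sum_apply_smul_x,
    Finset.sum_comm, reflSum_apply, reflSum_apply, smul_sub]
  have h5 : ∀ s : Refl G, (D.c s / D.roots.κ s) • rep Y s.1 (x D ξ • m) =
      x D ξ • (D.c s / D.roots.κ s) • rep Y s.1 m - ∑ j, (D.c s * ξ (D.roots.αv s)) •
        (D.roots.α s (finBasis ℂ h j) • x D ((finBasis ℂ h).coord j)) • rep Y s.1 m := fun s => by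
    rw [h4, smul_sub, Y.smul_comm_complex, smul_smul, ← Finset.smul_sum, ← Finset.sum_smul, ← sum_apply_smul_x]
    congr 2
    have := D.roots.κ_ne_zero s
    field_simp
  rw [Finset.sum_congr rfl fun s _ => h5 s, Finset.sum_sub_distrib, ← Finset.smul_sum (r := x D ξ)]
  abel

theorem sum_spinX_spinY (ω : Spin h) :
    ∑ j, spinX ((finBasis ℂ h).coord j) (spinY (finBasis ℂ h j) ω) = (-2 : ℂ) • spinN h ω := by
  rw [spinN_apply, smul_smul]
  norm_num

/-- `spinRep_refl` expanded in dual bases, which is the form in which the reflection terms of `D²`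
appear. -/
theorem spinX_spinY_refl (s : Refl G) (ω : Spin h) :
    ∑ i, ∑ j, (D.roots.α s (finBasis ℂ h j) * (finBasis ℂ h).coord i (D.roots.αv s)) •
      spinX ((finBasis ℂ h).coord j) (spinY (finBasis ℂ h i) ω) =
    (2 / D.roots.κ s) • (spinRep G s.1 ω - ω) := by
  have h1 : spinX (D.roots.α s) = ∑ j, D.roots.α s (finBasis ℂ h j) • spinX ((finBasis ℂ h).coord j) := by
    conv_lhs => rw [← (finBasis ℂ h).sum_dual_apply_smul_coord (D.roots.α s), map_sum]
    simp only [map_smul]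
  have h2 : spinY (D.roots.αv s) = ∑ i, (finBasis ℂ h).coord i (D.roots.αv s) • spinY (finBasis ℂ h i) := by
    conv_lhs => rw [← (finBasis ℂ h).sum_repr (D.roots.αv s), map_sum]
    simp only [map_smul]
    rfl
  have h3 : spinX (D.roots.α s) (spinY (D.roots.αv s) ω) = ∑ i, ∑ j,
      (D.roots.α s (finBasis ℂ h j) * (finBasis ℂ h).coord i (D.roots.αv s)) •
      spinX ((finBasis ℂ h).coord j) (spinY (finBasis ℂ h i) ω) := by
    rw [h1, h2]
    simp only [LinearMap.sum_apply, LinearMap.smul_apply, map_sum, map_smul, Finset.smul_sum, smul_smul]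
    refine Finset.sum_congr rfl fun i _ => Finset.sum_congr rfl fun j _ => ?_
    rw [mul_comm]
  have h4 := congrArg (fun T : End ℂ (Spin h) => T ω) (spinRep_refl D.roots s)
  have h5 : spinRep G s.1 ω = ω + (D.roots.κ s / 2) • spinX (D.roots.α s) (spinY (D.roots.αv s) ω) := h4
  have h6 := D.roots.κ_ne_zero s
  rw [← h3, h5, add_sub_cancel_left, smul_smul]
  rw [show 2 / D.roots.κ s * (D.roots.κ s / 2) = 1 by field_simp, one_smul]

/-- Write `D = A + B` with `A² = B² = 0`. In `AB + BA` the Clifford relation gives `-2 ∑ xⱼ yⱼ`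
(`h3`), the scalar part of `[y, x]` gives the number operator (`h4`), and the reflections give the
diagonal sum minus the sum acting on `Y` alone (`h5`). The last sum completes `∑ xⱼ yⱼ` to the Euler
element. -/
theorem dirac_dirac_tmul (m : Y) (ω : Spin h) : dirac Y (dirac Y (m ⊗ₜ ω)) =
    (-2 : ℂ) • (eulerOp Y m ⊗ₜ ω + D.t • m ⊗ₜ spinN h ω + reflSum D (diracRep Y) (m ⊗ₜ ω)) := by
  let b := finBasis ℂ h
  let A : End ℂ (Y ⊗[ℂ] Spin h) := ∑ j, act Y (x D (b.coord j)) ⊠ spinY (b j)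
  let B : End ℂ (Y ⊗[ℂ] Spin h) := ∑ j, act Y (y D (b j)) ⊠ spinX (b.coord j)
  have hD : dirac Y = A + B := Finset.sum_add_distrib
  have hA : A * A = 0 := sum_tmul_sq (fun i j => by
    rw [← map_mul (act Y), x_mul_x_comm, map_mul (act Y)])
    (fun i j => spinY_anticomm _ _)
  have hB : B * B = 0 := sum_tmul_sq (fun i j => by
    rw [← map_mul (act Y), y_mul_y_comm, map_mul (act Y)])
    (fun i j => spinX_anticomm _ _)
  have hAB := sum_tmul_anticomm (fun j => act Y (x D (b.coord j))) (fun j => act Y (y D (b j)))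
    (fun j => spinY (b j)) (fun j => spinX (b.coord j))
  have hsq : dirac Y * dirac Y = A * B + B * A := by
    rw [hD, mul_add, add_mul, add_mul, hA, hB]
    abel
  have h0 := congrArg (fun T : End ℂ (Y ⊗[ℂ] Spin h) => T (m ⊗ₜ ω)) (hsq.trans hAB)
  refine Eq.trans h0 ?_
  simp only [LinearMap.sum_apply, LinearMap.add_apply, TensorProduct.map_tmul]
  have h1 : ∀ i j, (spinY (b i) * spinX (b.coord j)) ω + (spinX (b.coord j) * spinY (b i)) ω =
      (if i = j then (-2 : ℂ) else 0) • ω := fun i j => by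
    change (spinY (b i) * spinX (b.coord j) + spinX (b.coord j) * spinY (b i)) ω = _
    rw [add_comm, spinX_spinY, LinearMap.smul_apply, Module.End.one_apply, Basis.coord_apply, Basis.repr_self,
      Finsupp.single_apply]
    split_ifs <;> simp
  have h2 : ∀ i j, (act Y (y D (b j)) * act Y (x D (b.coord i)) - act Y (x D (b.coord i)) * act Y (y D (b j))) m =
      (if i = j then D.t else 0) • m -
      ∑ s : Refl G, (D.c s * D.roots.α s (b j) * b.coord i (D.roots.αv s)) • rep Y s.1 m := fun i j => by
    refine (y_smul_x_smul_sub Y (b j) (b.coord i) m).trans ?_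
    rw [Basis.coord_apply, Basis.repr_self, Finsupp.single_apply]
    simp only [eq_comm (a := j), mul_ite, mul_one, mul_zero]
  have h3 : ∑ i, ∑ j, ((act Y (x D (b.coord i)) * act Y (y D (b j))) m) ⊗ₜ[ℂ]
      ((spinY (b i) * spinX (b.coord j)) ω + (spinX (b.coord j) * spinY (b i)) ω) =
      (-2 : ℂ) • ((∑ j, x D (b.coord j) • y D (b j) • m) ⊗ₜ ω) := by
    simp only [h1, ite_smul, zero_smul, TensorProduct.tmul_ite, Finset.sum_ite_eq,
      Finset.mem_univ, if_true, TensorProduct.tmul_smul, TensorProduct.sum_tmul, Finset.smul_sum]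
    rfl
  have h4 : ∑ i, ∑ j, ((if i = j then D.t else 0) • m) ⊗ₜ[ℂ] (spinX (b.coord j) (spinY (b i) ω)) =
      (-2 : ℂ) • D.t • m ⊗ₜ spinN h ω := by
    simp only [ite_smul, zero_smul, TensorProduct.ite_tmul, Finset.sum_ite_eq,
      Finset.mem_univ, if_true]
    rw [← TensorProduct.tmul_sum, sum_spinX_spinY, TensorProduct.tmul_smul, ← TensorProduct.smul_tmul']
  have h5 : ∑ i, ∑ j, (∑ s : Refl G, (D.c s * D.roots.α s (b j) * b.coord i (D.roots.αv s)) • rep Y s.1 m) ⊗ₜ[ℂ]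
      (spinX (b.coord j) (spinY (b i) ω)) =
      (2 : ℂ) • reflSum D (diracRep Y) (m ⊗ₜ ω) - (2 : ℂ) • reflSum D (rep Y) m ⊗ₜ ω := by
    have h6 : ∀ s : Refl G, ∑ i, ∑ j, ((D.c s * D.roots.α s (b j) * b.coord i (D.roots.αv s)) • rep Y s.1 m) ⊗ₜ[ℂ]
        (spinX (b.coord j) (spinY (b i) ω)) =
        (2 : ℂ) • (D.c s / D.roots.κ s) • diracRep Y s.1 (m ⊗ₜ ω) -
        (2 : ℂ) • ((D.c s / D.roots.κ s) • rep Y s.1 m) ⊗ₜ ω := fun s => by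
      have h7 := congrArg (fun w => (D.c s • rep Y s.1 m) ⊗ₜ[ℂ] w) (spinX_spinY_refl (D := D) s ω)
      simp only [TensorProduct.tmul_sum] at h7
      have h8 : diracRep Y s.1 (m ⊗ₜ[ℂ] ω) = rep Y s.1 m ⊗ₜ spinRep G s.1 ω := rfl
      rw [h8]
      refine Eq.trans ?_ (h7.trans ?_)
      · refine Finset.sum_congr rfl fun i _ => Finset.sum_congr rfl fun j _ => ?_
        rw [TensorProduct.tmul_smul, ← TensorProduct.smul_tmul', ← TensorProduct.smul_tmul', smul_smul]
        congr 1
        ring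
      · rw [TensorProduct.tmul_smul, TensorProduct.tmul_sub, ← TensorProduct.smul_tmul',
          ← TensorProduct.smul_tmul', ← TensorProduct.smul_tmul']
        match_scalars <;> ring
    simp only [TensorProduct.sum_tmul]
    rw [Finset.sum_congr rfl fun i _ => Finset.sum_comm, Finset.sum_comm, Finset.sum_congr rfl fun s _ => h6 s,
      Finset.sum_sub_distrib, ← Finset.smul_sum, ← Finset.smul_sum, reflSum_apply, reflSum_apply,
      TensorProduct.sum_tmul]
  simp only [Finset.sum_add_distrib]
  rw [h3]
  simp only [h2, Module.End.mul_apply, TensorProduct.sub_tmul, Finset.sum_sub_distrib]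
  rw [h4, h5, eulerOp_apply, TensorProduct.sub_tmul]
  module

end Cher

end DiracSquare

/-! ### Quotients of standard modules. -/

section StandardQuotients

open Module
local infixl:70 " ⊠ " => TensorProduct.map

variable {h : Type u} [AddCommGroup h] [Module ℂ h] [FiniteDimensional ℂ h]
  {V : Type u} [AddCommGroup V] [Module ℂ V] {W : Type u} [AddCommGroup W] [Module ℂ W]
  {G : Subgroup (h ≃ₗ[ℂ] h)} [Finite G]

theorem GrMod.eul_hom {A : Type u} [Ring A] [Algebra ℂ A] {𝒜 : ℤ → Submodule ℂ A} {X Y : GrMod.{u, v} 𝒜}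
    (q : X ⟶ Y) (m : X) : Y.eul (q.1 m) = q.1 (X.eul m) := by
  refine iSup_eq_top_induction (P := fun m => Y.eul (q.1 m) = q.1 (X.eul m)) (iSup_deg_eq_top X.isInternal)
    (fun n m hm => ?_) (fun m m' H H' => ?_) ?_ m
  · rw [X.eul_of_mem hm, Y.eul_of_mem (q.2 n m hm)]
    exact (LinearMap.map_smul_of_tower q.1 _ _).symm
  · simp only [map_add, H, H']
  · simp

theorem GrMod.deg_eq_map_of_surjective {A : Type u} [Ring A] [Algebra ℂ A] {𝒜 : ℤ → Submodule ℂ A}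
    {X Y : GrMod.{u, v} 𝒜} (q : X ⟶ Y) (hq : Function.Surjective q.1) (n : ℤ) :
    Y.deg n = (X.deg n).map (q.1.restrictScalars ℂ) := by
  refine le_antisymm (fun m hm => ?_) ?_
  · obtain ⟨m, rfl⟩ := hq m
    refine ⟨X.proj n m, gradedProj_mem X.isInternal n m, ?_⟩
    refine (proj_hom q n m).symm.trans ?_
    exact gradedProj_same Y.isInternal hm
  · rintro _ ⟨m, hm, rfl⟩
    exact q.2 n m hm

namespace Cher

variable (D : CherData G)

theorem std_x_induction (σ : Representation ℂ G W) {P : std D σ → Prop} (ins : ∀ v, P (stdIns D σ v))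
    (add : ∀ z z', P z → P z' → P (z + z')) (x_smul : ∀ ξ z, P z → P (x D ξ • z)) (z : std D σ) : P z := by
  obtain ⟨F, hF, hF'⟩ := exists_indIso_std D σ 0
  let F1 : (GrYRep.triv σ 0).ind D →ₗ[Cher D] std D σ := F.1
  obtain ⟨w, rfl⟩ : ∃ w, F1 w = z := hF.2 z
  induction w using GrYRep.ind_induction with
  | ins v =>
    have := hF' v
    change F1 _ = _ at this
    rw [this]
    exact ins v
  | add w w' H H' => rw [map_add]; exact add _ _ H H'
  | x_smul ξ w H => rw [map_smul]; exact x_smul _ _ H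

theorem stdIns_injective (σ : Representation ℂ G W) : Function.Injective (stdIns D σ) := by
  obtain ⟨F, hF, hF'⟩ := exists_indIso_std D σ 0
  intro v v' H
  rw [← hF', ← hF'] at H
  have h1 : (1 : Sy (Dual ℂ h)) ⊗ₜ[ℂ] v = 1 ⊗ₜ[ℂ] v' := hF.1 H
  have h2 := congrArg (TensorProduct.lid ℂ W ∘ (Sy.constCoeff ⊠ (LinearMap.id : W →ₗ[ℂ] W))) h1
  simpa [Sy.constCoeff_one] using h2

theorem eulerOp_hom {X Y : GrMod.{u, u} (Cher.deg D)} (q : X ⟶ Y) (m : X) :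
    eulerOp Y (q.1 m) = q.1 (eulerOp X m) := by
  rw [eulerOp_apply, eulerOp_apply, map_sub, map_sum]
  simp only [map_smul]
  congr 1
  exact (map_reflSum D (rep X) (rep Y) (q.1.restrictScalars ℂ) (fun g m => map_smul q.1 _ _) m).symm

variable {D} {σ : Representation ℂ G W} {z : ℂ} (hz : ∀ v, reflSum D σ v = z • v)

include hz in
-- On the generating copy of `σ` the terms `xⱼ yⱼ` vanish and the reflections contribute `-z`; every
-- further factor in `𝔥*` adds `t`.
theorem eulerOp_std (m : std D σ) : eulerOp (std D σ) m = D.t • (std D σ).eul m - z • m := by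
  induction m using std_x_induction with
  | ins v =>
    have h1 := map_reflSum D σ (rep (std D σ)) (stdIns D σ) (fun g v => (g_smul_stdIns D σ g v).symm) v
    rw [eulerOp_apply, (std D σ).eul_of_mem (stdIns_mem D σ v), ← h1, hz, map_smul]
    simp only [y_smul_stdIns, smul_zero, Finset.sum_const_zero, Int.cast_zero, zero_smul]
  | add m m' H H' =>
    rw [map_add, H, H', map_add]
    module
  | x_smul ξ m H =>
    have h1 := (std D σ).eul_smul (gen_mem_deg D (.x ξ)) m
    change (std D σ).eul (x D ξ • m) = x D ξ • (std D σ).eul m + ((1 : ℤ) : ℂ) • x D ξ • m at h1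
    rw [eulerOp_x_smul, H, h1, smul_sub, GrMod.smul_comm_complex, GrMod.smul_comm_complex]
    push_cast
    generalize x D ξ • (std D σ).eul m = a
    generalize x D ξ • m = b
    module

variable {Y : GrMod.{u, u} (Cher.deg D)} (q : std D σ ⟶ Y) (hq : Function.Surjective q.1)

include hz hq in
theorem eulerOp_of_surjective (m : Y) : eulerOp Y m = D.t • Y.eul m - z • m := by
  obtain ⟨m, rfl⟩ := hq m
  rw [eulerOp_hom, eulerOp_std hz, GrMod.eul_hom q m, map_sub]
  congr 1
  · exact LinearMap.map_smul_of_tower q.1 _ _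
  · exact LinearMap.map_smul_of_tower q.1 _ _

include hz hq in
/-- The square of the Dirac operator on a quotient of a standard module. -/
theorem dirac_dirac (w : Y ⊗[ℂ] Spin h) : dirac Y (dirac Y w) =
    (-2 : ℂ) • (D.t • totalEul Y w - z • w + reflSum D (diracRep Y) w) := by
  induction w using TensorProduct.induction_on with
  | zero => simp
  | add w w' H H' =>
    simp only [map_add, H, H']
    module
  | tmul m ω =>
    rw [dirac_dirac_tmul, eulerOp_of_surjective hz q hq, totalEul, LinearMap.add_apply, TensorProduct.map_tmul,
      TensorProduct.map_tmul, TensorProduct.sub_tmul, ← TensorProduct.smul_tmul', ← TensorProduct.smul_tmul',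
      Module.End.one_apply, Module.End.one_apply]
    module

include hz hq in
-- On an equivariant map from `τ` into total degree `γ`, each of the three summands of `D²` is a
-- scalar.
theorem dirac_dirac_homSpin {τ : Representation ℂ G V} {z' : ℂ} (hz' : ∀ v, reflSum D τ v = z' • v) {γ : ℤ}
    {ε : ZMod 2} {f : V →ₗ[ℂ] Y ⊗[ℂ] Spin h} (hf : f ∈ homSpin Y τ γ ε) (v : V) :
    dirac Y (dirac Y (f v)) = (-2 * (D.t * γ - z + z')) • f v := by
  rw [dirac_dirac hz q hq, (mem_totalDeg Y).1 (hf.2.2 v), ← map_reflSum D τ (diracRep Y) f hf.1, hz', map_smul]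
  module

/-- The polynomials of degree `n` applied to the generating subspace of a standard module. -/
noncomputable def stdDeg (σ : Representation ℂ G W) (D : CherData G) : ℕ → Submodule ℂ (std D σ)
  | 0 => LinearMap.range (stdIns D σ)
  | n + 1 => Submodule.map₂ ((act (std D σ)).toLinearMap ∘ₗ x D) ⊤ (stdDeg σ D n)

theorem fg_stdDeg [FiniteDimensional ℂ W] (n : ℕ) : (stdDeg σ D n).FG := by
  induction n with
  | zero =>
    rw [stdDeg, LinearMap.range_eq_map]
    exact Submodule.FG.map _ Module.Finite.fg_top
  | succ n ih => exact Submodule.FG.map₂ _ Module.Finite.fg_top ih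

theorem stdDeg_le (n : ℕ) : stdDeg σ D n ≤ (std D σ).deg n := by
  induction n with
  | zero =>
    rintro _ ⟨v, rfl⟩
    exact stdIns_mem D σ v
  | succ n ih =>
    refine Submodule.map₂_le.2 fun ξ _ m hm => ?_
    have := (std D σ).smul_mem (gen_mem_deg D (.x ξ)) (ih hm)
    rw [add_comm] at this
    exact_mod_cast this

theorem iSup_stdDeg : ⨆ n : ℤ, (if 0 ≤ n then stdDeg σ D n.toNat else ⊥) = ⊤ := by
  refine eq_top_iff.2 fun m hm => ?_
  clear hm
  have hmem : ∀ (n : ℕ), ∀ m ∈ stdDeg σ D n, m ∈ ⨆ n : ℤ, (if 0 ≤ n then stdDeg σ D n.toNat else ⊥) :=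
    fun n m hm => Submodule.mem_iSup_of_mem (n : ℤ) (by simpa using hm)
  induction m using std_x_induction with
  | ins v => exact hmem 0 _ ⟨v, rfl⟩
  | add m m' H H' => exact Submodule.add_mem _ H H'
  | x_smul ξ m H =>
    induction H using Submodule.iSup_induction' with
    | mem n m hm =>
      split_ifs at hm with hn
      · exact hmem (n.toNat + 1) _ (Submodule.apply_mem_map₂ _ (m := ξ) trivial hm)
      · rw [(Submodule.mem_bot ℂ).1 hm, smul_zero]; exact Submodule.zero_mem _
    | zero => rw [smul_zero]; exact Submodule.zero_mem _
    | add m m' _ _ H H' => rw [smul_add]; exact Submodule.add_mem _ H H'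

/-- The explicit finitely generated pieces lie in the right degrees and span, so they exhaust the
grading. Nonnegativity and finite dimension of the degrees both follow. -/
theorem deg_std (n : ℤ) : (std D σ).deg n = if 0 ≤ n then stdDeg σ D n.toNat else ⊥ := by
  refine (eq_of_le_of_iSup_eq_top (std D σ).isInternal (fun n => ?_) iSup_stdDeg n).symm
  split_ifs with hn
  · have := stdDeg_le (σ := σ) (D := D) n.toNat
    rwa [Int.toNat_of_nonneg hn] at this
  · exact bot_le

theorem deg_std_zero : (std D σ).deg 0 = LinearMap.range (stdIns D σ) := by
  rw [deg_std, if_pos le_rfl]; rfl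

theorem deg_std_of_neg {n : ℤ} (hn : n < 0) : (std D σ).deg n = ⊥ := by
  rw [deg_std, if_neg (by omega)]

include hq in
theorem finiteDimensional_deg [FiniteDimensional ℂ W] (n : ℤ) : FiniteDimensional ℂ (Y.deg n) := by
  rw [GrMod.deg_eq_map_of_surjective q hq]
  refine Module.Finite.iff_fg.2 (Submodule.FG.map _ ?_)
  rw [deg_std]
  split_ifs
  · exact fg_stdDeg _
  · exact Submodule.fg_bot

include hq in
-- Here the two computations meet: the Koszul resolution gives even minus odd, and `D²` being scalar
-- identifies this with the Dirac index.
theorem hasExtEuler_of_surjective [FiniteDimensional ℂ V] [FiniteDimensional ℂ W] (τ : Representation ℂ G V)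
    (hτ : τ.IsIrreducible) (hσ : σ.IsIrreducible) (γ : ℤ) :
    HasExtEuler.{u + 1} ((std D τ).shift γ) Y (finrank ℂ h + 2) (diracIndexMult Y τ γ) := by
  obtain ⟨z, hz⟩ := exists_reflSum_eq_smul D σ hσ
  obtain ⟨z', hz'⟩ := exists_reflSum_eq_smul D τ hτ
  have hfin := finiteDimensional_deg q hq
  obtain ⟨h1, h2⟩ := finrank_homSpin Y τ γ hfin
  have h3 := Koszul.hasExtEuler_std (D := D) τ γ Y hfin
  rw [h2, ← diracIndexMult_eq Y τ γ h1 _ fun ε f hf v => dirac_dirac_homSpin hz q hq hz' hf v] at h3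
  exact h3

end Cher

end StandardQuotients

/-! ### The pairing of two standard modules. -/

section StandardPairing

open Module
local infixl:70 " ⊠ " => TensorProduct.map

variable {h : Type u} [AddCommGroup h] [Module ℂ h] [FiniteDimensional ℂ h]
  {V : Type u} [AddCommGroup V] [Module ℂ V] {W : Type u} [AddCommGroup W] [Module ℂ W]
  {G : Subgroup (h ≃ₗ[ℂ] h)} [Finite G]

theorem GrMod.eul_shift_zero {A : Type u} [Ring A] [Algebra ℂ A] {𝒜 : ℤ → Submodule ℂ A}
    (X : GrMod.{u, v} 𝒜) (m : X) : (X.shift 0).eul m = X.eul m := by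
  refine iSup_eq_top_induction (P := fun m => (X.shift 0).eul m = X.eul m) (iSup_deg_eq_top X.isInternal)
    (fun n m hm => ?_) (fun m m' H H' => ?_) ?_ m
  · have hm' : m ∈ (X.shift 0).deg n := by
      change m ∈ X.deg (n - 0)
      rwa [sub_zero]
    exact ((X.shift 0).eul_of_mem hm').trans (X.eul_of_mem hm).symm
  · rw [map_add X.eul, ← H, ← H']
    exact map_add (X.shift 0).eul m m'
  · rw [map_zero X.eul]
    exact map_zero (X.shift 0).eul

namespace Cher

/-- As a graded `G`-module the standard module is `S(𝔥*) ⊗ σ`; neither the action of `G` nor the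
grading on this model involves `t` or `c`. -/
theorem exists_equiv_std (D : CherData G) (σ : Representation ℂ G W) :
    ∃ E : Sy (Dual ℂ h) ⊗[ℂ] W ≃ₗ[ℂ] std D σ,
      (∀ g z, E ((GrYRep.triv σ 0).opG g z) = rep (std D σ) g (E z)) ∧
      ∀ z, E ((GrYRep.triv σ 0).indEul z) = (std D σ).eul (E z) := by
  obtain ⟨F, hF, -⟩ := exists_indIso_std D σ 0
  refine ⟨LinearEquiv.ofBijective (F.1.restrictScalars ℂ) hF, fun g z => ?_, fun z => ?_⟩
  · have h1 := (GrYRep.triv σ 0).g_smul_ind D g z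
    let F1 : (GrYRep.triv σ 0).ind D →ₗ[Cher D] std D σ := F.1
    exact (congrArg F1 h1.symm).trans (F1.map_smul (Cher.g D g) z)
  · have h1 := (GrYRep.triv σ 0).eul_ind D z
    refine (congrArg F.1 h1.symm).trans ?_
    exact (GrMod.eul_hom F z).symm.trans (GrMod.eul_shift_zero _ _)

theorem finrank_homBideg_le {D D' : CherData G} {Y : GrMod.{u, u} (Cher.deg D)} {Y' : GrMod.{u, u} (Cher.deg D')}
    (E : Y ≃ₗ[ℂ] Y') (hg : ∀ g m, E (rep Y g m) = rep Y' g (E m)) (hE : ∀ m, E (Y.eul m) = Y'.eul (E m))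
    (τ : Representation ℂ G V) (γ : ℤ) (p : ℕ) [FiniteDimensional ℂ (Koszul.homBideg τ γ p Y')] :
    finrank ℂ (Koszul.homBideg τ γ p Y) ≤ finrank ℂ (Koszul.homBideg τ γ p Y') := by
  let T : Y ⊗[ℂ] Spin h ≃ₗ[ℂ] Y' ⊗[ℂ] Spin h := TensorProduct.congr E (LinearEquiv.refl ℂ _)
  have hT : ∀ m ω, T (m ⊗ₜ ω) = E m ⊗ₜ ω := fun m ω => rfl
  have h1 : ∀ g w, T (diracRep Y g w) = diracRep Y' g (T w) := fun g w => by
    induction w using TensorProduct.induction_on with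
    | zero => simp
    | add w w' H H' => simp only [map_add, H, H']
    | tmul m ω => exact congrArg (· ⊗ₜ[ℂ] spinRep G g ω) (hg g m)
  have h2 : ∀ w, T (((1 : End ℂ Y) ⊠ spinProj h p) w) = ((1 : End ℂ Y') ⊠ spinProj h p) (T w) := fun w => by
    induction w using TensorProduct.induction_on with
    | zero => simp
    | add w w' H H' => simp only [map_add, H, H']
    | tmul m ω => rfl
  have h3 : ∀ w, T ((Y.eul ⊠ (1 : End ℂ (Spin h))) w) = (Y'.eul ⊠ (1 : End ℂ (Spin h))) (T w) := fun w => by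
    induction w using TensorProduct.induction_on with
    | zero => simp
    | add w w' H H' => simp only [map_add, H, H']
    | tmul m ω => exact congrArg (· ⊗ₜ[ℂ] ω) (hE m)
  let Φ : Koszul.homBideg τ γ p Y →ₗ[ℂ] Koszul.homBideg τ γ p Y' :=
    LinearMap.codRestrict _ (LinearMap.compRight ℂ T.toLinearMap ∘ₗ (Koszul.homBideg τ γ p Y).subtype) fun f =>
      ⟨fun g v => (congrArg T (f.2.1 g v)).trans (h1 g _), fun v => (h2 _).symm.trans (congrArg T (f.2.2.1 v)),
        fun v => (h3 _).symm.trans ((congrArg T (f.2.2.2 v)).trans (map_smul T _ _))⟩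
  refine LinearMap.finrank_le_finrank_of_injective (f := Φ) fun f f' H => Subtype.ext (LinearMap.ext fun v => ?_)
  exact T.injective (LinearMap.congr_fun (congrArg Subtype.val H) v)

theorem finrank_homBideg_std (D D' : CherData G) [FiniteDimensional ℂ V] [FiniteDimensional ℂ W]
    (τ : Representation ℂ G V) (σ : Representation ℂ G W) (γ : ℤ) (p : ℕ) :
    finrank ℂ (Koszul.homBideg τ γ p (std D σ)) = finrank ℂ (Koszul.homBideg τ γ p (std D' σ)) := by
  have key : ∀ D D' : CherData G, finrank ℂ (Koszul.homBideg τ γ p (std D σ)) ≤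
      finrank ℂ (Koszul.homBideg τ γ p (std D' σ)) := fun D D' => by
    obtain ⟨E, h1, h2⟩ := exists_equiv_std D σ
    obtain ⟨E', h1', h2'⟩ := exists_equiv_std D' σ
    have := Koszul.finiteDimensional_homBideg τ γ p (std D' σ)
      (finiteDimensional_deg (𝟙 (std D' σ)) Function.surjective_id _)
    refine finrank_homBideg_le (E.symm.trans E') (fun g m => ?_) (fun m => ?_) τ γ p
    · obtain ⟨m, rfl⟩ := E.surjective m
      rw [← h1, LinearEquiv.trans_apply, LinearEquiv.trans_apply, E.symm_apply_apply, E.symm_apply_apply, h1']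
    · obtain ⟨m, rfl⟩ := E.surjective m
      rw [← h2, LinearEquiv.trans_apply, LinearEquiv.trans_apply, E.symm_apply_apply, E.symm_apply_apply, h2']
  exact le_antisymm (key D D') (key D' D)

/-- Where `D²` is a nonzero scalar, `D` embeds each parity in the other. -/
theorem finrank_homSpin_eq_of_dirac_dirac {D : CherData G} (Y : GrMod.{u, u} (Cher.deg D))
    (τ : Representation ℂ G V) (γ : ℤ) (hW : ∀ ε, FiniteDimensional ℂ (homSpin Y τ γ ε)) {κ : ℂ} (hk : κ ≠ 0)
    (hκ : ∀ ε, ∀ f ∈ homSpin Y τ γ ε, ∀ v, dirac Y (dirac Y (f v)) = κ • f v) :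
    finrank ℂ (homSpin Y τ γ 0) = finrank ℂ (homSpin Y τ γ 1) := by
  have key : ∀ ε, finrank ℂ (homSpin Y τ γ ε) ≤ finrank ℂ (homSpin Y τ γ (ε + 1)) := fun ε => by
    rw [finrank_eq_inf_ker_add_map (homSpin Y τ γ ε) (LinearMap.compRight ℂ (dirac Y))]
    have h0 : homSpin Y τ γ ε ⊓ LinearMap.ker (LinearMap.compRight ℂ (dirac Y)) = ⊥ := by
      refine eq_bot_iff.2 fun f hf => LinearMap.ext fun v => ?_
      have h5 := hκ ε f hf.1 v
      have h6 : dirac Y (f v) = 0 := LinearMap.congr_fun hf.2 v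
      rw [h6, map_zero] at h5
      exact (smul_eq_zero.1 h5.symm).resolve_left hk
    rw [h0, finrank_bot, zero_add]
    refine finrank_le_of_le_complex ?_
    rintro _ ⟨f, hf, rfl⟩
    exact dirac_comp_mem hf
  have h1 := key 1
  rw [CharTwo.add_self_eq_zero] at h1
  exact le_antisymm (key 0) h1

section DegreeZero

variable (D : CherData G) (σ : Representation ℂ G W)

/-- The embedding `v ↦ (1 ⊗ v) ⊗ 1` of `σ` in the component of degree `0`. -/
noncomputable def stdSpinIns : W →ₗ[ℂ] std D σ ⊗[ℂ] Spin h :=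
  (TensorProduct.mk ℂ (std D σ) (Spin h)).flip 1 ∘ₗ stdIns D σ

theorem stdSpinIns_injective : Function.Injective (stdSpinIns D σ) := fun v v' H => by
  have h1 := congrArg (contr (ExteriorAlgebra.algebraMapInv (R := ℂ) (M := Dual ℂ h)).toLinearMap) H
  have h2 : ∀ v, contr (ExteriorAlgebra.algebraMapInv (R := ℂ) (M := Dual ℂ h)).toLinearMap (stdSpinIns D σ v) =
      stdIns D σ v := fun v => by
    refine (contr_tmul _ _ _).trans ?_
    rw [AlgHom.toLinearMap_apply, map_one, one_smul]
  rw [h2, h2] at h1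
  exact stdIns_injective D σ h1

variable {D σ} in
-- A standard module has no negative degrees, so total degree `0` leaves only `σ ⊗ ⋀⁰`.
theorem formProj_of_mem_totalDeg_zero {w : std D σ ⊗[ℂ] Spin h} (hw : w ∈ totalDeg (std D σ) 0) :
    formProj (std D σ) 0 w ∈ LinearMap.range (stdSpinIns D σ) ∧
      ∀ p, formProj (std D σ) (p + 1) w = 0 := by
  induction hw using Submodule.span_induction with
  | mem _ hw =>
    obtain ⟨l, m, ω, hm, hω, rfl⟩ := hw
    refine ⟨?_, fun p => ?_⟩
    · by_cases hl : l = 0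
      · subst hl
        rw [Int.natCast_zero, sub_zero, deg_std_zero] at hm
        obtain ⟨v, rfl⟩ := hm
        refine ⟨ExteriorAlgebra.algebraMapInv (R := ℂ) (M := Dual ℂ h) ω • v, ?_⟩
        rw [formProj_tmul, spinProj_zero, TensorProduct.tmul_smul, map_smul]
        rfl
      · rw [formProj_tmul, spinProj_of_mem_ne hl hω, TensorProduct.tmul_zero]
        exact Submodule.zero_mem _
    · by_cases hl : l = p + 1
      · rw [deg_std_of_neg (by omega), Submodule.mem_bot] at hm
        rw [hm, TensorProduct.zero_tmul, map_zero]
      · rw [formProj_tmul, spinProj_of_mem_ne hl hω, TensorProduct.tmul_zero]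
  | zero => exact ⟨by rw [map_zero]; exact Submodule.zero_mem _, fun p => map_zero _⟩
  | add _ _ _ _ h₁ h₂ =>
    exact ⟨by rw [map_add]; exact Submodule.add_mem _ h₁.1 h₂.1, fun p => by
      rw [map_add, h₁.2, h₂.2, add_zero]⟩
  | smul c _ _ h =>
    exact ⟨by rw [map_smul]; exact Submodule.smul_mem _ _ h.1, fun p => by rw [map_smul, h.2, smul_zero]⟩

variable (τ : Representation ℂ G V)

theorem finrank_homBideg_std_zero_succ (p : ℕ) : finrank ℂ (Koszul.homBideg τ 0 (p + 1) (std D σ)) = 0 := by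
  rw [show Koszul.homBideg τ 0 (p + 1) (std D σ) = ⊥ from ?_, finrank_bot]
  refine eq_bot_iff.2 fun f hf => LinearMap.ext fun v => ?_
  have h1 : formProj _ (p + 1) (f v) = f v := hf.2.1 v
  rw [← h1, (formProj_of_mem_totalDeg_zero ((homBideg_le hf).2.2 v)).2]
  rfl

theorem rep_stdSpinIns (g : G) (v : W) : stdSpinIns D σ (σ g v) = diracRep (std D σ) g (stdSpinIns D σ v) := by
  change stdIns D σ (σ g v) ⊗ₜ[ℂ] (1 : Spin h) = (Cher.g D g • stdIns D σ v) ⊗ₜ spinRep G g 1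
  rw [g_smul_stdIns, spinRep_one]

/-- The map sending `T : τ → σ` to the corresponding equivariant map to the component of degree `0`. -/
noncomputable def intertwiningToHomBideg :
    Representation.IntertwiningMap τ σ →ₗ[ℂ] Koszul.homBideg τ 0 0 (std D σ) where
  toFun T := ⟨stdSpinIns D σ ∘ₗ T.toLinearMap, fun g v => by
      refine Eq.trans ?_ (rep_stdSpinIns D σ g (T v))
      exact congrArg (stdSpinIns D σ) (T.isIntertwining _ _ g v),
    fun v => congrArg (stdIns D σ (T v) ⊗ₜ[ℂ] ·) spinProj_one,
    fun v => by
      refine (congrArg (· ⊗ₜ[ℂ] (1 : Spin h)) ((std D σ).eul_of_mem (stdIns_mem D σ (T v)))).trans ?_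
      rw [← TensorProduct.smul_tmul']
      rfl⟩
  map_add' T T' := Subtype.ext (LinearMap.comp_add _ _ _)
  map_smul' c T := Subtype.ext (LinearMap.comp_smul _ _ _)

theorem intertwiningToHomBideg_bijective : Function.Bijective (intertwiningToHomBideg D σ τ) := by
  constructor
  · intro T T' H
    refine Representation.IntertwiningMap.ext (LinearMap.ext fun v => stdSpinIns_injective D σ ?_)
    exact LinearMap.congr_fun (congrArg Subtype.val H) v
  · intro f
    have h1 : ∀ v, f.1 v ∈ LinearMap.range (stdSpinIns D σ) := fun v => by
      have h2 : formProj _ 0 (f.1 v) = f.1 v := f.2.2.1 v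
      rw [← h2]
      exact (formProj_of_mem_totalDeg_zero ((homBideg_le f.2).2.2 v)).1
    let e := LinearEquiv.ofInjective (stdSpinIns D σ) (stdSpinIns_injective D σ)
    let T : V →ₗ[ℂ] W := e.symm.toLinearMap ∘ₗ f.1.codRestrict _ h1
    have hT : ∀ v, stdSpinIns D σ (T v) = f.1 v := fun v =>
      congrArg Subtype.val (e.apply_symm_apply ⟨f.1 v, h1 v⟩)
    refine ⟨LinearMap.intertwiningMap_of_isIntertwiningMap τ σ T fun g v => stdSpinIns_injective D σ ?_,
      Subtype.ext (LinearMap.ext hT)⟩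
    rw [hT, rep_stdSpinIns, hT, f.2.1]

open Classical in
theorem finrank_intertwiningMap_eq [FiniteDimensional ℂ V] [FiniteDimensional ℂ W] (hτ : τ.IsIrreducible)
    (hσ : σ.IsIrreducible) : finrank ℂ (Representation.IntertwiningMap τ σ) =
      if Nonempty (τ.Equiv σ) then 1 else 0 := by
  let := Fintype.ofFinite G
  have : Invertible (Nat.card G : ℂ) := invertibleOfNonzero (by simp)
  have h1 := Representation.char_orthonormal σ τ
  rw [Representation.card_inv_mul_sum_char_mul_char_eq_finrank] at h1
  split_ifs at h1 ⊢ <;> exact_mod_cast h1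

end DegreeZero

/-- In degree `0` only `p = 0` contributes, and it counts `Hom_G(τ, σ)`. In the other degrees
independence of the parameters allows a convenient choice of them. -/
theorem sum_finrank_homBideg_std [FiniteDimensional ℂ V] [FiniteDimensional ℂ W] (D : CherData G)
    (τ : Representation ℂ G V) (hτ : τ.IsIrreducible) (σ : Representation ℂ G W) (hσ : σ.IsIrreducible) (γ : ℤ) :
    ∑ p ∈ Finset.range (finrank ℂ h + 2), (-1) ^ p * (finrank ℂ (Koszul.homBideg τ γ p (std D σ)) : ℤ) =
      delta τ σ γ := by
  classical
  by_cases hγ : γ = 0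
  · subst hγ
    rw [Finset.sum_range_succ']
    simp only [finrank_homBideg_std_zero_succ, Int.natCast_zero, mul_zero, Finset.sum_const_zero, zero_add,
      pow_zero, one_mul]
    rw [← (LinearEquiv.ofBijective _ (intertwiningToHomBideg_bijective D σ τ)).finrank_eq,
      finrank_intertwiningMap_eq σ τ hτ hσ, delta]
    split_ifs <;> simp_all
  -- For `t = 1` and `c = 0` the reflection sums vanish and `D²` is the scalar `-2γ ≠ 0`.
  · let D' : CherData G := { t := 1, c := fun _ => 0, conj := fun _ _ _ _ => rfl, roots := D.roots }
    have hz : ∀ {M : Type u} [AddCommGroup M] [Module ℂ M] (ρ : Representation ℂ G M) (m : M),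
        reflSum D' ρ m = (0 : ℂ) • m := fun ρ m => by
      rw [reflSum_apply, zero_smul]
      refine Finset.sum_eq_zero fun s _ => ?_
      change ((0 : ℂ) / _) • _ = _
      rw [zero_div, zero_smul]
    obtain ⟨h1, h2⟩ := finrank_homSpin (std D' σ) τ γ
      (finiteDimensional_deg (𝟙 (std D' σ)) Function.surjective_id)
    simp only [finrank_homBideg_std D D']
    rw [h2, finrank_homSpin_eq_of_dirac_dirac (std D' σ) τ γ h1 (κ := -2 * (1 * γ - 0 + 0)) (by simpa using hγ)
      (fun ε f hf v => dirac_dirac_homSpin (hz σ) (𝟙 (std D' σ)) Function.surjective_id (hz τ) hf v), sub_self, delta,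
      if_neg fun H => hγ H.1]

theorem hasExtEuler_std_std [FiniteDimensional ℂ V] [FiniteDimensional ℂ W] (D : CherData G)
    (τ : Representation ℂ G V) (hτ : τ.IsIrreducible) (σ : Representation ℂ G W) (hσ : σ.IsIrreducible) (γ : ℤ) :
    HasExtEuler.{u + 1} ((std D τ).shift γ) (std D σ) (finrank ℂ h + 2) (delta τ σ γ) := by
  rw [← sum_finrank_homBideg_std D τ hτ σ hσ]
  exact Koszul.hasExtEuler_std τ γ (std D σ) (finiteDimensional_deg (𝟙 (std D σ)) Function.surjective_id)

end Cher

end StandardPairing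

/-! ### Finiteness of Dirac cohomology for `t ≠ 0`. -/

section DiracCohomologyFinite

open Module
local infixl:70 " ⊠ " => TensorProduct.map

variable {h : Type u} [AddCommGroup h] [Module ℂ h] [FiniteDimensional ℂ h]
  {W : Type u} [AddCommGroup W] [Module ℂ W] {G : Subgroup (h ≃ₗ[ℂ] h)} [Finite G]

namespace Cher

variable {D : CherData G} (Y : GrMod.{u, u} (Cher.deg D))

theorem fg_totalDeg (hY : ∀ n, FiniteDimensional ℂ (Y.deg n)) (n : ℤ) : (totalDeg Y n).FG := by
  let S : ℕ → Submodule ℂ (Y ⊗[ℂ] Spin h) := fun p =>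
    LinearMap.range ((Y.deg (n - p)).subtype ⊠ (LinearMap.id : Spin h →ₗ[ℂ] Spin h))
  have hS : ∀ p, (S p).FG := fun p => by
    change (LinearMap.range _).FG
    rw [LinearMap.range_eq_map]
    exact Submodule.FG.map _ Module.Finite.fg_top
  have hfg : (⨆ p ∈ Finset.range (finrank ℂ h + 1), S p).FG := Submodule.fg_biSup _ _ fun p _ => hS p
  have hle : totalDeg Y n ≤ ⨆ p ∈ Finset.range (finrank ℂ h + 1), S p := by
    rw [totalDeg, Submodule.span_le]
    rintro _ ⟨p, m, ω, hm, hω, rfl⟩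
    by_cases hp : finrank ℂ h < p
    · rw [exteriorPower_eq_bot hp, Submodule.mem_bot] at hω
      rw [hω, TensorProduct.tmul_zero]
      exact Submodule.zero_mem _
    · refine Submodule.mem_iSup_of_mem p (Submodule.mem_iSup_of_mem (Finset.mem_range.2 (by omega)) ?_)
      exact ⟨⟨m, hm⟩ ⊗ₜ ω, rfl⟩
  have := Module.Finite.iff_fg.2 hfg
  exact Module.Finite.iff_fg.1 (finite_of_le_complex hle)

/-- The minimal polynomial of `∑ c(s) κ(s)⁻¹ s` in the finite-dimensional group algebra annihilates
its action on every representation. This uniformity is needed because `Y ⊗ S*` may be infinite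
dimensional. -/
theorem exists_polynomial_reflSum (D : CherData G) : ∃ P : Polynomial ℂ, P ≠ 0 ∧
    ∀ {M : Type u} [AddCommGroup M] [Module ℂ M] (ρ : Representation ℂ G M) (m : M) (μ : ℂ), m ≠ 0 →
      reflSum D ρ m = μ • m → P.IsRoot μ := by
  let a : MonoidAlgebra ℂ G := ∑ s : Refl G, (D.c s / D.roots.κ s) • MonoidAlgebra.of ℂ G s.1
  have : Module.Finite ℂ (MonoidAlgebra ℂ G) := inferInstance
  have ha : IsIntegral ℂ a := Algebra.IsIntegral.isIntegral a
  refine ⟨minpoly ℂ a, minpoly.ne_zero ha, fun {M} _ _ ρ m μ hm hμ => ?_⟩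
  have h1 : ρ.asAlgebraHom a = reflSum D ρ := by
    simp only [a, map_sum, map_smul, Representation.asAlgebraHom_of]
    rfl
  have h2 : Polynomial.aeval (reflSum D ρ) (minpoly ℂ a) = 0 := by
    rw [← h1, Polynomial.aeval_algHom_apply, minpoly.aeval, map_zero]
  have h3 := Module.End.aeval_apply_of_hasEigenvector (f := reflSum D ρ) (p := minpoly ℂ a)
    ⟨End.mem_eigenspace_iff.2 hμ, hm⟩
  rw [h2, LinearMap.zero_apply] at h3
  exact (smul_eq_zero.1 h3.symm).resolve_right hm

variable {Y}

/-- For `t ≠ 0`, the Dirac operator of a quotient of a standard module has finite dimensional kernel. -/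
theorem finiteDimensional_ker_dirac [FiniteDimensional ℂ W] (ht : D.t ≠ 0) {σ : Representation ℂ G W}
    (hσ : σ.IsIrreducible) (q : std D σ ⟶ Y) (hq : Function.Surjective q.1) :
    Module.Finite ℂ (LinearMap.ker (dirac Y)) := by
  obtain ⟨z, hz⟩ := exists_reflSum_eq_smul D σ hσ
  obtain ⟨P, hP, hroot⟩ := exists_polynomial_reflSum D
  have hinj : Function.Injective fun n : ℤ => z - D.t * n := fun n n' H => by
    have := mul_left_cancel₀ ht (sub_right_injective H)
    exact_mod_cast this
  have hfin : {n : ℤ | P.IsRoot (z - D.t * n)}.Finite :=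
    (Polynomial.finite_setOfPred_isRoot hP).preimage hinj.injOn
  -- If `D w = 0` in degree `n`, the formula for `D²` makes `w` an eigenvector of the reflection sum
  -- with eigenvalue `z - t n`; as `t ≠ 0`, this can be a root for only finitely many `n`.
  have hdeg : ∀ n w, w ∈ totalDeg Y n → dirac Y w = 0 → w ≠ 0 → n ∈ hfin.toFinset := fun n w hw hd hw0 => by
    rw [Set.Finite.mem_toFinset]
    refine hroot (diracRep Y) w _ hw0 ?_
    have h1 := dirac_dirac hz q hq w
    rw [hd, map_zero, (mem_totalDeg Y).1 hw] at h1
    have h2 := (smul_eq_zero.1 h1.symm).resolve_left (by norm_num)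
    rw [eq_comm, ← sub_eq_zero, ← neg_eq_zero, ← h2]
    module
  have hle : LinearMap.ker (dirac Y) ≤ ⨆ n ∈ hfin.toFinset, totalDeg Y n := fun w hw => by
    obtain ⟨s, hs⟩ := exists_sum_gradedProj (isInternal_totalDeg Y) w
    rw [hs]
    refine Submodule.sum_mem _ fun n _ => ?_
    by_cases h0 : gradedProj (isInternal_totalDeg Y) n w = 0
    · rw [h0]; exact Submodule.zero_mem _
    · have hmem := gradedProj_mem (isInternal_totalDeg Y) n w
      refine Submodule.mem_iSup_of_mem n (Submodule.mem_iSup_of_mem (hdeg n _ hmem ?_ h0) hmem)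
      rw [gradedProj_comm (isInternal_totalDeg Y) (isInternal_totalDeg Y) (dirac Y)
        (fun n z hz => dirac_mem_totalDeg Y hz), show dirac Y w = 0 from hw, map_zero]
  have hfg : (⨆ n ∈ hfin.toFinset, totalDeg Y n).FG :=
    Submodule.fg_biSup _ _ fun n _ => fg_totalDeg Y (finiteDimensional_deg q hq) n
  have := Module.Finite.iff_fg.2 hfg
  exact finite_of_le_complex hle

theorem finiteDimensional_diracCoh_of_ker (Y : GrMod.{u, u} (Cher.deg D))
    [Module.Finite ℂ (LinearMap.ker (dirac Y))] (ε : ZMod 2) : FiniteDimensional ℂ (DiracCoh Y ε) := by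
  have : Module.Finite ℂ (diracKer Y ε) := finite_of_le_complex (T := LinearMap.ker (dirac Y)) inf_le_left
  exact Module.Finite.of_surjective (Submodule.mkQ _) (Submodule.mkQ_surjective _)

end Cher

end DiracCohomologyFinite

/-! ### Invariant polynomials and finite quotients of the symmetric algebra. -/

section FiniteQuotient

open Module
local infixl:70 " ⊠ " => TensorProduct.map

namespace Sy

variable {E : Type*} [AddCommGroup E] [Module ℂ E] [FiniteDimensional ℂ E]

/-- A polynomial ring modulo an ideal containing a power of every linear form is finite dimensional. -/
theorem finite_quotient (I : Ideal (Sy E)) (N : ℕ) (hI : ∀ e : E, ι e ^ N ∈ I) : Module.Finite ℂ (Sy E ⧸ I) := by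
  have h1 : Algebra.FiniteType ℂ (Sy E ⧸ I) := inferInstance
  have h2 : Algebra.IsIntegral ℂ (Sy E ⧸ I) := by
    refine ⟨fun f => ?_⟩
    obtain ⟨f, rfl⟩ := Ideal.Quotient.mkₐ_surjective ℂ I f
    induction f using Sy.induction with
    | C a => exact (AlgHom.commutes (Ideal.Quotient.mkₐ ℂ I) a) ▸ isIntegral_algebraMap
    | add f f' H H' => rw [map_add]; exact H.add H'
    | mul e f H =>
      rw [map_mul]
      refine IsIntegral.mul ?_ H
      -- Linear forms become nilpotent, hence integral. The exponent `N + 1` stays positive when `N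
      -- = 0`.
      have h3 : Ideal.Quotient.mkₐ ℂ I (ι e) ^ (N + 1) = 0 := by
        rw [← map_pow]
        exact Ideal.Quotient.eq_zero_iff_mem.2 (by rw [pow_succ]; exact I.mul_mem_right _ (hI e))
      refine IsIntegral.of_pow (n := N + 1) (Nat.succ_pos N) ?_
      rw [h3]
      exact isIntegral_zero
  exact Algebra.finite_iff_isIntegral_and_finiteType.2 ⟨h2, h1⟩

/-- Every linear form satisfies a monic equation whose other coefficients are invariants without constant
term. -/
theorem exists_pow_eq_sum {G : Type*} [Group G] [Finite G] (ρ : Representation ℂ G E) (e : E) :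
    ∃ a : ℕ → Sy E, (∀ k < Nat.card G, (∀ g, rep ρ g (a k) = a k) ∧ constCoeff (a k) = 0) ∧
      ι e ^ Nat.card G = ∑ k ∈ Finset.range (Nat.card G), a k * ι e ^ k := by
  let := Fintype.ofFinite G
  -- The orbit polynomial of `e`. `G` permutes its factors, so its coefficients are invariant;
  -- setting the variables of `S(E)` to `0` turns it into `X^|G|`, so the lower coefficients have no
  -- constant term.
  let P : Polynomial (Sy E) := ∏ g : G, (Polynomial.X - Polynomial.C (ι (ρ g e)))
  have hmonic : P.Monic := Polynomial.monic_prod_of_monic _ _ fun g _ => Polynomial.monic_X_sub_C _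
  have hdeg : P.natDegree = Nat.card G := by
    rw [Polynomial.natDegree_prod_of_monic _ _ fun g _ => Polynomial.monic_X_sub_C _]
    simp
  have heval : P.eval (ι e) = 0 := by
    rw [Polynomial.eval_prod]
    exact Finset.prod_eq_zero (Finset.mem_univ 1) (by simp)
  have hinv : ∀ g : G, P.map (map (ρ g) : Sy E →+* Sy E) = P := fun g => by
    simp only [P, Polynomial.map_prod, Polynomial.map_sub, Polynomial.map_X, Polynomial.map_C]
    rw [← Equiv.prod_comp (Equiv.mulLeft g) fun g' => Polynomial.X - Polynomial.C (ι (ρ g' e))]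
    refine Finset.prod_congr rfl fun g' _ => ?_
    congr 2
    change map (ρ g) (ι (ρ g' e)) = _
    rw [map_ι, Equiv.coe_mulLeft, map_mul]
    rfl
  let ev : Sy E →+* ℂ := (MvPolynomial.aeval fun _ => (0 : ℂ) : Sy E →ₐ[ℂ] ℂ)
  have hev : ∀ e : E, ev (ι e) = 0 := fun e => by
    have := constCoeff_mul e 1
    rwa [mul_one] at this
  have hconst : P.map ev = Polynomial.X ^ Nat.card G := by
    simp only [P, Polynomial.map_prod, Polynomial.map_sub, Polynomial.map_X, Polynomial.map_C, hev, map_zero,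
      sub_zero, Finset.prod_const, Finset.card_univ, Nat.card_eq_fintype_card]
  refine ⟨fun k => -P.coeff k, fun k hk => ⟨fun g => ?_, ?_⟩, ?_⟩
  · rw [map_neg]
    have := congrArg (fun Q => Polynomial.coeff Q k) (hinv g)
    simp only [Polynomial.coeff_map] at this
    exact congrArg Neg.neg this
  · rw [map_neg]
    have := congrArg (fun Q => Polynomial.coeff Q k) hconst
    simp only [Polynomial.coeff_map, Polynomial.coeff_X_pow, if_neg hk.ne] at this
    change ev _ = 0 at this
    rw [neg_eq_zero]
    exact this
  · rw [Polynomial.eval_eq_sum_range, hdeg, Finset.sum_range_succ, ← hdeg, hmonic.coeff_natDegree, one_mul, hdeg]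
      at heval
    rw [← neg_eq_of_add_eq_zero_right heval, ← Finset.sum_neg_distrib]
    exact Finset.sum_congr rfl fun k _ => (neg_mul _ _).symm

/-- Invariants without constant term are sums of homogeneous invariants of positive degree. -/
theorem mem_of_homogeneous_invariants {G : Type*} [Group G] (ρ : Representation ℂ G E) (S : Submodule ℂ (Sy E))
    (hS : ∀ (n : ℕ) (f : Sy E), 0 < n → (∀ g, rep ρ g f = f) → eul E f = (n : ℂ) • f → f ∈ S) {f : Sy E}
    (hf : ∀ g, rep ρ g f = f) (hf0 : constCoeff f = 0) : f ∈ S := by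
  have hint : DirectSum.IsInternal fun n : ℤ => (eul E).eigenspace (n : ℂ) := isGradingOp_eul.isInternal
  -- Since the family `homog` already spans, the Euler operator has no negative integral
  -- eigenvalues, and its kernel consists of the constants.
  have heig : ∀ n : ℤ, (if 0 ≤ n then homog E n.toNat else ⊥) = (eul E).eigenspace (n : ℂ) :=
    eq_of_le_of_iSup_eq_top hint (fun n => by
      split_ifs with hn
      · intro f hf
        have h1 := eul_of_mem_homog hf
        have h2 : ((n.toNat : ℕ) : ℂ) = (n : ℂ) := by
          have : ((n.toNat : ℤ) : ℂ) = (n : ℂ) := by rw [Int.toNat_of_nonneg hn]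
          exact_mod_cast this
        rw [h2] at h1
        exact End.mem_eigenspace_iff.2 h1
      · exact bot_le) (by
      rw [eq_top_iff, ← iSup_homog (E := E)]
      refine iSup_le fun n => ?_
      have := le_iSup (fun n : ℤ => (if 0 ≤ n then homog E n.toNat else ⊥ : Submodule ℂ (Sy E))) (n : ℤ)
      simpa using this)
  have hmem : ∀ n, eul E (gradedProj hint n f) = (n : ℂ) • gradedProj hint n f := fun n =>
    End.mem_eigenspace_iff.1 (gradedProj_mem hint n f)
  have hconst : ∀ n : ℤ, n ≠ 0 → constCoeff (gradedProj hint n f) = 0 := fun n hn => by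
    have h1 := constCoeff_eul (gradedProj hint n f)
    rw [hmem, map_smul] at h1
    exact (smul_eq_zero.1 h1).resolve_left (by exact_mod_cast hn)
  have hzero : gradedProj hint 0 f = 0 := by
    have h1 := gradedProj_mem hint 0 f
    rw [← heig, if_pos le_rfl] at h1
    obtain ⟨a, ha⟩ := Submodule.mem_span_singleton.1 h1
    have h2 : constCoeff (gradedProj hint 0 f) = 0 := by
      obtain ⟨s, hs⟩ := exists_sum_gradedProj hint f
      rw [hs, map_sum] at hf0
      by_cases h0 : (0 : ℤ) ∈ s
      · rwa [Finset.sum_eq_single 0 (fun n _ hn => hconst n hn) (fun h => absurd h0 h)] at hf0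
      · have h3 : gradedProj hint 0 f = 0 := by
          conv_lhs => rw [hs, map_sum]
          exact Finset.sum_eq_zero fun n hn => gradedProj_ne hint (by rintro rfl; exact h0 hn) (gradedProj_mem hint n f)
        rw [h3, map_zero]
    rw [← ha, map_smul, constCoeff_one, smul_eq_mul, mul_one] at h2
    rw [← ha, h2, zero_smul]
  obtain ⟨s, hs⟩ := exists_sum_gradedProj hint f
  rw [hs]
  refine Submodule.sum_mem _ fun n _ => ?_
  rcases lt_trichotomy n 0 with hn | rfl | hn
  · have h1 := gradedProj_mem hint n f
    rw [← heig, if_neg (by omega), Submodule.mem_bot] at h1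
    rw [h1]; exact Submodule.zero_mem _
  · rw [hzero]; exact Submodule.zero_mem _
  · refine hS n.toNat _ (by omega) (fun g => ?_) ?_
    · rw [gradedProj_comm hint hint (rep ρ g) (fun k x hx => ?_), hf]
      rw [End.mem_eigenspace_iff] at hx ⊢
      rw [eul_rep, hx, map_smul]
    · have : ((n.toNat : ℤ) : ℂ) = (n : ℂ) := by rw [Int.toNat_of_nonneg hn.le]
      rw [hmem, ← this, Int.cast_natCast]

end Sy

/-! ### Finite dimension of the simple modules for `t = 0`. -/

section SimpleModule

variable {h : Type u} [AddCommGroup h] [Module ℂ h] [FiniteDimensional ℂ h]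
  {W : Type u} [AddCommGroup W] [Module ℂ W] {G : Subgroup (h ≃ₗ[ℂ] h)} [Finite G]

theorem RootChoice.α_mul_divDiff (R : RootChoice G) (s : Refl G) (f : Sy (Dual ℂ h)) :
    Sy.ι (R.α s) * R.divDiff s f = f - Sy.rep (reflRep G).dual s.1 f := by
  induction f using Sy.induction with
  | C a =>
    have : (MvPolynomial.C a : Sy (Dual ℂ h)) = a • 1 := by rw [MvPolynomial.smul_eq_C_mul, mul_one]
    rw [this, map_smul, R.divDiff_one, map_smul, Sy.rep_one, smul_zero, mul_zero, sub_self]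
  | add f f' H H' => rw [map_add, map_add, mul_add, H, H']; abel
  | mul ξ f H =>
    rw [R.divDiff_mul, mul_add, mul_left_comm, H, Sy.rep_mul, R.dual_apply, map_sub, map_smul, sub_mul, mul_sub,
      mul_smul_comm, smul_mul_assoc]
    abel

theorem RootChoice.divDiff_eq_zero (R : RootChoice G) (s : Refl G) {f : Sy (Dual ℂ h)}
    (hf : Sy.rep (reflRep G).dual s.1 f = f) : R.divDiff s f = 0 := by
  have h1 := R.α_mul_divDiff s f
  rw [hf, sub_self] at h1
  refine (mul_eq_zero.1 h1).resolve_left fun h2 => R.α_ne_zero s ?_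
  exact Sy.ι_injective (h2.trans (map_zero _).symm)

namespace Cher

variable {D : CherData G}

/-- For `t = 0` and an invariant `f` of degree `n > 0`, the vectors `f ⊗ w` are singular and form a
quotient of `σ` under `G`. The submodule they generate is an image of `M(σ)[n]`; it misses degree
`0`, so it is proper and graded, and it dies in the simple quotient. -/
theorem exists_surjective_simple (D : CherData G) (σ : Representation ℂ G W) (hσ : Nontrivial W) :
    ∃ q : (GrYRep.triv σ 0).ind D →ₗ[Cher D] simple D σ, Function.Surjective q ∧
      (D.t = 0 → ∀ (n : ℕ) (f : Sy (Dual ℂ h)), 0 < n → (∀ g, Sy.rep (reflRep G).dual g f = f) →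
        Sy.eul _ f = (n : ℂ) • f → ∀ w : W, q (f ⊗ₜ w : Sy (Dual ℂ h) ⊗[ℂ] W) = 0) := by
  obtain ⟨F, hF, hF'⟩ := exists_indIso_std D σ 0
  let F1 : (GrYRep.triv σ 0).ind D →ₗ[Cher D] std D σ := F.1
  let S : Submodule (Cher D) (std D σ) := sSup {N | (std D σ).IsHomogeneous N ∧ N ≠ ⊤}
  let π : std D σ →ₗ[Cher D] simple D σ := S.mkQ
  refine ⟨π ∘ₗ F1, (Submodule.mkQ_surjective S).comp hF.2, fun ht n f hn hfG hf w => ?_⟩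
  let j : W →ₗ[ℂ] (GrYRep.triv σ 0).ind D := TensorProduct.mk ℂ (Sy (Dual ℂ h)) W f
  let φ : W →ₗ[ℂ] std D σ := F1.restrictScalars ℂ ∘ₗ j
  have hg : ∀ g w, φ (σ g w) = Cher.g D g • φ w := fun g w => by
    have h1 : Cher.g D g • j w = j (σ g w) := by
      refine ((GrYRep.triv σ 0).g_smul_ind D g (j w)).trans ?_
      refine ((GrYRep.triv σ 0).opG_tmul g f w).trans ?_
      rw [hfG]
      rfl
    exact (congrArg F1 h1.symm).trans (F1.map_smul _ _)
  have hy : ∀ η w, Cher.y D η • φ w = 0 := fun η w => by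
    have h1 : Cher.y D η • j w = 0 := by
      refine ((GrYRep.triv σ 0).y_smul_ind D η (j w)).trans ?_
      refine ((GrYRep.triv σ 0).opY_tmul D η f w).trans ?_
      -- Without the derivative term a Dunkl operator consists of divided differences, which vanish
      -- on invariants.
      rw [ht, zero_smul, zero_sub, Finset.sum_eq_zero fun s _ => ?_, neg_zero, zero_add]
      · exact TensorProduct.tmul_zero _ _
      · rw [D.roots.divDiff_eq_zero s (hfG s.1), TensorProduct.zero_tmul, smul_zero]
    exact ((F1.map_smul _ _).symm.trans (congrArg F1 h1)).trans (map_zero F1)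
  have he : ∀ w, (std D σ).eul (φ w) = (n : ℂ) • φ w := fun w => by
    have h1 : ((GrYRep.triv σ 0).ind D).eul (j w) = (n : ℂ) • j w := by
      refine ((GrYRep.triv σ 0).eul_ind D (j w)).trans ?_
      change Sy.eul (Dual ℂ h) f ⊗ₜ[ℂ] w + f ⊗ₜ[ℂ] (((0 : ℤ) : ℂ) • w) = (n : ℂ) • f ⊗ₜ[ℂ] w
      rw [hf, Int.cast_zero, zero_smul, TensorProduct.tmul_zero, add_zero, ← TensorProduct.smul_tmul']
    have h2 := GrMod.eul_hom F (j w)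
    rw [h1] at h2
    refine (GrMod.eul_shift_zero _ _).symm.trans (h2.trans ?_)
    exact LinearMap.map_smul_of_tower F1 _ _
  obtain ⟨Φ, hΦ⟩ := (GrYRep.triv σ n).exists_indHom D (std D σ) φ hg
    (fun η w => (map_zero φ).trans (hy η w).symm) (fun w => by
      refine Eq.trans ?_ (he w).symm
      exact (map_smul φ ((n : ℤ) : ℂ) w).trans (by simp))
  -- The module induced from `σ` placed in degree `n > 0` starts in degree `n`, so its image cannot
  -- contain the generators of `M(σ)`.
  have hbot : ∀ z ∈ ((GrYRep.triv σ n).ind D).deg 0, z = 0 := fun z hz => by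
    obtain ⟨F', hF', -⟩ := exists_indIso_std D σ n
    have h0 : (std D σ).deg (0 - n) = ⊥ := deg_std_of_neg (by omega)
    have h1 : F'.1 z = 0 := (Submodule.mem_bot ℂ).1 (h0.le (F'.2 0 z hz))
    exact hF'.1 (h1.trans (map_zero F'.1).symm)
  have hne : LinearMap.range Φ.1 ≠ ⊤ := fun H => by
    obtain ⟨v, hv⟩ := exists_ne (0 : W)
    obtain ⟨z, hz⟩ : stdIns D σ v ∈ LinearMap.range Φ.1 := H ▸ trivial
    have h1 : (std D σ).proj 0 (stdIns D σ v) = stdIns D σ v := gradedProj_same _ (stdIns_mem D σ v)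
    have h2 := GrMod.proj_hom Φ 0 z
    have h3 : ((GrYRep.triv σ n).ind D).proj 0 z = 0 := hbot _ (gradedProj_mem _ 0 z)
    rw [h3, map_zero, hz, h1] at h2
    exact hv (stdIns_injective D σ (h2.trans (map_zero _).symm))
  have hle : LinearMap.range Φ.1 ≤ S := le_sSup ⟨GrMod.isHomogeneous_range Φ, hne⟩
  exact (Submodule.Quotient.mk_eq_zero S).2 (hle ⟨_, hΦ w⟩)

/-- For `t = 0`, the simple graded modules are finite dimensional. -/
theorem finite_simple (ht : D.t = 0) (σ : Representation ℂ G W) [FiniteDimensional ℂ W] (hσ : Nontrivial W) :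
    Module.Finite ℂ (simple D σ) := by
  obtain ⟨q, hq, hq0⟩ := exists_surjective_simple D σ hσ
  let q' : Sy (Dual ℂ h) ⊗[ℂ] W →ₗ[ℂ] simple D σ := q.restrictScalars ℂ
  have hqx : ∀ ξ f w, q' (f ⊗ₜ w) = 0 → q' ((Sy.ι ξ * f) ⊗ₜ w) = 0 := fun ξ f w H => by
    have h1 := q.map_smul (x D ξ) (f ⊗ₜ[ℂ] w : Sy (Dual ℂ h) ⊗[ℂ] W)
    have h2 := (GrYRep.triv σ 0).x_smul_ind D ξ (f ⊗ₜ[ℂ] w : Sy (Dual ℂ h) ⊗[ℂ] W)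
    refine (congrArg q h2.symm).trans (h1.trans ?_)
    change x D ξ • q' (f ⊗ₜ w) = 0
    rw [H, smul_zero]
  -- `I` contains the invariants of positive degree, hence by `Sy.exists_pow_eq_sum` the `|G|`-th
  -- power of every linear form. So `S(𝔥*)/I` is finite dimensional, and `L(σ)` is a quotient of
  -- `(S(𝔥*)/I) ⊗ σ`.
  let I : Ideal (Sy (Dual ℂ h)) :=
    { carrier := {f | ∀ w, q' (f ⊗ₜ w) = 0}
      add_mem' := fun {f f'} hf hf' w => by rw [TensorProduct.add_tmul, map_add, hf, hf', add_zero]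
      zero_mem' := fun w => by rw [TensorProduct.zero_tmul, map_zero]
      smul_mem' := fun f f' hf' w => by
        rw [smul_eq_mul]
        induction f using Sy.induction with
        | C a => rw [← MvPolynomial.smul_eq_C_mul, ← TensorProduct.smul_tmul', map_smul, hf', smul_zero]
        | add f g H H' => rw [add_mul, TensorProduct.add_tmul, map_add, H, H', add_zero]
        | mul ξ f H => rw [mul_assoc]; exact hqx _ _ _ H }
  have hI : ∀ ξ : Dual ℂ h, Sy.ι ξ ^ Nat.card G ∈ I := fun ξ => by
    obtain ⟨a, ha, he⟩ := Sy.exists_pow_eq_sum (reflRep G).dual ξ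
    rw [he]
    refine Ideal.sum_mem _ fun k hk => I.mul_mem_right _ ?_
    obtain ⟨h1, h2⟩ := ha k (Finset.mem_range.1 hk)
    exact Sy.mem_of_homogeneous_invariants (reflRep G).dual (I.restrictScalars ℂ)
      (fun n f hn hfG hf w => hq0 ht n f hn hfG hf w) h1 h2
  have := Sy.finite_quotient I _ hI
  have : Module.Finite ℂ (Sy (Dual ℂ h) ⧸ I.restrictScalars ℂ) :=
    Module.Finite.equiv (Submodule.Quotient.restrictScalarsEquiv ℂ I).symm
  let L : (Sy (Dual ℂ h) ⧸ I.restrictScalars ℂ) →ₗ[ℂ] W →ₗ[ℂ] simple D σ :=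
    (I.restrictScalars ℂ).liftQ (TensorProduct.curry q') fun f hf => LinearMap.ext fun w => hf w
  refine Module.Finite.of_surjective (TensorProduct.lift L) fun m => ?_
  obtain ⟨z, rfl⟩ := hq m
  refine ⟨((I.restrictScalars ℂ).mkQ ⊠ LinearMap.id) z, ?_⟩
  change _ = q' z
  induction z using TensorProduct.induction_on with
  | zero => rw [map_zero, map_zero, map_zero]
  | add z z' H H' => rw [map_add, map_add, map_add, H, H']
  | tmul f w => rfl

end Cher

end SimpleModule

end FiniteQuotient

/-! ### Assembly of the two formulas. -/

section Conclusion

open Module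

theorem Representation.IsIrreducible.nontrivial_space {G V : Type*} [Monoid G] [AddCommGroup V] [Module ℂ V]
    {ρ : Representation ℂ G V} (hρ : ρ.IsIrreducible) : Nontrivial V := by
  by_contra H
  rw [not_nontrivial_iff_subsingleton] at H
  obtain ⟨A, B, hAB⟩ := hρ.toNontrivial.exists_pair_ne
  exact hAB (by ext v; simp [Subsingleton.elim v 0])

end Conclusion

theorem GrMod.epgrDefined_of_hasExtEuler {h : Type u} [AddCommGroup h] [Module ℂ h] [FiniteDimensional ℂ h]
    {G : Subgroup (h ≃ₗ[ℂ] h)} [Finite G] {D : CherData G} {X Y : GrMod.{u, u} (Cher.deg D)} {N : ℕ} {e : ℤ → ℤ}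
    (H : ∀ γ, HasExtEuler.{u+1} (X.shift γ) Y N (e γ)) : GrMod.EPgrDefined X Y :=
  ⟨fun p γ => (H γ).finite p, N, fun p hp γ => (H γ).vanish p hp⟩

theorem corollaryc {h : Type u} [AddCommGroup h] [Module ℂ h] [FiniteDimensional ℂ h]
    (G : Subgroup (h ≃ₗ[ℂ] h)) [Finite G] (hG : IsIrredReflectionGroup G) (D : CherData G)
    {V W : Type u} [AddCommGroup V] [Module ℂ V] [FiniteDimensional ℂ V]
    [AddCommGroup W] [Module ℂ W] [FiniteDimensional ℂ W]
    (τ : Representation ℂ G V) (hτ : τ.IsIrreducible)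
    (σ : Representation ℂ G W) (hσ : σ.IsIrreducible) :
    (GrMod.EPgrDefined (Cher.std D τ) (Cher.std D σ) ∧
      GrMod.EPgr (Cher.std D τ) (Cher.std D σ) = Cher.delta τ σ) ∧
    (GrMod.EPgrDefined (Cher.std D τ) (Cher.simple D σ) ∧
      (∀ ε, FiniteDimensional ℂ (Cher.DiracCoh (Cher.simple D σ) ε)) ∧
      GrMod.EPgr (Cher.std D τ) (Cher.simple D σ) = Cher.diracIndexPoly D σ τ) := by
  let q : Cher.std D σ ⟶ Cher.simple D σ := GrMod.quotπ (Cher.std D σ) _ ((Cher.std D σ).isHomogeneous_sSup _ fun _ hN => hN.1)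
  have hq : Function.Surjective q.1 := Submodule.mkQ_surjective _
  have H1 := Cher.hasExtEuler_std_std D τ hτ σ hσ
  have H2 := Cher.hasExtEuler_of_surjective q hq τ hτ hσ
  refine ⟨⟨GrMod.epgrDefined_of_hasExtEuler H1, funext fun γ => (H1 γ).finsum_eq⟩,
    GrMod.epgrDefined_of_hasExtEuler H2, ?_, funext fun γ => (H2 γ).finsum_eq⟩
  have : Module.Finite ℂ (LinearMap.ker (Cher.dirac (Cher.simple D σ))) := by
    -- For `t = 0` the scalar by which `D²` acts no longer depends on the degree, so finiteness has
    -- to come from `L(σ)` itself.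
    by_cases ht : D.t = 0
    · have := Cher.finite_simple ht σ hσ.nontrivial_space
      infer_instance
    · exact Cher.finiteDimensional_ker_dirac ht hσ q hq
  exact Cher.finiteDimensional_diracCoh_of_ker _
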